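/- Throughout, logarithms are to base $2$ and the model is the word RAM: a fixed program (independent of $n$, of the word size and of the data) works on registers and memory cells that hold $w$-bit words; loading, storing, copying, loading a constant, unsigned addition, subtraction, multiplication and division with remainder, bitwise operations, shifts and comparisons of words, and each test of a branch or of a loop, take one step. Space is counted in words and includes the working space of the query algorithm. The word size is any $w\ge c\,(\lfloor\log n\rfloor+1)$ for a suitable absolute constant $c$. For $k\ge 0$ and $0<\rho<1$, an answer with additive error $k^{\rho}$ is an integer $k'\ge 0$ with $k-k^{\rho}\le k'\le k+k^{\rho}$ (so $k'=0$ if $k=0$). Theorem. Let $n\ge 4$ and let $P\subseteq\{1,\dots,n\}^2$ be a set of at most $n$ points. (1) There is a data structure for $P$ that uses $O(n\log^2 n)$ words of space and that, for every query point $q\in\{1,\dots,n\}^2$ and every real $\rho$ with $0<\rho<1$ chosen at query time, returns an answer with additive error $k^{\rho}$ in $O((1/\rho)\log\log n)$ time, where $k$ is the number of points of $P$ that dominate $q$, that is, whose coordinates are both greater than or equal to the corresponding coordinates of $q$. (2) There is a data structure for $P$ that uses $O(n\log^4 n)$ words of space and that, for every query rectangle $Q=[a_1,b_1]\times[a_2,b_2]$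 with $(a_1,a_2),(b_1,b_2)\in\{1,\dots,n\}^2$ and every real $\rho$ with $0<\rho<1$ chosen at query time, returns an answer with additive error $k^{\rho}$ in $O((1/\rho)\log\log n)$ time, where $k=|P\cap Q|$. In both parts the parameter $\rho$ is communicated to the query program as the integer $\lceil 1/\rho\rceil$ (or as the largest word $2^w-1$ if that integer does not fit into a word), the query leaves the data structure unchanged, and the constants in the $O$-bounds are absolute: they do not depend on $n$, $w$, $P$, the query or $\rho$. -/

import Mathlib

namespace WordRAM

/-- Binary operations on machine words. They are evaluated on `w`-bit words: arithmetic is unsigned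
and modulo `2 ^ w`, and the comparisons return the word `1` (true) or `0` (false). -/
inductive BinOp where
  | add | sub | mul | div | mod | and | or | xor | shl | shr | lt | eq

/-- The value of an operation on two `w`-bit words (a division by zero returns `0`, and a remainder
modulo zero returns the dividend). -/
def BinOp.eval {w : ℕ} (o : BinOp) (x y : BitVec w) : BitVec w :=
  match o with
  | .add => x + y
  | .sub => x - y
  | .mul => x * y
  | .div => x / y
  | .mod => x % y
  | .and => x &&& y
  | .or => x ||| y
  | .xor => x ^^^ y
  | .shl => x <<< y
  | .shr => x >>> y
  | .lt => if x.toNat < y.toNat then BitVec.ofNat w 1 else BitVec.ofNat w 0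
  | .eq => if x = y then BitVec.ofNat w 1 else BitVec.ofNat w 0

/-- Programs of the word RAM. A program is a finite text that does not depend on the word size and
mentions finitely many registers; registers are numbered, and memory is addressed indirectly through
registers. -/
inductive Prog where
  /-- `const d c`: register `d` receives the constant `c` (modulo `2 ^ w`). -/
  | const (d c : ℕ)
  /-- `move d a`: register `d` receives the content of register `a`. -/
  | move (d a : ℕ)
  /-- `op o d a b`: register `d` receives the result of `o` on registers `a` and `b`. -/
  | op (o : BinOp) (d a b : ℕ)
  /-- `load d a`: register `d` receives the memory cell whose address is in register `a`. -/
  | load (d a : ℕ)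
  /-- `store a b`: the memory cell whose address is in register `a` receives register `b`. -/
  | store (a b : ℕ)
  /-- Sequential composition. -/
  | seq (p q : Prog)
  /-- `ite a p q`: run `p` if register `a` is nonzero, and `q` otherwise. -/
  | ite (a : ℕ) (p q : Prog)
  /-- `loop a p`: while register `a` is nonzero, run `p`. -/
  | loop (a : ℕ) (p : Prog)

/-- A configuration: contents of the registers and of the memory cells, all of them `w`-bit words. -/
@[ext] structure State (w : ℕ) where
  reg : ℕ → BitVec w
  mem : ℕ → BitVec w

/-- Write the word `v` to register `d`. -/
def State.setReg {w : ℕ} (s : State w) (d : ℕ) (v : BitVec w) : State w :=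
  { s with reg := Function.update s.reg d v }

/-- Write the word `v` to memory cell `i`. -/
def State.setMem {w : ℕ} (s : State w) (i : ℕ) (v : BitVec w) : State w :=
  { s with mem := Function.update s.mem i v }

/-- `Exec w M p s t s'`: on the machine with `w`-bit words and with `M` memory cells, numbered
`0, …, M - 1`, the program `p`, started in configuration `s`, halts after exactly `t` steps in
configuration `s'`. Every instruction and every test of a branch or of a loop is one step. An access
to an address that is not below `M` is a fault: there is then no halting run. -/
inductive Exec (w M : ℕ) : Prog → State w → ℕ → State w → Prop where
  | const (s : State w) (d c : ℕ) :
      Exec w M (.const d c) s 1 (s.setReg d (BitVec.ofNat w c))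
  | move (s : State w) (d a : ℕ) :
      Exec w M (.move d a) s 1 (s.setReg d (s.reg a))
  | op (s : State w) (o : BinOp) (d a b : ℕ) :
      Exec w M (.op o d a b) s 1 (s.setReg d (o.eval (s.reg a) (s.reg b)))
  | load (s : State w) (d a : ℕ) (h : (s.reg a).toNat < M) :
      Exec w M (.load d a) s 1 (s.setReg d (s.mem (s.reg a).toNat))
  | store (s : State w) (a b : ℕ) (h : (s.reg a).toNat < M) :
      Exec w M (.store a b) s 1 (s.setMem (s.reg a).toNat (s.reg b))
  | seq {p q : Prog} {s s' s'' : State w} {t t' : ℕ}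
      (hp : Exec w M p s t s') (hq : Exec w M q s' t' s'') :
      Exec w M (.seq p q) s (t + t') s''
  | ite_true {a : ℕ} {p q : Prog} {s s' : State w} {t : ℕ}
      (h : s.reg a ≠ 0) (hp : Exec w M p s t s') :
      Exec w M (.ite a p q) s (1 + t) s'
  | ite_false {a : ℕ} {p q : Prog} {s s' : State w} {t : ℕ}
      (h : s.reg a = 0) (hq : Exec w M q s t s') :
      Exec w M (.ite a p q) s (1 + t) s'
  | loop_done {a : ℕ} {p : Prog} {s : State w} (h : s.reg a = 0) :
      Exec w M (.loop a p) s 1 s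
  | loop_step {a : ℕ} {p : Prog} {s s' s'' : State w} {t t' : ℕ}
      (h : s.reg a ≠ 0) (hp : Exec w M p s t s') (hl : Exec w M (.loop a p) s' t' s'') :
      Exec w M (.loop a p) s (1 + t + t') s''

/-- The configuration with memory `mem` in which the query is in registers `0, 1, 2, …` and all other
registers are `0`. -/
def State.init {w : ℕ} (query : List ℕ) (mem : ℕ → BitVec w) : State w where
  reg i := BitVec.ofNat w (query.getD i 0)
  mem := mem

/-- The memory `mem` holds the words of `data` in its first cells. -/
def Holds {w : ℕ} (mem : ℕ → BitVec w) (data : List (BitVec w)) : Prop :=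
  ∀ (i : ℕ) (h : i < data.length), mem i = data[i]

/-- On the machine with `M` cells of `w` bits, the query program `p` answers the query `query` on the
stored data structure `data` in at most `T` steps, with an answer (returned in register `0`) that
satisfies `Correct`. The cells behind `data` are working space, whose content at the start is
arbitrary; the data structure itself is unchanged at the end, hence ready for the next query. -/
def Answers {w : ℕ} (M : ℕ) (p : Prog) (data : List (BitVec w)) (query : List ℕ) (T : ℝ)
    (Correct : ℕ → Prop) : Prop :=
  ∀ mem : ℕ → BitVec w, Holds mem data →
    ∃ (t : ℕ) (s : State w), Exec w M p (State.init query mem) t s ∧ (t : ℝ) ≤ T ∧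
      Correct (s.reg 0).toNat ∧ Holds s.mem data

end WordRAM

namespace ApproxCounting

/-- The word through which a query tells the machine the real parameter `ρ ∈ (0, 1)`: the integer
`⌈1 / ρ⌉`, or the largest word if that integer does not fit into a word. A machine that is given more
(for instance `ρ` as a fraction of two words) can compute it with one division. -/
noncomputable def precisionWord (w : ℕ) (ρ : ℝ) : ℕ :=
  min ⌈1 / ρ⌉₊ (2 ^ w - 1)

/-- `k'` approximates `k` with additive error `k ^ ρ`. -/
def IsApprox (ρ : ℝ) (k k' : ℕ) : Prop :=
  (k : ℝ) - (k : ℝ) ^ ρ ≤ (k' : ℝ) ∧ (k' : ℝ) ≤ (k : ℝ) + (k : ℝ) ^ ρ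

/-- The `n × n` grid `{1, …, n} × {1, …, n}`. -/
def grid (n : ℕ) : Finset (ℕ × ℕ) :=
  Finset.Icc 1 n ×ˢ Finset.Icc 1 n

/-- The number of points of `P` that dominate `q`. -/
def domCount (P : Finset (ℕ × ℕ)) (q : ℕ × ℕ) : ℕ :=
  (P.filter fun p => q.1 ≤ p.1 ∧ q.2 ≤ p.2).card

/-- The number of points of `P` in the rectangle `[l.1, u.1] × [l.2, u.2]`. -/
def rangeCount (P : Finset (ℕ × ℕ)) (l u : ℕ × ℕ) : ℕ :=
  (P.filter fun p => (l.1 ≤ p.1 ∧ p.1 ≤ u.1) ∧ (l.2 ≤ p.2 ∧ p.2 ≤ u.2)).card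

end ApproxCounting

/-! Dominance counting. A perturbation puts the points in general position, and coordinates are
replaced by ranks. For the levels `T = 2 ^ 2 ^ j` a table records, for each x-rank, the height at
which at most `T` dominating points remain. Comparing the query height with these thresholds yields
the least level with `k ≤ T`, so `2 ^ 2 ^ i < k` for all smaller `i` (`lt_threshold_iff`,
`card_levels`). A shallow cutting then localizes the query: a cell consists of `T` consecutive
x-ranks and the `T` highest points to their right. It has at most `2 * T` points and contains all
dominating points (`dominators_subset_cell`), and all cells of one level together have at most twice
as many points as the set (`sum_card_cell_le`).

Inside a cell the answer is the number of points of an x-suffix whose y-rank is at least some `b`.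
The y-ranks are read in digits of `e` bits, from the top. At each tree node, for every suffix length
that is a multiple of `2 ^ (e - 1)`, tables give the number of suffix points with a larger digit and
with the same digit. The descent rounds the current suffix down to such a multiple, adds the first
number and continues with the second (`DescentInv.step`). A round loses at most `2 ^ (e - 1) - 1`
points, so the answer is a lower bound; with `e = 1` it is exact. Taking for `e` the power of two
near `2 ^ j / (R * (j + 3))`, where `R` is about `1 / ρ`, makes the number of rounds `O(R * (j +
3))` (`GoodWidth.rounds_le`) and the total loss at most `k ^ ρ / 4` (`GoodWidth.error_le`), because
`k > 2 ^ 2 ^ (j - 1)`.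

For fixed width and depth the nonzero table entries can be charged to the points of the cell, two to
each (`exists_charge`). Ranks are found by binary search over the levels of a trie
(`rank_eq_of_trie`), in `O(log log n)` rounds. All entries, over all tables, live in a single static
two-level perfect hash table of linear size (`exists_dict`), so the space is governed by the number
of nonzero entries (`card_allKeys_le`).

Range counting. The bounds of a nonempty interval separate at one level of the binary trie: the
lower bound is then in a left child, the upper one in the sibling. In either child only one bound is
effective, and reflecting right children makes it a lower bound (`IsSplit.between_iff`). Doing this
in both coordinates turns a rectangle into four dominance queries on sets indexed by pairs of trie
nodes; each point is in at most `L * L` of these, where `L` is the bit length, which costs another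
factor `log² n` of space. Four errors of a quarter each give the claimed error.

The machine level is handled by compiling expressions to programs and by a small program logic
`Runs` over natural numbers. -/

namespace WordRAM

/-! ### Expressions, their compilation, and a program logic with step counts -/

/-- Arithmetic expressions over registers, constants and memory cells. -/
inductive Expr where
  | reg (i : ℕ)
  | const (c : ℕ)
  | bin (o : BinOp) (a b : Expr)
  | load (a : Expr)

/-- The operations on natural numbers that the operations on words implement when nothing
overflows. -/
def BinOp.natEval (o : BinOp) (x y : ℕ) : ℕ :=
  match o with
  | .add => x + y
  | .sub => x - y
  | .mul => x * y
  | .div => x / y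
  | .mod => x % y
  | .and => x &&& y
  | .or => x ||| y
  | .xor => x ^^^ y
  | .shl => x * 2 ^ y
  | .shr => x / 2 ^ y
  | .lt => if x < y then 1 else 0
  | .eq => if x = y then 1 else 0

/-- The operation does not overflow on `w`-bit words. -/
def BinOp.Fits (w : ℕ) (o : BinOp) (x y : ℕ) : Prop :=
  match o with
  | .add => x + y < 2 ^ w
  | .sub => y ≤ x
  | .mul => x * y < 2 ^ w
  | .shl => x * 2 ^ y < 2 ^ w
  | _ => True

theorem BinOp.toNat_eval {w : ℕ} (hw : 0 < w) (o : BinOp) (x y : BitVec w)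
    (h : o.Fits w x.toNat y.toNat) : (o.eval x y).toNat = o.natEval x.toNat y.toNat := by
  have h1 : 1 < 2 ^ w := Nat.one_lt_two_pow hw.ne'
  cases o <;> simp only [BinOp.eval, BinOp.natEval, BinOp.Fits] at *
  · rw [BitVec.toNat_add, Nat.mod_eq_of_lt h]
  · exact BitVec.toNat_sub_of_le h
  · rw [BitVec.toNat_mul, Nat.mod_eq_of_lt h]
  · exact BitVec.toNat_udiv
  · exact BitVec.toNat_umod
  · exact BitVec.toNat_and x y
  · exact BitVec.toNat_or x y
  · exact BitVec.toNat_xor x y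
  · rw [BitVec.shiftLeft_eq', BitVec.toNat_shiftLeft, Nat.shiftLeft_eq, Nat.mod_eq_of_lt h]
  · rw [BitVec.ushiftRight_eq', BitVec.toNat_ushiftRight, Nat.shiftRight_eq_div_pow]
  · split_ifs <;> simp [Nat.mod_eq_of_lt h1]
  · by_cases hxy : x = y
    · simp [hxy, Nat.mod_eq_of_lt h1]
    · have : x.toNat ≠ y.toNat := fun h => hxy (BitVec.eq_of_toNat_eq h)
      simp [hxy, this]

namespace Expr

instance : Add Expr := ⟨bin .add⟩
instance : Sub Expr := ⟨bin .sub⟩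
instance : Mul Expr := ⟨bin .mul⟩
instance : Div Expr := ⟨bin .div⟩
instance : Mod Expr := ⟨bin .mod⟩

/-- The value of an expression in a memory `μ` and registers `σ`. -/
def eval (μ σ : ℕ → ℕ) : Expr → ℕ
  | reg i => σ i
  | const c => c
  | bin o a b => o.natEval (a.eval μ σ) (b.eval μ σ)
  | load a => μ (a.eval μ σ)

/-- The evaluation of the expression neither overflows nor leaves the memory. -/
def Safe (w M : ℕ) (μ σ : ℕ → ℕ) : Expr → Prop
  | reg i => i < 64
  | const c => c < 2 ^ w
  | bin o a b => a.Safe w M μ σ ∧ b.Safe w M μ σ ∧ o.Fits w (a.eval μ σ) (b.eval μ σ)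
  | load a => a.Safe w M μ σ ∧ a.eval μ σ < M

/-- Evaluate an expression into register `k`, using registers from `k` on as temporaries. -/
def compile : Expr → ℕ → Prog
  | reg i, k => .move k i
  | const c, k => .const k c
  | bin o a b, k => .seq (a.compile k) (.seq (b.compile (k + 1)) (.op o k k (k + 1)))
  | load a, k => .seq (a.compile k) (.load k k)

/-- The number of steps of the compiled expression. -/
def cost : Expr → ℕ
  | reg _ => 1
  | const _ => 1
  | bin _ a b => a.cost + (b.cost + 1)
  | load a => a.cost + 1

section simp_lemmas
variable (μ σ : ℕ → ℕ) (a b : Expr)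

@[simp] theorem eval_reg (i : ℕ) : (reg i).eval μ σ = σ i := rfl
@[simp] theorem eval_const (c : ℕ) : (const c).eval μ σ = c := rfl
@[simp] theorem eval_load : (load a).eval μ σ = μ (a.eval μ σ) := rfl
@[simp] theorem eval_add : (a + b).eval μ σ = a.eval μ σ + b.eval μ σ := rfl
@[simp] theorem eval_sub : (a - b).eval μ σ = a.eval μ σ - b.eval μ σ := rfl
@[simp] theorem eval_mul : (a * b).eval μ σ = a.eval μ σ * b.eval μ σ := rfl
@[simp] theorem eval_div : (a / b).eval μ σ = a.eval μ σ / b.eval μ σ := rfl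
@[simp] theorem eval_mod : (a % b).eval μ σ = a.eval μ σ % b.eval μ σ := rfl
@[simp] theorem eval_shl : (bin .shl a b).eval μ σ = a.eval μ σ * 2 ^ b.eval μ σ := rfl
@[simp] theorem eval_shr : (bin .shr a b).eval μ σ = a.eval μ σ / 2 ^ b.eval μ σ := rfl
@[simp] theorem eval_lt :
    (bin .lt a b).eval μ σ = if a.eval μ σ < b.eval μ σ then 1 else 0 := rfl
@[simp] theorem eval_eq :
    (bin .eq a b).eval μ σ = if a.eval μ σ = b.eval μ σ then 1 else 0 := rfl

theorem cost_add : (a + b).cost = a.cost + (b.cost + 1) := rfl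
theorem cost_sub : (a - b).cost = a.cost + (b.cost + 1) := rfl
theorem cost_div : (a / b).cost = a.cost + (b.cost + 1) := rfl

variable (w M : ℕ)

@[simp] theorem safe_reg (i : ℕ) : (reg i).Safe w M μ σ ↔ i < 64 := Iff.rfl
@[simp] theorem safe_const (c : ℕ) : (const c).Safe w M μ σ ↔ c < 2 ^ w := Iff.rfl
@[simp] theorem safe_load : (load a).Safe w M μ σ ↔ a.Safe w M μ σ ∧ a.eval μ σ < M := Iff.rfl
@[simp] theorem safe_add : (a + b).Safe w M μ σ ↔
    a.Safe w M μ σ ∧ b.Safe w M μ σ ∧ a.eval μ σ + b.eval μ σ < 2 ^ w := Iff.rfl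
@[simp] theorem safe_sub : (a - b).Safe w M μ σ ↔
    a.Safe w M μ σ ∧ b.Safe w M μ σ ∧ b.eval μ σ ≤ a.eval μ σ := Iff.rfl
@[simp] theorem safe_mul : (a * b).Safe w M μ σ ↔
    a.Safe w M μ σ ∧ b.Safe w M μ σ ∧ a.eval μ σ * b.eval μ σ < 2 ^ w := Iff.rfl
@[simp] theorem safe_div : (a / b).Safe w M μ σ ↔ a.Safe w M μ σ ∧ b.Safe w M μ σ :=
  ⟨fun h => ⟨h.1, h.2.1⟩, fun h => ⟨h.1, h.2, trivial⟩⟩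
@[simp] theorem safe_mod : (a % b).Safe w M μ σ ↔ a.Safe w M μ σ ∧ b.Safe w M μ σ :=
  ⟨fun h => ⟨h.1, h.2.1⟩, fun h => ⟨h.1, h.2, trivial⟩⟩
@[simp] theorem safe_shl : (bin .shl a b).Safe w M μ σ ↔
    a.Safe w M μ σ ∧ b.Safe w M μ σ ∧ a.eval μ σ * 2 ^ b.eval μ σ < 2 ^ w := Iff.rfl
@[simp] theorem safe_shr : (bin .shr a b).Safe w M μ σ ↔ a.Safe w M μ σ ∧ b.Safe w M μ σ :=
  ⟨fun h => ⟨h.1, h.2.1⟩, fun h => ⟨h.1, h.2, trivial⟩⟩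
@[simp] theorem safe_lt : (bin .lt a b).Safe w M μ σ ↔ a.Safe w M μ σ ∧ b.Safe w M μ σ :=
  ⟨fun h => ⟨h.1, h.2.1⟩, fun h => ⟨h.1, h.2, trivial⟩⟩
@[simp] theorem safe_eq : (bin .eq a b).Safe w M μ σ ↔ a.Safe w M μ σ ∧ b.Safe w M μ σ :=
  ⟨fun h => ⟨h.1, h.2.1⟩, fun h => ⟨h.1, h.2, trivial⟩⟩

end simp_lemmas

/-- The second operand is computed from register `k + 1` on, so it does not destroy the first one in
register `k`; since `64 ≤ k`, the registers that expressions may mention are never temporaries. -/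
theorem exec_compile {w M : ℕ} (hw : 0 < w) {μ σ : ℕ → ℕ} (e : Expr) :
    ∀ (k : ℕ) (s : State w), 64 ≤ k → (∀ i < M, (s.mem i).toNat = μ i) →
      (∀ i < 64, (s.reg i).toNat = σ i) → e.Safe w M μ σ →
      ∃ s', Exec w M (e.compile k) s e.cost s' ∧ s'.mem = s.mem ∧
        (∀ i < k, s'.reg i = s.reg i) ∧ (s'.reg k).toNat = e.eval μ σ := by
  induction e with
  | reg i =>
    intro k s hk hμ hσ hs
    refine ⟨_, .move _ _ _, rfl, fun i hi => ?_, ?_⟩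
    · simp [State.setReg, Function.update_of_ne hi.ne]
    · simpa [State.setReg] using hσ i hs
  | const c =>
    intro k s hk hμ hσ hs
    refine ⟨_, .const _ _ _, rfl, fun i hi => ?_, ?_⟩
    · simp [State.setReg, Function.update_of_ne hi.ne]
    · simpa [State.setReg] using Nat.mod_eq_of_lt hs
  | bin o a b iha ihb =>
    intro k s hk hμ hσ hs
    obtain ⟨ha, hb, hf⟩ := hs
    obtain ⟨s1, e1, m1, r1, v1⟩ := iha k s hk hμ hσ ha
    obtain ⟨s2, e2, m2, r2, v2⟩ := ihb (k + 1) s1 (by omega) (by rwa [m1])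
      (fun i hi => by rw [r1 i (by omega)]; exact hσ i hi) hb
    refine ⟨_, .seq e1 (.seq e2 (.op _ _ _ _ _)), by simp [State.setReg, m1, m2],
      fun i hi => ?_, ?_⟩
    · simp only [State.setReg, Function.update_of_ne hi.ne]
      rw [r2 i (by omega), r1 i hi]
    · simp only [State.setReg, Function.update_self]
      rw [r2 k (by omega), BinOp.toNat_eval hw, v1, v2]
      · rfl
      · rwa [v1, v2]
  | load a iha =>
    intro k s hk hμ hσ hs
    obtain ⟨s1, e1, m1, r1, v1⟩ := iha k s hk hμ hσ hs.1
    refine ⟨_, .seq e1 (.load _ _ _ (by rw [v1]; exact hs.2)), by simp [State.setReg, m1],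
      fun i hi => ?_, ?_⟩
    · simp [State.setReg, Function.update_of_ne hi.ne, r1 i hi]
    · simp only [State.setReg, Function.update_self]
      rw [v1, m1]
      exact hμ _ hs.2

end Expr

/-- Assign the value of `e` to register `d`. -/
def asg (d : ℕ) (e : Expr) : Prog := .seq (e.compile 64) (.move d 64)

/-- Run `p` as often as register `c` says, counting `c` down to `0`. -/
def rep (c : ℕ) (p : Prog) : Prog := .loop c (.seq p (asg c (.reg c - .const 1)))

/-- On every configuration with memory `μ` and with the registers below `64` given by `σ`, the
program `p` halts within `t` steps, leaves the memory unchanged, and the final registers below `64`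
are given by a function that satisfies `Q`. -/
def Runs (w M : ℕ) (μ : ℕ → ℕ) (p : Prog) (σ : ℕ → ℕ) (t : ℕ) (Q : (ℕ → ℕ) → Prop) : Prop :=
  ∀ s : State w, (∀ i < M, (s.mem i).toNat = μ i) → (∀ i < 64, (s.reg i).toNat = σ i) →
    ∃ t' ≤ t, ∃ (s' : State w) (σ' : ℕ → ℕ), Exec w M p s t' s' ∧ s'.mem = s.mem ∧
      (∀ i < 64, (s'.reg i).toNat = σ' i) ∧ Q σ'

namespace Runs
variable {w M : ℕ} {μ : ℕ → ℕ}

theorem mono {p : Prog} {σ : ℕ → ℕ} {t t' : ℕ} {Q Q' : (ℕ → ℕ) → Prop}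
    (h : Runs w M μ p σ t Q) (ht : t ≤ t') (hQ : ∀ σ', Q σ' → Q' σ') : Runs w M μ p σ t' Q' := by
  intro s hμ hσ
  obtain ⟨t1, ht1, s', σ', h1, h2, h3, h4⟩ := h s hμ hσ
  exact ⟨t1, ht1.trans ht, s', σ', h1, h2, h3, hQ _ h4⟩

theorem asg (hw : 0 < w) {d : ℕ} (hd : d < 64) {e : Expr} {σ : ℕ → ℕ} (he : e.Safe w M μ σ) :
    Runs w M μ (asg d e) σ (e.cost + 1) (fun σ' => σ' = Function.update σ d (e.eval μ σ)) := by
  intro s hμ hσ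
  obtain ⟨s1, e1, m1, r1, v1⟩ := Expr.exec_compile hw e 64 s le_rfl hμ hσ he
  refine ⟨_, le_rfl, _, _, .seq e1 (.move _ _ _), by simp [State.setReg, m1], fun i hi => ?_, rfl⟩
  by_cases h : i = d
  · subst h; simp [State.setReg, v1]
  · simp [State.setReg, Function.update_of_ne h, r1 i hi, hσ i hi]

theorem seq {p q : Prog} {σ : ℕ → ℕ} {t t' : ℕ} {P Q : (ℕ → ℕ) → Prop}
    (hp : Runs w M μ p σ t P) (hq : ∀ σ', P σ' → Runs w M μ q σ' t' Q) :
    Runs w M μ (.seq p q) σ (t + t') Q := by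
  intro s hμ hσ
  obtain ⟨t1, ht1, s1, σ1, e1, m1, r1, q1⟩ := hp s hμ hσ
  obtain ⟨t2, ht2, s2, σ2, e2, m2, r2, q2⟩ := hq σ1 q1 s1 (by rwa [m1]) r1
  exact ⟨_, add_le_add ht1 ht2, s2, σ2, .seq e1 e2, by rw [m2, m1], r2, q2⟩

/-- The value `v` is supplied by the caller, so that the state after a chain of assignments is a
chain of updates by readable numbers. -/
theorem asg_seq (hw : 0 < w) {d : ℕ} {e : Expr} {σ : ℕ → ℕ} {q : Prog} {t : ℕ}
    {Q : (ℕ → ℕ) → Prop} (v : ℕ) (hd : d < 64) (he : e.Safe w M μ σ) (hv : e.eval μ σ = v)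
    (hq : Runs w M μ q (Function.update σ d v) t Q) :
    Runs w M μ (.seq (WordRAM.asg d e) q) σ (e.cost + 1 + t) Q :=
  seq (asg hw hd he) (by rintro _ rfl; rwa [hv])

theorem asg_of (hw : 0 < w) {d : ℕ} {e : Expr} {σ : ℕ → ℕ} {Q : (ℕ → ℕ) → Prop} (v : ℕ)
    (hd : d < 64) (he : e.Safe w M μ σ) (hv : e.eval μ σ = v) (hq : Q (Function.update σ d v)) :
    Runs w M μ (WordRAM.asg d e) σ (e.cost + 1) Q :=
  (asg hw hd he).mono le_rfl (by rintro _ rfl; rwa [hv])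

/-- The invariant is indexed by the number of remaining rounds. Each round costs the body, one test
and four steps for the decrement; the final test is the last summand. -/
theorem rep (hw : 0 < w) {c : ℕ} (hc : c < 64) {p : Prog} {t : ℕ} (I : ℕ → (ℕ → ℕ) → Prop)
    (hstep : ∀ k τ, I (k + 1) τ → τ c = k + 1 →
      Runs w M μ p τ t (fun τ' => τ' c = k + 1 ∧ I k (Function.update τ' c k))) :
    ∀ (m : ℕ) (σ : ℕ → ℕ), σ c = m → I m σ →
      Runs w M μ (rep c p) σ (m * (t + 5) + 1) (fun σ' => I 0 σ' ∧ σ' c = 0) := by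
  intro m
  have h1 : 1 < 2 ^ w := Nat.one_lt_two_pow hw.ne'
  induction m with
  | zero =>
    intro σ hσc hI s hμ hσ
    refine ⟨1, by omega, s, σ, .loop_done ?_, rfl, hσ, hI, hσc⟩
    apply BitVec.eq_of_toNat_eq
    rw [hσ c hc, hσc]; simp
  | succ m ih =>
    intro σ hσc hI s hμ hσ
    have hb : Runs w M μ (.seq p (WordRAM.asg c (.reg c - .const 1))) σ (t + 4)
        (fun τ => τ c = m ∧ I m τ) := by
      refine seq (hstep m σ hI hσc) (fun τ' h => ?_)
      refine asg_of hw m hc ?_ ?_ ?_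
      · simp [hc, h.1, h1]
      · simp [h.1]
      · simpa using h.2
    obtain ⟨t1, ht1, s1, σ1, e1, m1, r1, q1⟩ := hb s hμ hσ
    obtain ⟨t2, ht2, s2, σ2, e2, m2, r2, q2⟩ := ih σ1 q1.1 q1.2 s1 (by rwa [m1]) r1
    refine ⟨_, ?_, s2, σ2, .loop_step ?_ e1 e2, by rw [m2, m1], r2, q2⟩
    · rw [add_mul]; omega
    · intro h0
      have := hσ c hc
      rw [h0, hσc] at this
      simp at this

end Runs

end WordRAM

/-! ### Static perfect hashing in two levels -/

namespace WordRAM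

/-- The hash function with prime `p`, range `s` and multiplier `a`. -/
def hash (p s a x : ℕ) : ℕ := a * x % p % s

theorem hash_lt {p s a x : ℕ} (hs : 0 < s) : hash p s a x < s := Nat.mod_lt _ hs

/-- For a collision, the difference of the residues of `a * x` and `a * y` modulo `p` is a nonzero
multiple of `s` between `-p` and `p`; it determines `a`, being congruent to `a * (x - y)`. There are
at most `2 * ((p - 1) / s)` such multiples. -/
theorem card_hash_eq_mul_le {p : ℕ} (hp : p.Prime) {s x y : ℕ} (hs : 0 < s) (hx : x < p)
    (hy : y < p) (hxy : x ≠ y) :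
    ((Finset.Ico 1 p).filter fun a => hash p s a x = hash p s a y).card * s ≤ 2 * (p - 1) := by
  have := Fact.mk hp
  set f : ℕ → ℤ := fun a => ((a * x % p : ℕ) : ℤ) - ((a * y % p : ℕ) : ℤ) with hf
  have hcast : ∀ a, ((f a : ℤ) : ZMod p) = (a : ZMod p) * ((x : ZMod p) - y) := by
    intro a
    simp only [hf]
    push_cast
    ring
  have hxy' : ((x : ZMod p) - y) ≠ 0 := by
    intro h
    rw [sub_eq_zero, ZMod.natCast_eq_natCast_iff'] at h
    rw [Nat.mod_eq_of_lt hx, Nat.mod_eq_of_lt hy] at h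
    exact hxy h
  set A := (Finset.Ico 1 p).filter fun a => hash p s a x = hash p s a y
  -- Absolute quotient and sign parametrize the possible differences.
  set g : ℕ × Bool → ℤ := fun q => if q.2 then (q.1 * s : ℤ) else -(q.1 * s : ℤ)
  have himg : A.image f ⊆ ((Finset.Icc 1 ((p - 1) / s)) ×ˢ Finset.univ).image g := by
    intro z hz
    obtain ⟨a, ha, rfl⟩ := Finset.mem_image.1 hz
    obtain ⟨ha1, ha2⟩ := Finset.mem_filter.1 ha
    rw [Finset.mem_Ico] at ha1
    have hne : f a ≠ 0 := by
      intro h0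
      have := hcast a
      rw [h0] at this
      simp only [Int.cast_zero] at this
      rcases mul_eq_zero.1 this.symm with h | h
      · rw [ZMod.natCast_eq_zero_iff] at h
        have := Nat.le_of_dvd (by omega) h
        omega
      · exact hxy' h
    have hdvd : (s : ℤ) ∣ f a := by
      have : ((a * y % p : ℕ) : ℤ) ≡ ((a * x % p : ℕ) : ℤ) [ZMOD s] := by
        rw [Int.natCast_modEq_iff]
        exact ha2.symm
      exact this.dvd
    have hb1 : a * x % p < p := Nat.mod_lt _ hp.pos
    have hb2 : a * y % p < p := Nat.mod_lt _ hp.pos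
    obtain ⟨t, ht⟩ := hdvd
    have habs : f a < p ∧ -f a < p := by simp only [hf]; omega
    have hs' : (0 : ℤ) < s := by exact_mod_cast hs
    rw [Finset.mem_image]
    rcases lt_trichotomy t 0 with h | h | h
    · refine ⟨(t.natAbs, false), ?_, ?_⟩
      · simp only [Finset.mem_product, Finset.mem_Icc, Finset.mem_univ, and_true]
        refine ⟨by omega, ?_⟩
        rw [Nat.le_div_iff_mul_le hs]
        have : ((t.natAbs * s : ℕ) : ℤ) < p := by
          push_cast
          rw [abs_of_neg h]
          nlinarith
        have : t.natAbs * s < p := by exact_mod_cast this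
        omega
      · simp only [g, Bool.false_eq_true, if_false]
        rw [ht, Int.natCast_natAbs, abs_of_neg h]; ring
    · subst h; simp at ht; exact absurd ht hne
    · refine ⟨(t.natAbs, true), ?_, ?_⟩
      · simp only [Finset.mem_product, Finset.mem_Icc, Finset.mem_univ, and_true]
        refine ⟨by omega, ?_⟩
        rw [Nat.le_div_iff_mul_le hs]
        have : ((t.natAbs * s : ℕ) : ℤ) < p := by
          push_cast
          rw [abs_of_pos h]
          nlinarith
        have : t.natAbs * s < p := by exact_mod_cast this
        omega
      · simp only [g, if_true]
        rw [ht, Int.natCast_natAbs, abs_of_pos h]; ring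
  have hinj : Set.InjOn f A := by
    intro a ha b hb hab
    have ha1 := Finset.mem_Ico.1 (Finset.mem_filter.1 ha).1
    have hb1 := Finset.mem_Ico.1 (Finset.mem_filter.1 hb).1
    have h1 := hcast a
    rw [hab, hcast b] at h1
    have h2 := mul_right_cancel₀ hxy' h1
    rw [ZMod.natCast_eq_natCast_iff', Nat.mod_eq_of_lt ha1.2, Nat.mod_eq_of_lt hb1.2] at h2
    exact h2.symm
  have hcard : A.card ≤ 2 * ((p - 1) / s) := by
    rw [← Finset.card_image_of_injOn hinj]
    refine (Finset.card_le_card himg).trans (Finset.card_image_le.trans ?_)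
    simp [Finset.card_product, mul_comm]
  calc A.card * s ≤ 2 * ((p - 1) / s) * s := Nat.mul_le_mul_right _ hcard
    _ = 2 * ((p - 1) / s * s) := by ring
    _ ≤ 2 * (p - 1) := Nat.mul_le_mul_left _ (Nat.div_mul_le_self _ _)

/-- A multiplier with few collisions. -/
theorem exists_hash {p : ℕ} (hp : p.Prime) (K : Finset ℕ) (hK : ∀ x ∈ K, x < p) {s : ℕ}
    (hs : 0 < s) : ∃ a < p,
      (K.offDiag.filter fun q => hash p s a q.1 = hash p s a q.2).card * s
        ≤ 2 * K.offDiag.card := by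
  by_contra! hcon
  -- Averaging over the nonzero multipliers: if each had too many collisions, double counting would
  -- contradict the bound for single pairs.
  have h1 : ∑ a ∈ Finset.Ico 1 p,
      (K.offDiag.filter fun q => hash p s a q.1 = hash p s a q.2).card
      = ∑ q ∈ K.offDiag, ((Finset.Ico 1 p).filter
        fun a => hash p s a q.1 = hash p s a q.2).card := by
    simp only [Finset.card_filter]
    exact Finset.sum_comm
  have h2 : (∑ q ∈ K.offDiag, ((Finset.Ico 1 p).filter
        fun a => hash p s a q.1 = hash p s a q.2).card) * s ≤ K.offDiag.card * (2 * (p - 1)) := by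
    rw [Finset.sum_mul, ← smul_eq_mul]
    refine Finset.sum_le_card_nsmul _ _ _ fun q hq => ?_
    obtain ⟨hq1, hq2, hq3⟩ := Finset.mem_offDiag.1 hq
    exact card_hash_eq_mul_le hp hs (hK _ hq1) (hK _ hq2) hq3
  have h3 : (Finset.Ico 1 p).card • (2 * K.offDiag.card + 1) ≤ ∑ a ∈ Finset.Ico 1 p,
      (K.offDiag.filter fun q => hash p s a q.1 = hash p s a q.2).card * s :=
    Finset.card_nsmul_le_sum _ _ _ fun a ha => hcon a (Finset.mem_Ico.1 ha).2
  rw [← Finset.sum_mul, h1, Nat.card_Ico, smul_eq_mul] at h3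
  have h4 := h3.trans h2
  have h5 : 0 < p - 1 := by have := hp.two_le; omega
  nlinarith

/-- With quadratic range the average number of collisions drops below one, so some multiplier has
none. This serves inside the buckets. -/
theorem exists_injective_hash {p : ℕ} (hp : p.Prime) (K : Finset ℕ) (hK : ∀ x ∈ K, x < p) :
    ∃ a < p, Set.InjOn (hash p (2 * K.card ^ 2 + 1) a) K := by
  obtain ⟨a, ha, h⟩ := exists_hash hp K hK (s := 2 * K.card ^ 2 + 1) (by omega)
  refine ⟨a, ha, fun x hx y hy hxy => ?_⟩
  by_contra hne
  have hpos : 0 < (K.offDiag.filter fun q => hash p (2 * K.card ^ 2 + 1) a q.1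
      = hash p (2 * K.card ^ 2 + 1) a q.2).card :=
    Finset.card_pos.2 ⟨(x, y), Finset.mem_filter.2 ⟨Finset.mem_offDiag.2 ⟨hx, hy, hne⟩, hxy⟩⟩
  have h2 : K.offDiag.card ≤ K.card ^ 2 := by
    rw [Finset.offDiag_card, sq]; omega
  nlinarith

/-- With linear range there are at most `2 * K.card` collisions of ordered pairs, so the quadratic
second-level tables have linear total size. -/
theorem exists_first_level {p : ℕ} (hp : p.Prime) (K : Finset ℕ) (hK : ∀ x ∈ K, x < p) :
    ∃ a < p, ∑ h ∈ Finset.range (K.card + 1),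
      (2 * (K.filter fun x => hash p (K.card + 1) a x = h).card ^ 2 + 1) ≤ 7 * K.card + 1 := by
  obtain ⟨a, ha, h⟩ := exists_hash hp K hK (s := K.card + 1) (by omega)
  refine ⟨a, ha, ?_⟩
  set s := K.card + 1
  -- The squares of the bucket sizes count the colliding ordered pairs, including the diagonal.
  have h1 : ∑ h ∈ Finset.range s, (K.filter fun x => hash p s a x = h).card ^ 2
      = ((K ×ˢ K).filter fun q => hash p s a q.1 = hash p s a q.2).card := by
    rw [Finset.card_eq_sum_card_fiberwise (f := fun q => hash p s a q.1) (t := Finset.range s)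
      (fun q _ => by simpa using hash_lt (by omega))]
    refine Finset.sum_congr rfl fun c _ => ?_
    rw [sq, ← Finset.card_product]
    congr 1
    ext ⟨x, y⟩
    simp only [Finset.mem_product, Finset.mem_filter]
    constructor
    · rintro ⟨⟨h1, h2⟩, h3, h4⟩; exact ⟨⟨⟨h1, h3⟩, h2.trans h4.symm⟩, h2⟩
    · rintro ⟨⟨⟨h1, h3⟩, h2⟩, h4⟩; exact ⟨⟨h1, h4⟩, h3, h2 ▸ h4⟩
  have h2 : ((K ×ˢ K).filter fun q => hash p s a q.1 = hash p s a q.2).card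
      ≤ K.card + (K.offDiag.filter fun q => hash p s a q.1 = hash p s a q.2).card := by
    rw [← Finset.diag_union_offDiag, Finset.filter_union]
    refine (Finset.card_union_le _ _).trans (Nat.add_le_add_right ?_ _)
    exact (Finset.card_filter_le _ _).trans (by simp)
  have h3 : (K.offDiag.filter fun q => hash p s a q.1 = hash p s a q.2).card ≤ 2 * K.card := by
    rw [Finset.offDiag_card] at h
    by_contra! hcon
    have : (2 * K.card + 1) * s ≤ 2 * (K.card * K.card - K.card) :=
      (Nat.mul_le_mul_right _ hcon).trans h
    have h4 : K.card * K.card - K.card ≤ K.card * K.card := Nat.sub_le _ _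
    simp only [s] at this
    nlinarith
  rw [Finset.sum_add_distrib, ← Finset.mul_sum, h1]
  simp only [Finset.sum_const, Finset.card_range, smul_eq_mul, mul_one]
  omega

/-! ### Memory layout and lookup in the hash table -/

open WordRAM.Expr in
/-- The cell in which the bucket of the key in register `r` records its `i`-th parameter. -/
def bucketExpr (r i : ℕ) : Expr :=
  load (((load (const 1) * reg r) % load (const 0)) % load (const 2) * const 3 + const (3 + i))

open WordRAM.Expr in
/-- The address of the slot of the key in register `r`. -/
def slotExpr (r : ℕ) : Expr :=
  ((bucketExpr r 0 * reg r) % load (const 0)) % bucketExpr r 1 * const 2 + bucketExpr r 2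

open WordRAM.Expr in
/-- The value that the stored dictionary assigns to the key in register `r`. -/
def lookup (r : ℕ) : Expr :=
  load (slotExpr r + const 1) * bin .eq (load (slotExpr r)) (reg r)

/-- The memory `μ` stores the function `O` on the keys below `U`. -/
def IsDict (w M : ℕ) (μ : ℕ → ℕ) (U : ℕ) (O : ℕ → ℕ) : Prop :=
  ∀ (σ : ℕ → ℕ) (r : ℕ), r < 64 → σ r < U →
    (lookup r).Safe w M μ σ ∧ (lookup r).eval μ σ = O (σ r)

section layout
variable (K : Finset ℕ) (O : ℕ → ℕ) (p a s : ℕ) (b size : ℕ → ℕ)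

/-- The slot of the key `x`. -/
def slot (x : ℕ) : ℕ :=
  ∑ i ∈ Finset.range (hash p s a x), size i + hash p (size (hash p s a x)) (b (hash p s a x)) x

open Classical in
/-- The memory layout of a two-level hash table: prime, multiplier and number of the buckets, then
three parameters for each bucket, then the slots, each with a key and a value. -/
noncomputable def layout (i : ℕ) : ℕ :=
  if i = 0 then p else if i = 1 then a else if i = 2 then s else
  if i < 3 + 3 * s then
    if i % 3 = 0 then b ((i - 3) / 3) else if i % 3 = 1 then size ((i - 3) / 3)
    else 3 + 3 * s + 2 * ∑ h ∈ Finset.range ((i - 3) / 3), size h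
  else if h : ∃ x ∈ K, slot p a s b size x = (i - (3 + 3 * s)) / 2 then
    if (i - (3 + 3 * s)) % 2 = 0 then h.choose else O h.choose
  else 0

/-- Buckets occupy consecutive disjoint intervals of slots, and within a bucket the second hash
function is injective. -/
theorem slot_injOn (hsize : ∀ h, 0 < size h)
    (hinj : ∀ h, Set.InjOn (hash p (size h) (b h)) (K.filter fun x => hash p s a x = h)) :
    Set.InjOn (slot p a s b size) K := by
  have hmono : ∀ x y, hash p s a x < hash p s a y →
      slot p a s b size x < slot p a s b size y := by
    intro x y hxy
    have h1 : ∑ i ∈ Finset.range (hash p s a x + 1), size i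
        ≤ ∑ i ∈ Finset.range (hash p s a y), size i :=
      Finset.sum_le_sum_of_subset (Finset.range_subset_range.2 hxy)
    rw [Finset.sum_range_succ] at h1
    have h2 : hash p (size (hash p s a x)) (b (hash p s a x)) x < size (hash p s a x) :=
      hash_lt (hsize _)
    unfold slot
    omega
  intro x hx y hy hxy
  rcases lt_trichotomy (hash p s a x) (hash p s a y) with h | h | h
  · exact absurd hxy (hmono x y h).ne
  · refine hinj (hash p s a y) ?_ ?_ ?_
    · simpa [h] using hx
    · simpa using hy
    · unfold slot at hxy
      rw [h] at hxy
      omega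
  · exact absurd hxy (hmono y x h).ne'

open Classical in
theorem layout_slot (y : ℕ) {c : ℕ} (hc : c < 2) :
    layout K O p a s b size (3 + 3 * s + 2 * y + c)
      = if h : ∃ x ∈ K, slot p a s b size x = y then if c = 0 then h.choose else O h.choose
        else 0 := by
  have e0 : (3 + 3 * s + 2 * y + c - (3 + 3 * s)) / 2 = y := by omega
  have e1 : (3 + 3 * s + 2 * y + c - (3 + 3 * s)) % 2 = c := by omega
  unfold layout
  rw [if_neg (by omega), if_neg (by omega), if_neg (by omega), if_neg (by omega)]
  simp only [e0, e1]

theorem slot_lt (hs : 0 < s) (hsize : ∀ h, 0 < size h) (x : ℕ) :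
    slot p a s b size x < ∑ i ∈ Finset.range s, size i := by
  have h0 : hash p s a x < s := hash_lt hs
  have h1 : ∑ i ∈ Finset.range (hash p s a x + 1), size i ≤ ∑ i ∈ Finset.range s, size i :=
    Finset.sum_le_sum_of_subset (Finset.range_subset_range.2 h0)
  rw [Finset.sum_range_succ] at h1
  have h2 : hash p (size (hash p s a x)) (b (hash p s a x)) x < size (hash p s a x) :=
    hash_lt (hsize _)
  unfold slot
  omega

/-- The lookup multiplies the stored value by the test whether the stored key is the queried one, so
absent keys yield `0` without a branch. The bound on `p * p` prevents overflow in the hash products.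
-/
theorem isDict_layout {w M U : ℕ} {μ : ℕ → ℕ} (hs : 0 < s) (hsize : ∀ h, 0 < size h)
    (hinj : ∀ h, Set.InjOn (hash p (size h) (b h)) (K.filter fun x => hash p s a x = h))
    (hM : M = 3 + 3 * s + 2 * ∑ i ∈ Finset.range s, size i)
    (hμ : ∀ i < M, μ i = layout K O p a s b size i)
    (hp : 0 < p) (ha : a < p) (hb : ∀ h, b h < p) (hU : U ≤ p) (hw : p * p + p + M < 2 ^ w)
    (hO : ∀ x < U, O x < 2 ^ w) (hOK : ∀ x < U, x ∉ K → O x = 0) (hKU : ∀ x ∈ K, x < U) :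
    IsDict w M μ U O := by
  intro σ r hr hx
  set x := σ r with hxdef
  set h := hash p s a x with hh
  have hhs : h < s := hash_lt hs
  have m0 : μ 0 = p := by rw [hμ 0 (by omega)]; simp [layout]
  have m1 : μ 1 = a := by rw [hμ 1 (by omega)]; simp [layout]
  have m2 : μ 2 = s := by rw [hμ 2 (by omega)]; simp [layout]
  have hb0 : μ (h * 3 + (3 + 0)) = b h := by
    rw [hμ _ (by omega)]
    unfold layout
    rw [if_neg (by omega), if_neg (by omega), if_neg (by omega), if_pos (by omega),
      if_pos (by omega)]
    congr 1; omega
  have hb1 : μ (h * 3 + (3 + 1)) = size h := by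
    rw [hμ _ (by omega)]
    unfold layout
    rw [if_neg (by omega), if_neg (by omega), if_neg (by omega), if_pos (by omega),
      if_neg (by omega), if_pos (by omega)]
    congr 1; omega
  have hb2 : μ (h * 3 + (3 + 2)) = 3 + 3 * s + 2 * ∑ i ∈ Finset.range h, size i := by
    rw [hμ _ (by omega)]
    unfold layout
    rw [if_neg (by omega), if_neg (by omega), if_neg (by omega), if_pos (by omega),
      if_neg (by omega), if_neg (by omega)]
    congr 4; omega
  have hslot := slot_lt p a s b size hs hsize x
  have hax : a * x < 2 ^ w := by
    have : a * x ≤ p * p := Nat.mul_le_mul ha.le (by omega)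
    omega
  have hbx : b h * x < 2 ^ w := by
    have : b h * x ≤ p * p := Nat.mul_le_mul (hb h).le (by omega)
    omega
  have ehash : a * x % p % s = h := rfl
  have ebucket : ∀ i, (bucketExpr r i).eval μ σ = μ (h * 3 + (3 + i)) := by
    intro i
    simp [bucketExpr, m0, m1, m2, ← hxdef, ehash]
  have sbucket : ∀ i < 3, (bucketExpr r i).Safe w M μ σ := by
    intro i hi
    simp only [bucketExpr, Expr.safe_load, Expr.safe_add, Expr.safe_mul, Expr.safe_mod,
      Expr.safe_const, Expr.safe_reg, Expr.eval_load, Expr.eval_const, Expr.eval_mod,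
      Expr.eval_mul, Expr.eval_reg, Expr.eval_add, m0, m1, m2, ← hxdef, ehash]
    refine ⟨⟨⟨⟨⟨⟨⟨?_, ?_⟩, hr, hax⟩, ?_, ?_⟩, ?_, ?_⟩, ?_, ?_⟩, ?_, ?_⟩, ?_⟩ <;> omega
  have eslot : (slotExpr r).eval μ σ = 3 + 3 * s + 2 * slot p a s b size x := by
    simp only [slotExpr, Expr.eval_add, Expr.eval_mul, Expr.eval_mod, ebucket, hb0, hb1, hb2,
      Expr.eval_load, Expr.eval_const, Expr.eval_reg, m0, ← hxdef]
    unfold slot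
    rw [← hh]
    have : b h * x % p % size h = hash p (size h) (b h) x := rfl
    rw [this]; ring
  have sslot : (slotExpr r).Safe w M μ σ := by
    have e2 := eslot
    simp only [slotExpr, Expr.eval_add, Expr.eval_mul, Expr.eval_const] at e2
    simp only [slotExpr, Expr.safe_add, Expr.safe_mul, Expr.safe_mod, Expr.safe_load,
      Expr.safe_const, Expr.safe_reg, Expr.eval_mul, Expr.eval_const]
    have := sbucket 0 (by omega)
    have := sbucket 1 (by omega)
    have := sbucket 2 (by omega)
    refine ⟨⟨⟨⟨⟨‹_›, hr, ?_⟩, ?_, ?_⟩, ‹_›⟩, ?_, ?_⟩, ‹_›, ?_⟩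
    · simpa [ebucket, hb0, ← hxdef] using hbx
    all_goals omega
  have hlay : ∀ c < 2, μ (3 + 3 * s + 2 * slot p a s b size x + c)
      = layout K O p a s b size (3 + 3 * s + 2 * slot p a s b size x + c) :=
    fun c hc => hμ _ (by omega)
  have hkey : μ (3 + 3 * s + 2 * slot p a s b size x + 1)
        * (if μ (3 + 3 * s + 2 * slot p a s b size x) = x then 1 else 0) = O x ∧
      μ (3 + 3 * s + 2 * slot p a s b size x + 1) < 2 ^ w := by
    have h0 := hlay 0 (by omega)
    rw [add_zero] at h0
    have h0' := layout_slot K O p a s b size (slot p a s b size x) (c := 0) (by omega)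
    rw [add_zero] at h0'
    rw [h0, h0', hlay 1 (by omega), layout_slot _ _ _ _ _ _ _ _ (by omega)]
    simp only [if_true, one_ne_zero, if_false]
    by_cases hex : ∃ y ∈ K, slot p a s b size y = slot p a s b size x
    · rw [dif_pos hex, dif_pos hex]
      have hc := hex.choose_spec
      set y := hex.choose
      refine ⟨?_, hO _ (hKU _ hc.1)⟩
      by_cases hxK : x ∈ K
      · have : y = x := slot_injOn K p a s b size hsize hinj hc.1 hxK hc.2
        rw [this]; simp
      · have : y ≠ x := fun h => hxK (h ▸ hc.1)
        simp [this, hOK x hx hxK]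
    -- An empty slot holds key and value `0`; the query `0` may pass the key test there, but the
    -- answer is still `0`.
    · rw [dif_neg hex, dif_neg hex]
      have hxK : x ∉ K := fun h => hex ⟨x, h, rfl⟩
      refine ⟨by simp [hOK x hx hxK], by omega⟩
  constructor
  · simp only [lookup, Expr.safe_mul, Expr.safe_load, Expr.safe_add, Expr.safe_const,
      Expr.safe_eq, Expr.safe_reg, Expr.eval_add, Expr.eval_const, Expr.eval_load, eslot,
      Expr.eval_eq, Expr.eval_reg, ← hxdef, hkey.1]
    refine ⟨⟨⟨sslot, ?_, ?_⟩, ?_⟩, ⟨⟨sslot, ?_⟩, hr⟩, hO x hx⟩ <;> omega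
  · simp only [lookup, Expr.eval_mul, Expr.eval_load, Expr.eval_add, Expr.eval_const,
      Expr.eval_eq, Expr.eval_reg, eslot, ← hxdef, hkey.1]

end layout

/-- Static dictionaries of linear size. -/
theorem exists_dict {w U : ℕ} (hU : 0 < U) (hw : 64 * U ^ 2 ≤ 2 ^ w) (K : Finset ℕ) (O : ℕ → ℕ)
    (hKU : ∀ x ∈ K, x < U) (hO : ∀ x < U, O x < 2 ^ w) (hOK : ∀ x < U, x ∉ K → O x = 0) :
    ∃ data : List (BitVec w), data.length ≤ 20 * (K.card + 1) ∧
      ∀ μ : ℕ → ℕ, (∀ (i : ℕ) (h : i < data.length), μ i = (data[i]).toNat) →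
        IsDict w data.length μ U O := by
  classical
  -- By Bertrand's postulate the prime is at most `2 * U`, so products of two residues fit into a
  -- word.
  obtain ⟨p, hp, hUp, hp2⟩ := Nat.exists_prime_lt_and_le_two_mul U hU.ne'
  have hKp : ∀ x ∈ K, x < p := fun x hx => (hKU x hx).trans hUp
  obtain ⟨a, ha, hsum⟩ := exists_first_level hp K hKp
  set s := K.card + 1 with hs
  set size : ℕ → ℕ := fun h => 2 * (K.filter fun x => hash p s a x = h).card ^ 2 + 1 with hsize
  have hex : ∀ h, ∃ b < p, Set.InjOn (hash p (size h) b) (K.filter fun x => hash p s a x = h) :=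
    fun h => exists_injective_hash hp _ fun x hx => hKp x (Finset.mem_filter.1 hx).1
  choose b hb hinj using hex
  set M := 3 + 3 * s + 2 * ∑ i ∈ Finset.range s, size i with hM
  have hsum' : ∑ i ∈ Finset.range s, size i ≤ 7 * K.card + 1 := hsum
  have hMle : M ≤ 20 * (K.card + 1) := by omega
  have hKcard : K.card ≤ U := by
    have : K ⊆ Finset.range U := fun x hx => Finset.mem_range.2 (hKU x hx)
    simpa using Finset.card_le_card this
  have hbig : p * p + p + M < 2 ^ w := by nlinarith
  refine ⟨(List.range M).map fun i => BitVec.ofNat w (layout K O p a s b size i), by simpa using hMle,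
    fun μ hμ => ?_⟩
  simp only [List.length_map, List.length_range] at hμ ⊢
  refine isDict_layout K O p a s b size (by omega) (fun h => by simp [hsize]) hinj hM ?_ hp.pos ha hb
    hUp.le hbig hO hOK hKU
  intro i hi
  rw [hμ i hi]
  simp only [List.getElem_map, List.getElem_range, BitVec.toNat_ofNat]
  refine Nat.mod_eq_of_lt ?_
  have hsz : ∀ h < s, ∑ i ∈ Finset.range (h + 1), size i ≤ ∑ i ∈ Finset.range s, size i :=
    fun h hh => Finset.sum_le_sum_of_subset (Finset.range_subset_range.2 hh)
  have hpw : p < 2 ^ w := by nlinarith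
  have hKw : ∀ x ∈ K, x < 2 ^ w := fun x hx => (hKp x hx).trans hpw
  have hbw : ∀ h, b h < 2 ^ w := fun h => (hb h).trans hpw
  unfold layout
  split_ifs with h1 h2 h3 h4 h5 h6 h7 h8
  · omega
  · omega
  · omega
  · exact hbw _
  · have := hsz ((i - 3) / 3) (by omega)
    rw [Finset.sum_range_succ] at this
    omega
  · have := hsz ((i - 3) / 3) (by omega)
    rw [Finset.sum_range_succ] at this
    omega
  · exact hKw _ h7.choose_spec.1
  · exact hO _ (hKU _ h7.choose_spec.1)
  · positivity

end WordRAM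

namespace ApproxCounting
open Finset

/-! ### Ranks -/

/-- The number of elements of `A` below `z`. -/
def rank (A : Finset ℕ) (z : ℕ) : ℕ := #{x ∈ A | x < z}

theorem rank_le_card (A : Finset ℕ) (z : ℕ) : rank A z ≤ #A := card_filter_le _ _

theorem rank_mono (A : Finset ℕ) {y z : ℕ} (h : y ≤ z) : rank A y ≤ rank A z :=
  card_le_card fun x hx => by
    simp only [mem_filter] at hx ⊢
    exact ⟨hx.1, by omega⟩

theorem rank_lt_rank {A : Finset ℕ} {y z : ℕ} (hy : y ∈ A) (h : y < z) : rank A y < rank A z :=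
  card_lt_card <| by
    rw [ssubset_iff_of_subset fun x hx => ?_]
    · exact ⟨y, by simp [hy, h], by simp⟩
    · simp only [mem_filter] at hx ⊢
      exact ⟨hx.1, by omega⟩

/-- Only the number on the right has to be in `A`, so an arbitrary query coordinate may be replaced
by its rank when compared with points. -/
theorem rank_le_rank_iff {A : Finset ℕ} {y z : ℕ} (hz : z ∈ A) : rank A y ≤ rank A z ↔ y ≤ z :=
  ⟨fun h => not_lt.1 fun h' => absurd (rank_lt_rank hz h') (by omega), rank_mono A⟩

theorem rank_lt_card {A : Finset ℕ} {y : ℕ} (hy : y ∈ A) : rank A y < #A :=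
  card_lt_card <| by
    rw [ssubset_iff_of_subset (filter_subset _ _)]
    exact ⟨y, hy, by simp⟩

theorem rank_injOn (A : Finset ℕ) : Set.InjOn (rank A) A := by
  intro x hx y hy h
  rcases lt_trichotomy x y with h' | h' | h'
  · exact absurd (rank_lt_rank hx h') (by omega)
  · exact h'
  · exact absurd (rank_lt_rank hy h') (by omega)

theorem image_rank (A : Finset ℕ) : A.image (rank A) = range #A := by
  refine eq_of_subset_of_card_le (fun x hx => ?_) ?_
  · obtain ⟨y, hy, rfl⟩ := mem_image.1 hx
    exact mem_range.2 (rank_lt_card hy)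
  · rw [card_image_of_injOn (rank_injOn A), card_range]

/-! ### Predecessor search in a trie -/

/-- The entry of the trie of `A ⊆ [0, 2 ^ L)` for the prefix `π` of length `lev`. It is present if
the parent of the prefix occurs in `A`, and it gives the number of elements of `A` to the left of
the prefix, plus one. -/
def trieVal (L : ℕ) (A : Finset ℕ) (lev π : ℕ) : ℕ :=
  if 1 ≤ lev ∧ lev ≤ L ∧ ∃ z ∈ A, z / 2 ^ (L - lev) / 2 = π / 2 then
    1 + rank A (π * 2 ^ (L - lev)) else 0

theorem trieVal_ne_zero {L : ℕ} {A : Finset ℕ} {lev π : ℕ} : trieVal L A lev π ≠ 0 ↔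
    1 ≤ lev ∧ lev ≤ L ∧ ∃ z ∈ A, z / 2 ^ (L - lev) / 2 = π / 2 := by
  unfold trieVal
  split_ifs with h
  · simp [h]
  · simp only [ne_eq, not_true_eq_false, false_iff]; exact h

theorem trieVal_le (L : ℕ) (A : Finset ℕ) (lev π : ℕ) : trieVal L A lev π ≤ #A + 1 := by
  unfold trieVal
  split_ifs
  · have := rank_le_card A (π * 2 ^ (L - lev)); omega
  · omega

/-- An element that witnesses a long parent prefix also witnesses all shorter ones. This is the
monotonicity that binary search over levels needs. -/
theorem trieVal_anti {L : ℕ} {A : Finset ℕ} {b lev lev' : ℕ}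
    (h : trieVal L A lev (b / 2 ^ (L - lev)) ≠ 0) (h1 : 1 ≤ lev') (h2 : lev' ≤ lev) :
    trieVal L A lev' (b / 2 ^ (L - lev')) ≠ 0 := by
  rw [trieVal_ne_zero] at h ⊢
  obtain ⟨h3, h4, z, hz, hzb⟩ := h
  refine ⟨h1, by omega, z, hz, ?_⟩
  have e : L - lev' = L - lev + (lev - lev') := by omega
  have key : ∀ y, y / 2 ^ (L - lev') / 2 = y / 2 ^ (L - lev) / 2 / 2 ^ (lev - lev') := by
    intro y
    rw [e, pow_add, Nat.div_div_eq_div_mul, Nat.div_div_eq_div_mul, Nat.div_div_eq_div_mul]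
    congr 1; ring
  rw [key, key, hzb]

/-- If the last present entry is at a level `pos < L`, then no element of `A` has this prefix of
`b`, since otherwise the next entry would be present. So the elements below `b` are those to the
left of the prefix. At `pos = L` the prefix is `b` itself; `pos = 0` forces `A` to be empty. Entries
exist already when the parent occurs, which covers siblings of occurring prefixes. -/
theorem rank_eq_of_trie {L : ℕ} (hL : 1 ≤ L) {A : Finset ℕ} (hA : ∀ z ∈ A, z < 2 ^ L) {b : ℕ}
    (hb : b < 2 ^ L) {pos : ℕ} (hpos : pos ≤ L)
    (hlast : pos + 1 ≤ L → trieVal L A (pos + 1) (b / 2 ^ (L - (pos + 1))) = 0)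
    (hfirst : pos ≠ 0 → trieVal L A pos (b / 2 ^ (L - pos)) ≠ 0) :
    rank A b = (if pos = 0 then 1 else trieVal L A pos (b / 2 ^ (L - pos))) - 1 := by
  by_cases h0 : pos = 0
  · subst h0
    have h := hlast hL
    rw [if_pos rfl, Nat.sub_self]
    unfold rank
    rw [card_eq_zero, filter_eq_empty_iff]
    intro z hz
    exfalso
    have hne : trieVal L A (0 + 1) (b / 2 ^ (L - (0 + 1))) ≠ 0 := by
      rw [trieVal_ne_zero]
      refine ⟨le_rfl, hL, z, hz, ?_⟩
      have key : ∀ y < 2 ^ L, y / 2 ^ (L - (0 + 1)) / 2 = 0 := by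
        intro y hy
        rw [Nat.div_div_eq_div_mul, ← pow_succ, show L - (0 + 1) + 1 = L by omega]
        exact Nat.div_eq_of_lt hy
      rw [key z (hA z hz), key b hb]
    exact hne h
  · rw [if_neg h0]
    have h1 := hfirst h0
    have hv : trieVal L A pos (b / 2 ^ (L - pos))
        = 1 + rank A (b / 2 ^ (L - pos) * 2 ^ (L - pos)) := by
      unfold trieVal
      rw [if_pos (trieVal_ne_zero.1 h1)]
    rw [hv, Nat.add_sub_cancel_left]
    rcases hpos.eq_or_lt with h | h
    · subst h; simp
    · have h2 := hlast h
      unfold rank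
      congr 1
      refine filter_congr fun z hz => ?_
      have hne : z / 2 ^ (L - pos) ≠ b / 2 ^ (L - pos) := by
        intro hzb
        apply (trieVal_ne_zero (L := L) (A := A) (lev := pos + 1)
          (π := b / 2 ^ (L - (pos + 1)))).2 _ h2
        refine ⟨by omega, h, z, hz, ?_⟩
        rw [Nat.div_div_eq_div_mul, Nat.div_div_eq_div_mul, ← pow_succ,
          show L - (pos + 1) + 1 = L - pos by omega]
        exact hzb
      have hD : 0 < 2 ^ (L - pos) := by positivity
      constructor
      · intro hzb
        have := Nat.div_le_div_right (c := 2 ^ (L - pos)) hzb.le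
        exact (Nat.div_lt_iff_lt_mul hD).1 (by omega)
      · intro h
        exact h.trans_le (Nat.div_mul_le_self _ _)

/-- The state of a binary search for the largest level in `[1, 2 ^ lam)` with the decreasing
property `P`, when `k` rounds remain. -/
def SearchInv (P : ℕ → Prop) (lam k pos : ℕ) : Prop :=
  pos + 2 ^ k ≤ 2 ^ lam ∧ (pos ≠ 0 → P pos) ∧ ∀ l, pos + 2 ^ k ≤ l → l < 2 ^ lam → ¬ P l

theorem SearchInv.start (P : ℕ → Prop) (lam : ℕ) : SearchInv P lam lam 0 :=
  ⟨by simp, by simp, fun l h1 h2 => by omega⟩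

theorem SearchInv.step {P : ℕ → Prop} [DecidablePred P] {lam k pos : ℕ}
    (hP : ∀ l l', P l → 1 ≤ l' → l' ≤ l → P l') (h : SearchInv P lam (k + 1) pos) :
    SearchInv P lam k (if P (pos + 2 ^ k) then pos + 2 ^ k else pos) := by
  obtain ⟨h1, h2, h3⟩ := h
  have hk : 0 < 2 ^ k := by positivity
  rw [pow_succ] at h1 h3
  split_ifs with hp
  · exact ⟨by omega, fun _ => hp, fun l hl => h3 l (by omega)⟩
  · exact ⟨by omega, h2, fun l hl hl' hpl => hp (hP _ _ hpl (by omega) hl)⟩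

/-! ### Suffixes of point sets -/

/-- The number of points of `G` to the right of `p`. -/
def rightCount (G : Finset (ℕ × ℕ)) (p : ℕ × ℕ) : ℕ := #{q ∈ G | p.1 < q.1}

/-- The `r` rightmost points of `G`. -/
def last (r : ℕ) (G : Finset (ℕ × ℕ)) : Finset (ℕ × ℕ) := {p ∈ G | rightCount G p < r}

theorem rightCount_lt_rightCount {G : Finset (ℕ × ℕ)} {p q : ℕ × ℕ} (hq : q ∈ G)
    (h : p.1 < q.1) : rightCount G q < rightCount G p :=
  card_lt_card <| by
    rw [ssubset_iff_of_subset fun x hx => ?_]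
    · exact ⟨q, by simp [hq, h], by simp⟩
    · simp only [mem_filter] at hx ⊢
      exact ⟨hx.1, by omega⟩

theorem image_rightCount {G : Finset (ℕ × ℕ)} (hG : Set.InjOn Prod.fst (G : Set (ℕ × ℕ))) :
    G.image (rightCount G) = range #G := by
  have hinj : Set.InjOn (rightCount G) G := by
    intro p hp q hq h
    rcases lt_trichotomy p.1 q.1 with h' | h' | h'
    · exact absurd (rightCount_lt_rightCount hq h') (by omega)
    · exact hG hp hq h'
    · exact absurd (rightCount_lt_rightCount hp h') (by omega)
  refine eq_of_subset_of_card_le (fun x hx => ?_) ?_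
  · obtain ⟨p, hp, rfl⟩ := mem_image.1 hx
    refine mem_range.2 (card_lt_card ?_)
    rw [ssubset_iff_of_subset (filter_subset _ _)]
    exact ⟨p, hp, by simp⟩
  · rw [card_image_of_injOn hinj, card_range]

theorem card_last {G : Finset (ℕ × ℕ)} (hG : Set.InjOn Prod.fst (G : Set (ℕ × ℕ))) {r : ℕ}
    (hr : r ≤ #G) : #(last r G) = r := by
  have h1 : (last r G).image (rightCount G) = range r := by
    ext x
    simp only [last, mem_image, mem_filter, mem_range]
    constructor
    · rintro ⟨p, ⟨_, hp⟩, rfl⟩; exact hp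
    · intro hx
      have : x ∈ G.image (rightCount G) := by rw [image_rightCount hG]; simp; omega
      obtain ⟨p, hp, rfl⟩ := mem_image.1 this
      exact ⟨p, ⟨hp, hx⟩, rfl⟩
  have hinj : Set.InjOn (rightCount G) G := by
    rw [← card_image_iff, image_rightCount hG, card_range]
  have h2 := card_image_of_injOn (s := last r G) (hinj.mono (coe_subset.2 (filter_subset _ _)))
  rw [← h2, h1, card_range]

theorem mem_last_of_le {r : ℕ} {G : Finset (ℕ × ℕ)} {p q : ℕ × ℕ} (hp : p ∈ last r G)
    (hq : q ∈ G) (h : p.1 ≤ q.1) : q ∈ last r G := by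
  rw [last, mem_filter] at hp ⊢
  refine ⟨hq, lt_of_le_of_lt (card_le_card fun x hx => ?_) hp.2⟩
  simp only [mem_filter] at hx ⊢
  exact ⟨hx.1, by omega⟩

/-- Hence a suffix of a node is determined by its cardinality, which is all that the descent keeps
of it. -/
theorem eq_last_of_upper {G Z : Finset (ℕ × ℕ)} (hZG : Z ⊆ G)
    (hZ : ∀ p ∈ Z, ∀ q ∈ G, p.1 ≤ q.1 → q ∈ Z) : Z = last #Z G := by
  ext p
  rw [last, mem_filter]
  constructor
  · intro hp
    refine ⟨hZG hp, card_lt_card ?_⟩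
    rw [ssubset_iff_of_subset fun x hx => ?_]
    · exact ⟨p, hp, by simp⟩
    · simp only [mem_filter] at hx
      exact hZ p hp x hx.1 hx.2.le
  · rintro ⟨hpG, hp⟩
    by_contra hpZ
    refine absurd hp (not_lt.2 (card_le_card fun q hq => ?_))
    simp only [mem_filter]
    exact ⟨hZG hq, not_le.1 fun h => hpZ (hZ q hq p hpG h)⟩

/-! ### Approximate counting in a cell -/

/-- The rank of the point `p` of `C` with respect to the second coordinate. -/
def yRank (C : Finset (ℕ × ℕ)) (p : ℕ × ℕ) : ℕ := rank (C.image Prod.snd) p.2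

/-- The points of `C` whose rank has the prefix `π`, when the last `s` bits are ignored. -/
def node (C : Finset (ℕ × ℕ)) (s π : ℕ) : Finset (ℕ × ℕ) := {p ∈ C | yRank C p / 2 ^ s = π}

/-- Among the last `ρ * 2 ^ (e - 1)` points in the node that contains the prefix `π`, the number
of points with a larger prefix. -/
def gtVal (C : Finset (ℕ × ℕ)) (e s π ρ : ℕ) : ℕ :=
  if ρ * 2 ^ (e - 1) ≤ #(node C (s + e) (π / 2 ^ e)) then
    #{p ∈ last (ρ * 2 ^ (e - 1)) (node C (s + e) (π / 2 ^ e)) | π < yRank C p / 2 ^ s} else 0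

/-- Among the last `ρ * 2 ^ (e - 1)` points in the node that contains the prefix `π`, the number
of points with this prefix. -/
def eqVal (C : Finset (ℕ × ℕ)) (e s π ρ : ℕ) : ℕ :=
  if ρ * 2 ^ (e - 1) ≤ #(node C (s + e) (π / 2 ^ e)) then
    #{p ∈ last (ρ * 2 ^ (e - 1)) (node C (s + e) (π / 2 ^ e)) | yRank C p / 2 ^ s = π} else 0

theorem gtVal_le (C : Finset (ℕ × ℕ)) (e s π ρ : ℕ) : gtVal C e s π ρ ≤ #C := by
  unfold gtVal
  split_ifs
  · exact (card_filter_le _ _).trans ((card_filter_le _ _).trans (card_filter_le _ _))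
  · omega

theorem eqVal_le (C : Finset (ℕ × ℕ)) (e s π ρ : ℕ) : eqVal C e s π ρ ≤ #C := by
  unfold eqVal
  split_ifs
  · exact (card_filter_le _ _).trans ((card_filter_le _ _).trans (card_filter_le _ _))
  · omega

/-- The state of the descent in the cell `C` towards the rank `b`, with steps of `e` bits: `s` bits
remain, the `r` last points of the current node still matter, `acc` points of the set `A` have been
counted, and `t` rounds are done. -/
def DescentInv (C A : Finset (ℕ × ℕ)) (e b s r acc t : ℕ) : Prop :=
  ∃ Z ⊆ node C s (b / 2 ^ s), (∀ p ∈ Z, ∀ q ∈ node C s (b / 2 ^ s), p.1 ≤ q.1 → q ∈ Z) ∧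
    #Z = r ∧ acc + #{p ∈ Z | b ≤ yRank C p} ≤ #{p ∈ A | b ≤ yRank C p} ∧
    #{p ∈ A | b ≤ yRank C p} ≤ acc + #{p ∈ Z | b ≤ yRank C p} + t * (2 ^ (e - 1) - 1)

/-- With enough bits all ranks have the empty prefix, so the root is the whole cell. -/
theorem DescentInv.start {C A : Finset (ℕ × ℕ)} {e b s : ℕ} (hAC : A ⊆ C)
    (hA : ∀ p ∈ A, ∀ q ∈ C, p.1 ≤ q.1 → q ∈ A) (hb : b < 2 ^ s) (hC : #C ≤ 2 ^ s) :
    DescentInv C A e b s #A 0 0 := by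
  have hn : node C s (b / 2 ^ s) = C := by
    rw [node, filter_true_of_mem]
    intro p hp
    rw [Nat.div_eq_of_lt hb]
    refine Nat.div_eq_of_lt (lt_of_lt_of_le (rank_lt_card (mem_image_of_mem _ hp)) ?_)
    exact card_image_le.trans hC
  refine ⟨A, by rwa [hn], by rwa [hn], rfl, by omega, by omega⟩

/-- Rounding the suffix length down to a multiple of `2 ^ (e - 1)` drops fewer than `2 ^ (e - 1)`
points. Of the rest, those with a larger prefix all count, those with a smaller one do not, and
those with the prefix of `b` form a suffix of the child node. -/
theorem DescentInv.step {C A : Finset (ℕ × ℕ)} {e b s r acc t : ℕ}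
    (hC : Set.InjOn Prod.fst (C : Set (ℕ × ℕ))) (h : DescentInv C A e b (s + e) r acc t) :
    DescentInv C A e b s (eqVal C e s (b / 2 ^ s) (r / 2 ^ (e - 1)))
      (acc + gtVal C e s (b / 2 ^ s) (r / 2 ^ (e - 1))) (t + 1) := by
  obtain ⟨Z, hZG, hZ, hr, h1, h2⟩ := h
  have hπ : b / 2 ^ s / 2 ^ e = b / 2 ^ (s + e) := by
    rw [Nat.div_div_eq_div_mul, ← pow_add]
  set G := node C (s + e) (b / 2 ^ (s + e)) with hG
  set B := 2 ^ (e - 1) with hB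
  have hBpos : 0 < B := by positivity
  set π := b / 2 ^ s with hπdef
  have hGC : G ⊆ C := filter_subset _ _
  have hle : r / B * B ≤ r := Nat.div_mul_le_self _ _
  have hrG : r ≤ #G := hr ▸ card_le_card hZG
  set Z' := last (r / B * B) G with hZ'
  have hZ'Z : Z' ⊆ Z := by
    rw [eq_last_of_upper hZG hZ, hr]
    intro p hp
    simp only [hZ', last, mem_filter] at hp ⊢
    exact ⟨hp.1, by omega⟩
  have hZ'card : #Z' = r / B * B := card_last (hC.mono (by exact_mod_cast hGC)) (by omega)
  have egt : gtVal C e s π (r / B) = #{p ∈ Z' | π < yRank C p / 2 ^ s} := by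
    unfold gtVal
    rw [hπ, if_pos (by rw [← hG, ← hB]; omega)]
  have eeq : eqVal C e s π (r / B) = #{p ∈ Z' | yRank C p / 2 ^ s = π} := by
    unfold eqVal
    rw [hπ, if_pos (by rw [← hG, ← hB]; omega)]
  have hsplit : #{p ∈ Z' | b ≤ yRank C p} = #{p ∈ Z' | π < yRank C p / 2 ^ s}
      + #{p ∈ {p ∈ Z' | yRank C p / 2 ^ s = π} | b ≤ yRank C p} := by
    rw [← card_union_of_disjoint]
    · congr 1
      ext p
      simp only [mem_union, mem_filter]
      have hmono : b ≤ yRank C p → π ≤ yRank C p / 2 ^ s := fun h => Nat.div_le_div_right h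
      have hmono' : π < yRank C p / 2 ^ s → b ≤ yRank C p := fun h => by
        by_contra! hcon
        have := Nat.div_le_div_right (c := 2 ^ s) hcon.le
        omega
      constructor
      · rintro ⟨hp, hb⟩
        rcases (hmono hb).lt_or_eq with h | h
        · exact Or.inl ⟨hp, h⟩
        · exact Or.inr ⟨⟨hp, h.symm⟩, hb⟩
      · rintro (⟨hp, hb⟩ | ⟨⟨hp, _⟩, hb⟩)
        · exact ⟨hp, hmono' hb⟩
        · exact ⟨hp, hb⟩
    · rw [disjoint_left]
      simp only [mem_filter]
      rintro p ⟨_, h1⟩ ⟨⟨_, h2⟩, _⟩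
      omega
  have hup : #{p ∈ Z | b ≤ yRank C p} ≤ #{p ∈ Z' | b ≤ yRank C p} + (B - 1) := by
    have h3 : #{p ∈ Z | b ≤ yRank C p} ≤ #{p ∈ Z' | b ≤ yRank C p} + #(Z \ Z') := by
      refine (card_le_card fun p hp => ?_).trans (card_union_le _ _)
      simp only [mem_filter, mem_union, mem_sdiff] at hp ⊢
      by_cases h : p ∈ Z'
      · exact Or.inl ⟨h, hp.2⟩
      · exact Or.inr ⟨hp.1, h⟩
    have h4 : #(Z \ Z') = r - r / B * B := by
      rw [card_sdiff_of_subset hZ'Z, hZ'card, hr]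
    have h5 := Nat.mod_lt r hBpos
    have h6 := Nat.div_add_mod r B
    rw [mul_comm] at h6
    omega
  have hlow : #{p ∈ Z' | b ≤ yRank C p} ≤ #{p ∈ Z | b ≤ yRank C p} :=
    card_le_card (filter_subset_filter _ hZ'Z)
  rw [egt, eeq]
  refine ⟨{p ∈ Z' | yRank C p / 2 ^ s = π}, ?_, ?_, rfl, by omega, ?_⟩
  · intro p hp
    rw [mem_filter] at hp
    exact mem_filter.2 ⟨hGC (mem_filter.1 hp.1).1, hp.2⟩
  · intro p hp q hq hpq
    rw [mem_filter] at hp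
    have hq' := mem_filter.1 hq
    rw [mem_filter]
    refine ⟨mem_last_of_le hp.1 (mem_filter.2 ⟨hq'.1, ?_⟩) hpq, hq'.2⟩
    rw [pow_add, ← Nat.div_div_eq_div_mul, hq'.2, hπ, pow_add]
  · rw [add_mul, one_mul, ← hB]; omega

/-- When no bits remain, all points of the node have rank exactly `b`, so the surviving suffix
counts entirely. -/
theorem DescentInv.finish {C A : Finset (ℕ × ℕ)} {e b r acc t : ℕ}
    (h : DescentInv C A e b 0 r acc t) : acc + r ≤ #{p ∈ A | b ≤ yRank C p} ∧
      #{p ∈ A | b ≤ yRank C p} ≤ acc + r + t * (2 ^ (e - 1) - 1) := by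
  obtain ⟨Z, hZG, -, hr, h1, h2⟩ := h
  have hf : {p ∈ Z | b ≤ yRank C p} = Z := filter_true_of_mem fun p hp => by
    have := (mem_filter.1 (hZG hp)).2
    simp only [pow_zero, Nat.div_one] at this
    omega
  rw [hf, hr] at h1 h2
  exact ⟨h1, h2⟩

/-- The point and the half of the prefixes to which an entry of the tables of a cell is charged. -/
theorem exists_charge {C : Finset (ℕ × ℕ)} (hC : Set.InjOn Prod.fst (C : Set (ℕ × ℕ)))
    {e s π ρ : ℕ} (he : 1 ≤ e) (hρ : ρ ≠ 0)
    (h : ρ * 2 ^ (e - 1) ≤ #(node C (s + e) (π / 2 ^ e))) :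
    ∃ p ∈ C, ∃ c < 2, ρ = rightCount (node C (s + e) (yRank C p / 2 ^ (s + e))) p / 2 ^ (e - 1) + 1 ∧
      π = yRank C p / 2 ^ (s + e) * 2 ^ e
        + rightCount (node C (s + e) (yRank C p / 2 ^ (s + e))) p % 2 ^ (e - 1) + c * 2 ^ (e - 1) := by
  set B := 2 ^ (e - 1) with hB
  have hBpos : 0 < B := by positivity
  have h2B : 2 ^ e = 2 * B := by
    rw [hB, ← pow_succ']; congr 1; omega
  set G := node C (s + e) (π / 2 ^ e) with hG
  have hm1 := Nat.mod_lt (π % 2 ^ e) hBpos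
  -- The `2 ^ e = 2 * B` digits are split into two halves of length `B`. The pair of `ρ` and the
  -- position within the half becomes an index below `ρ * B ≤ #G`, and this index is a position in
  -- the x-order of the node.
  have hlt : (ρ - 1) * B + π % 2 ^ e % B < #G := by
    obtain ⟨ρ', rfl⟩ := Nat.exists_eq_succ_of_ne_zero hρ
    simp only [Nat.succ_eq_add_one, Nat.add_sub_cancel] at h ⊢
    rw [add_mul] at h
    omega
  have hmem : (ρ - 1) * B + π % 2 ^ e % B ∈ G.image (rightCount G) := by
    rw [image_rightCount (hC.mono (by exact_mod_cast filter_subset _ _))]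
    exact mem_range.2 hlt
  obtain ⟨p, hp, hpr⟩ := mem_image.1 hmem
  have hp' := mem_filter.1 hp
  refine ⟨p, hp'.1, π % 2 ^ e / B, ?_, ?_, ?_⟩
  · rw [Nat.div_lt_iff_lt_mul hBpos, ← h2B]
    exact Nat.mod_lt _ (by positivity)
  · rw [hp'.2, ← hG, hpr, mul_comm, Nat.mul_add_div hBpos, Nat.div_eq_of_lt hm1]
    omega
  · rw [hp'.2, ← hG, hpr, mul_comm (ρ - 1), Nat.mul_add_mod, Nat.mod_mod]
    have h1 := Nat.div_add_mod π (2 ^ e)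
    have h2 := Nat.div_add_mod (π % 2 ^ e) B
    rw [mul_comm] at h1 h2
    omega

theorem charge_of_gtVal_ne_zero {C : Finset (ℕ × ℕ)} {e s π ρ : ℕ} (h : gtVal C e s π ρ ≠ 0) :
    ρ ≠ 0 ∧ ρ * 2 ^ (e - 1) ≤ #(node C (s + e) (π / 2 ^ e)) := by
  unfold gtVal at h
  split_ifs at h with h1
  · refine ⟨?_, h1⟩
    rintro rfl
    simp [last] at h
  · exact absurd rfl h

theorem charge_of_eqVal_ne_zero {C : Finset (ℕ × ℕ)} {e s π ρ : ℕ} (h : eqVal C e s π ρ ≠ 0) :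
    ρ ≠ 0 ∧ ρ * 2 ^ (e - 1) ≤ #(node C (s + e) (π / 2 ^ e)) := by
  unfold eqVal at h
  split_ifs at h with h1
  · refine ⟨?_, h1⟩
    rintro rfl
    simp [last] at h
  · exact absurd rfl h

/-! ### Cells -/

/-- Distinct points differ in both coordinates. -/
def GeneralPosition (S : Finset (ℕ × ℕ)) : Prop :=
  Set.InjOn Prod.fst (S : Set (ℕ × ℕ)) ∧ Set.InjOn Prod.snd (S : Set (ℕ × ℕ))

/-- The rank of the point `p` of `S` with respect to the first coordinate. -/
def xRank (S : Finset (ℕ × ℕ)) (p : ℕ × ℕ) : ℕ := rank (S.image Prod.fst) p.1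

/-- The points of `S` with rank at least `a` and second coordinate at least `y`. -/
def dominators (S : Finset (ℕ × ℕ)) (a y : ℕ) : Finset (ℕ × ℕ) :=
  {p ∈ S | a ≤ xRank S p ∧ y ≤ p.2}

theorem card_dominators_rank (S : Finset (ℕ × ℕ)) (q : ℕ × ℕ) :
    #(dominators S (rank (S.image Prod.fst) q.1) q.2) = domCount S q := by
  unfold dominators domCount
  congr 1
  refine filter_congr fun p hp => ?_
  rw [xRank, rank_le_rank_iff (mem_image_of_mem _ hp)]

/-- The least height at which at most `T` points remain. -/
noncomputable def threshold (S : Finset (ℕ × ℕ)) (T a : ℕ) : ℕ :=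
  sInf {y | #(dominators S a y) ≤ T}

theorem dominators_anti (S : Finset (ℕ × ℕ)) (a : ℕ) {y y' : ℕ} (h : y ≤ y') :
    dominators S a y' ⊆ dominators S a y := fun p hp => by
  simp only [dominators, mem_filter] at hp ⊢
  exact ⟨hp.1, hp.2.1, by omega⟩

theorem threshold_le {S : Finset (ℕ × ℕ)} {T a D : ℕ} (hS : ∀ p ∈ S, p.2 < D) :
    threshold S T a ≤ D := by
  refine Nat.sInf_le ?_
  have : dominators S a D = ∅ := by
    rw [dominators, filter_eq_empty_iff]
    intro p hp h
    have := hS p hp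
    omega
  simp [this]

/-- The number of dominators decreases with the height, so a stored threshold decides `T < k`
without knowledge of `k`. -/
theorem lt_threshold_iff {S : Finset (ℕ × ℕ)} {T a y : ℕ} :
    y < threshold S T a ↔ T < #(dominators S a y) := by
  constructor
  · intro h
    have := Nat.notMem_of_lt_sInf h
    simpa using this
  · intro h
    by_contra! hcon
    have hne : {y | #(dominators S a y) ≤ T}.Nonempty := by
      refine ⟨S.sup Prod.snd + 1, ?_⟩
      have : dominators S a (S.sup Prod.snd + 1) = ∅ := by
        rw [dominators, filter_eq_empty_iff]
        intro p hp h
        have := le_sup (f := Prod.snd) hp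
        omega
      simp [this]
    have h1 : #(dominators S a (threshold S T a)) ≤ T := Nat.sInf_mem hne
    have h2 := card_le_card (dominators_anti S a hcon)
    omega

theorem dominators_eq_empty {S : Finset (ℕ × ℕ)} {a : ℕ} (ha : #S ≤ a) (y : ℕ) :
    dominators S a y = ∅ := by
  rw [dominators, filter_eq_empty_iff]
  intro p hp h
  have h1 : xRank S p < _ := rank_lt_card (mem_image_of_mem _ hp)
  have h2 : #(S.image Prod.fst) ≤ #S := card_image_le
  omega

theorem lt_card_of_threshold_ne_zero {S : Finset (ℕ × ℕ)} {T a : ℕ} (h : threshold S T a ≠ 0) :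
    a < #S := by
  by_contra! hcon
  have := (lt_threshold_iff (S := S) (T := T) (a := a) (y := 0)).1 (by omega)
  rw [dominators_eq_empty hcon] at this
  simp at this

/-- The points whose ranks form the `i`-th block of length `T`. -/
def strip (S : Finset (ℕ × ℕ)) (T i : ℕ) : Finset (ℕ × ℕ) := {p ∈ S | xRank S p / T = i}

/-- The points to the right of the `i`-th strip. -/
def beyond (S : Finset (ℕ × ℕ)) (T i : ℕ) : Finset (ℕ × ℕ) := {p ∈ S | i < xRank S p / T}

/-- The `i`-th strip, and the `T` highest points to the right of it. -/
def cell (S : Finset (ℕ × ℕ)) (T i : ℕ) : Finset (ℕ × ℕ) :=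
  strip S T i ∪ {p ∈ beyond S T i | #{q ∈ beyond S T i | p.2 < q.2} < T}

/-- The number of points of the cell of the rank `a` whose rank is at least `a`. -/
def startCount (S : Finset (ℕ × ℕ)) (T a : ℕ) : ℕ := #{p ∈ cell S T (a / T) | a ≤ xRank S p}

theorem cell_subset (S : Finset (ℕ × ℕ)) (T i : ℕ) : cell S T i ⊆ S :=
  union_subset (filter_subset _ _) ((filter_subset _ _).trans (filter_subset _ _))

theorem startCount_le (S : Finset (ℕ × ℕ)) (T a : ℕ) : startCount S T a ≤ #S :=
  (card_filter_le _ _).trans (card_le_card (cell_subset _ _ _))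

theorem lt_card_of_startCount_ne_zero {S : Finset (ℕ × ℕ)} {T a : ℕ} (h : startCount S T a ≠ 0) :
    a < #S := by
  obtain ⟨p, hp⟩ := card_ne_zero.1 h
  obtain ⟨hp1, hp2⟩ := mem_filter.1 hp
  have h1 : xRank S p < _ := rank_lt_card (mem_image_of_mem _ (cell_subset _ _ _ hp1))
  have h2 : #(S.image Prod.fst) ≤ #S := card_image_le
  omega

theorem lt_card_of_mem_cell {S : Finset (ℕ × ℕ)} {T i : ℕ} {p : ℕ × ℕ}
    (h : p ∈ cell S T i) : i < #S := by
  have h1 : xRank S p < _ := rank_lt_card (mem_image_of_mem _ (cell_subset _ _ _ h))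
  have h2 : #(S.image Prod.fst) ≤ #S := card_image_le
  have h3 : i ≤ xRank S p / T := by
    rcases mem_union.1 h with h | h
    · exact (mem_filter.1 h).2.ge
    · exact (mem_filter.1 (mem_filter.1 h).1).2.le
  have := Nat.div_le_self (xRank S p) T
  omega

theorem card_highest_le {S : Finset (ℕ × ℕ)} (hS : Set.InjOn Prod.snd (S : Set (ℕ × ℕ))) (T : ℕ) :
    #{p ∈ S | #{q ∈ S | p.2 < q.2} < T} ≤ T := by
  have : ({p ∈ S | #{q ∈ S | p.2 < q.2} < T}).image (fun p => #{q ∈ S | p.2 < q.2}) ⊆ range T := by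
    intro x hx
    obtain ⟨p, hp, rfl⟩ := mem_image.1 hx
    exact mem_range.2 (mem_filter.1 hp).2
  have hinj : Set.InjOn (fun p : ℕ × ℕ => #{q ∈ S | p.2 < q.2})
      ({p ∈ S | #{q ∈ S | p.2 < q.2} < T} : Finset (ℕ × ℕ)) := by
    have key : ∀ p q : ℕ × ℕ, q ∈ S → p.2 < q.2 → #{r ∈ S | q.2 < r.2} < #{r ∈ S | p.2 < r.2} := by
      intro p q hq h
      refine card_lt_card ?_
      rw [ssubset_iff_of_subset fun x hx => ?_]
      · exact ⟨q, by simp [hq, h], by simp⟩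
      · simp only [mem_filter] at hx ⊢
        exact ⟨hx.1, by omega⟩
    intro p hp q hq h
    have hp' := (mem_filter.1 hp).1
    have hq' := (mem_filter.1 hq).1
    simp only at h
    rcases lt_trichotomy p.2 q.2 with h' | h' | h'
    · exact absurd (key p q hq' h') (by omega)
    · exact hS hp' hq' h'
    · exact absurd (key q p hp' h') (by omega)
  have h := card_le_card this
  rwa [card_image_of_injOn hinj, card_range] at h

theorem image_xRank {S : Finset (ℕ × ℕ)} (hS : GeneralPosition S) :
    S.image (xRank S) = range #S := by
  rw [← card_image_of_injOn hS.1, ← image_rank, image_image]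
  rfl

theorem card_strip_le {S : Finset (ℕ × ℕ)} (hS : GeneralPosition S) {T : ℕ} (hT : 0 < T) (i : ℕ) :
    #(strip S T i) ≤ T := by
  have hinj : Set.InjOn (xRank S) S := by
    rw [← card_image_iff, image_xRank hS, card_range]
  have hsub : (strip S T i).image (xRank S) ⊆ Ico (i * T) (i * T + T) := by
    intro x hx
    obtain ⟨p, hp, rfl⟩ := mem_image.1 hx
    have hp2 := (mem_filter.1 hp).2
    rw [mem_Ico]
    have h1 := Nat.div_add_mod (xRank S p) T
    have h2 := Nat.mod_lt (xRank S p) hT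
    rw [hp2, mul_comm] at h1
    omega
  have := card_le_card hsub
  rw [card_image_of_injOn (s := strip S T i) (hinj.mono (coe_subset.2 (filter_subset _ _))), Nat.card_Ico] at this
  omega

theorem card_cell_le {S : Finset (ℕ × ℕ)} (hS : GeneralPosition S) {T : ℕ} (hT : 0 < T) (i : ℕ) :
    #(cell S T i) ≤ 2 * T := by
  refine (card_union_le _ _).trans ?_
  have h1 := card_strip_le hS hT i
  have h2 := card_highest_le (S := beyond S T i)
    (hS.2.mono (by exact_mod_cast filter_subset _ _)) T
  omega

/-- Extra points exist only if the strip is not the last one, and then it is full: it has `T`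
points, at least as many as are added. -/
theorem card_cell_le_strip {S : Finset (ℕ × ℕ)} (hS : GeneralPosition S) {T : ℕ} (hT : 0 < T)
    (i : ℕ) : #(cell S T i) ≤ 2 * #(strip S T i) := by
  refine (card_union_le _ _).trans ?_
  rcases (beyond S T i).eq_empty_or_nonempty with h | ⟨p, hp⟩
  · rw [h]; simp; omega
  · have h2 := card_highest_le (S := beyond S T i)
      (hS.2.mono (by exact_mod_cast filter_subset _ _)) T
    have h3 : T ≤ #(strip S T i) := by
      obtain ⟨hp1, hp2⟩ := mem_filter.1 hp
      have hlt : xRank S p < #S := by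
        rw [← mem_range, ← image_xRank hS]; exact mem_image_of_mem _ hp1
      have hge : (i + 1) * T ≤ xRank S p := by
        rw [← Nat.le_div_iff_mul_le hT]; omega
      have hsub : Ico (i * T) (i * T + T) ⊆ (strip S T i).image (xRank S) := by
        intro x hx
        rw [mem_Ico] at hx
        rw [add_mul, one_mul] at hge
        have hx2 : x ∈ S.image (xRank S) := by
          rw [image_xRank hS, mem_range]; omega
        obtain ⟨q, hq, rfl⟩ := mem_image.1 hx2
        refine mem_image_of_mem _ (mem_filter.2 ⟨hq, ?_⟩)
        rw [Nat.div_eq_iff hT]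
        constructor <;> omega
      have := (card_le_card hsub).trans card_image_le
      rw [Nat.card_Ico] at this
      omega
    omega

/-- The strips of one level are disjoint, which makes the cutting linear in size. -/
theorem sum_card_cell_le {S : Finset (ℕ × ℕ)} (hS : GeneralPosition S) {T : ℕ} (hT : 0 < T)
    (N : ℕ) : ∑ i ∈ range N, #(cell S T i) ≤ 2 * #S := by
  calc ∑ i ∈ range N, #(cell S T i) ≤ ∑ i ∈ range N, 2 * #(strip S T i) :=
        sum_le_sum fun i _ => card_cell_le_strip hS hT i
    _ = 2 * ∑ i ∈ range N, #(strip S T i) := (mul_sum _ _ _).symm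
    _ ≤ 2 * #S := by
        refine Nat.mul_le_mul_left _ ?_
        have hd : ((range N : Finset ℕ) : Set ℕ).PairwiseDisjoint (strip S T) := by
          intro i _ j _ hij
          rw [Function.onFun, disjoint_left]
          intro p hp hq
          exact hij ((mem_filter.1 hp).2.symm.trans (mem_filter.1 hq).2)
        rw [← card_biUnion hd]
        exact card_le_card (biUnion_subset.2 fun i _ => filter_subset _ _)

/-- Every point beyond the strip that is higher than a dominator is itself a dominator, so a
dominator beyond the strip has fewer than `T` points above it there. -/
theorem dominators_subset_cell {S : Finset (ℕ × ℕ)} {T a y : ℕ} (h : #(dominators S a y) ≤ T) :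
    dominators S a y ⊆ cell S T (a / T) := by
  intro p hp
  have hp' := mem_filter.1 hp
  rw [cell, mem_union]
  have hdiv : a / T ≤ xRank S p / T := Nat.div_le_div_right hp'.2.1
  rcases hdiv.lt_or_eq with h1 | h1
  · right
    rw [mem_filter]
    refine ⟨mem_filter.2 ⟨hp'.1, h1⟩, lt_of_lt_of_le (card_lt_card ?_) h⟩
    rw [ssubset_iff_of_subset fun q hq => ?_]
    · exact ⟨p, hp, by simp⟩
    · obtain ⟨hq1, hq2⟩ := mem_filter.1 hq
      obtain ⟨hq3, hq4⟩ := mem_filter.1 hq1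
      refine mem_filter.2 ⟨hq3, ?_, by omega⟩
      by_contra! hcon
      have := Nat.div_le_div_right (c := T) hcon.le
      omega
  · exact Or.inl (mem_filter.2 ⟨hp'.1, h1.symm⟩)

theorem card_dominators_eq {S : Finset (ℕ × ℕ)} {T a y : ℕ} (h : #(dominators S a y) ≤ T) :
    #{p ∈ {p ∈ cell S T (a / T) | a ≤ xRank S p} |
        rank ((cell S T (a / T)).image Prod.snd) y ≤ yRank (cell S T (a / T)) p}
      = #(dominators S a y) := by
  congr 1
  ext p
  simp only [mem_filter]
  constructor
  · rintro ⟨⟨h1, h2⟩, h3⟩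
    rw [yRank, rank_le_rank_iff (mem_image_of_mem _ h1)] at h3
    exact mem_filter.2 ⟨cell_subset _ _ _ h1, h2, h3⟩
  · intro hp
    have hc := dominators_subset_cell h hp
    obtain ⟨h1, h2, h3⟩ := mem_filter.1 hp
    refine ⟨⟨hc, h2⟩, ?_⟩
    rw [yRank, rank_le_rank_iff (mem_image_of_mem _ hc)]
    exact h3

end ApproxCounting

/-! ### The tables, their keys, and the number of nonzero entries -/

namespace ApproxCounting
open Finset

/-- Append the digit `b` to the number `a` in base `W`. -/
def pack (W a b : ℕ) : ℕ := a * W + b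

theorem pack_div {W a b : ℕ} (h : b < W) : pack W a b / W = a := by
  rw [pack, mul_comm, Nat.mul_add_div (by omega), Nat.div_eq_of_lt h, add_zero]

theorem pack_mod {W a b : ℕ} (h : b < W) : pack W a b % W = b := by
  rw [pack, mul_comm, Nat.mul_add_mod, Nat.mod_eq_of_lt h]

theorem pack_div_mod (W k : ℕ) : pack W (k / W) (k % W) = k := Nat.div_add_mod' k W

theorem pack_lt {W a b m : ℕ} (ha : a < W ^ m) (hb : b < W) : pack W a b < W ^ (m + 1) := by
  have : (a + 1) * W ≤ W ^ m * W := Nat.mul_le_mul_right _ ha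
  rw [pack, pow_succ]
  rw [add_mul] at this
  omega

/-- The cell with the number `pack (pack id j) i` of the family `S` of point sets. -/
def cellOf (W lam : ℕ) (S : ℕ → Finset (ℕ × ℕ)) (c : ℕ) : Finset (ℕ × ℕ) :=
  if c / W % W ≤ lam then cell (S (c / W / W)) (2 ^ 2 ^ (c / W % W)) (c % W) else ∅

open Classical in
/-- The entries of the data structure for the family `S` of point sets, by type and index. -/
noncomputable def entry (W L lam H : ℕ) (S : ℕ → Finset (ℕ × ℕ)) (tag k : ℕ) : ℕ :=
  match tag with
  -- The tag is the lowest digit, so the keys `1`, `2`, `3` of the parameters can be formed before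
  -- the base `W` is known.
  | 1 => if k = 0 then W else 0
  | 2 => if k = 0 then lam else 0
  | 3 => if k = 0 then H else 0
  | 4 => trieVal L ((S (k / W / W)).image Prod.fst) (k / W % W) (k % W)
  | 5 => if k / W % W < lam then threshold (S (k / W / W)) (2 ^ 2 ^ (k / W % W)) (k % W) else 0
  | 6 => if k / W % W ≤ lam then startCount (S (k / W / W)) (2 ^ 2 ^ (k / W % W)) (k % W) else 0
  | 7 => trieVal L ((cellOf W lam S (k / W / W)).image Prod.snd) (k / W % W) (k % W)
  -- Only step widths that are powers of two, and depths below `2 ^ (lam + 2)`, are tabulated; this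
  -- bounds the number of tables of a cell.
  | 8 => if (∃ g ≤ lam, k / W / W / W % W = 2 ^ g) ∧ k / W / W % W < 2 ^ (lam + 2) then
      gtVal (cellOf W lam S (k / W / W / W / W)) (k / W / W / W % W) (k / W / W % W) (k / W % W)
        (k % W) else 0
  | 9 => if (∃ g ≤ lam, k / W / W / W % W = 2 ^ g) ∧ k / W / W % W < 2 ^ (lam + 2) then
      eqVal (cellOf W lam S (k / W / W / W / W)) (k / W / W / W % W) (k / W / W % W) (k / W % W)
        (k % W) else 0
  | _ => 0

/-- All entries of the data structure, by key. -/
noncomputable def dict (W L lam H : ℕ) (S : ℕ → Finset (ℕ × ℕ)) (k : ℕ) : ℕ :=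
  entry W L lam H S (k % W) (k / W)

theorem cellOf_pack {W lam : ℕ} {S : ℕ → Finset (ℕ × ℕ)} {id j i : ℕ} (hj : j < W) (hi : i < W)
    (hjl : j ≤ lam) : cellOf W lam S (pack W (pack W id j) i) = cell (S id) (2 ^ 2 ^ j) i := by
  simp [cellOf, pack_div, pack_mod, hj, hi, hjl]

theorem card_cellOf_le {W lam : ℕ} {S : ℕ → Finset (ℕ × ℕ)} {n : ℕ} (hn : ∀ id, #(S id) ≤ n)
    (c : ℕ) : #(cellOf W lam S c) ≤ n := by
  unfold cellOf
  split_ifs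
  · exact (card_le_card (cell_subset _ _ _)).trans (hn _)
  · simp

theorem dict_le {W L lam H : ℕ} {S : ℕ → Finset (ℕ × ℕ)} (hlam : lam ≤ W) (hH : H ≤ W)
    (hL : 2 ^ L ≤ W) (hn : ∀ id, #(S id) ≤ W - 1) (hW : 1 ≤ W)
    (hS : ∀ id, ∀ p ∈ S id, p.2 < 2 ^ L) (k : ℕ) :
    dict W L lam H S k ≤ W := by
  have hc := card_cellOf_le (W := W) (lam := lam) hn
  unfold dict entry
  split
  · split_ifs <;> omega
  · split_ifs <;> omega
  · split_ifs <;> omega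
  · refine (trieVal_le _ _ _ _).trans ?_
    have := (card_image_le (s := S (k / W / W / W)) (f := Prod.fst)).trans (hn _)
    omega
  · split_ifs
    · exact (threshold_le (hS _)).trans hL
    · omega
  · split_ifs
    · exact (startCount_le _ _ _).trans ((hn _).trans (by omega))
    · omega
  · refine (trieVal_le _ _ _ _).trans ?_
    have := (card_image_le (s := cellOf W lam S (k / W / W / W)) (f := Prod.snd)).trans (hc _)
    omega
  · split_ifs
    · exact (gtVal_le _ _ _ _ _).trans ((hc _).trans (by omega))
    · omega
  · split_ifs
    · exact (eqVal_le _ _ _ _ _).trans ((hc _).trans (by omega))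
    · omega
  · omega

section support
variable {β : Type*} (S : ℕ → Finset (ℕ × ℕ)) (Ids : Finset ℕ)

/-- The keys of the form `f id x` with `x` in a set `A id`. -/
def keysBy (A : ℕ → Finset β) (f : ℕ → β → ℕ) : Finset ℕ :=
  Ids.biUnion fun id => (A id).image (f id)

theorem card_keysBy_le (A : ℕ → Finset β) (f : ℕ → β → ℕ) (m : ℕ)
    (h : ∀ id ∈ Ids, #(A id) ≤ #(S id) * m) :
    #(keysBy Ids A f) ≤ (∑ id ∈ Ids, #(S id)) * m := by
  refine card_biUnion_le.trans ?_
  rw [sum_mul]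
  exact sum_le_sum fun id hid => card_image_le.trans (h id hid)

/-- The keys of the form `f id j i x`, where `x` contains a point of the cell with the number `i` at
the level `j ≤ lam` of the point set `S id`. -/
def cellKeys (lam : ℕ) (B : Finset β) (f : ℕ → ℕ → ℕ → (ℕ × ℕ) × β → ℕ) : Finset ℕ :=
  Ids.biUnion fun id => (range (lam + 1)).biUnion fun j => (range #(S id)).biUnion fun i =>
    (cell (S id) (2 ^ 2 ^ j) i ×ˢ B).image (f id j i)

/-- Each of the `lam + 1` levels contributes at most twice the set, with `#B` keys for each point of
a cell. -/
theorem card_cellKeys_le (hS : ∀ id, GeneralPosition (S id)) (lam : ℕ) (B : Finset β)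
    (f : ℕ → ℕ → ℕ → (ℕ × ℕ) × β → ℕ) :
    #(cellKeys S Ids lam B f) ≤ (∑ id ∈ Ids, #(S id)) * ((lam + 1) * (2 * #B)) := by
  refine card_biUnion_le.trans ?_
  rw [sum_mul]
  refine sum_le_sum fun id _ => card_biUnion_le.trans ?_
  have h1 : ∀ j ∈ range (lam + 1), #((range #(S id)).biUnion fun i =>
      (cell (S id) (2 ^ 2 ^ j) i ×ˢ B).image (f id j i)) ≤ #(S id) * (2 * #B) := by
    intro j _
    refine card_biUnion_le.trans ?_
    calc _ ≤ ∑ i ∈ range #(S id), #(cell (S id) (2 ^ 2 ^ j) i) * #B :=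
          sum_le_sum fun i _ => card_image_le.trans (card_product _ _).le
      _ = (∑ i ∈ range #(S id), #(cell (S id) (2 ^ 2 ^ j) i)) * #B := (sum_mul _ _ _).symm
      _ ≤ 2 * #(S id) * #B := Nat.mul_le_mul_right _ (sum_card_cell_le (hS id) (by positivity) _)
      _ = #(S id) * (2 * #B) := by ring
  refine (sum_le_card_nsmul _ _ _ h1).trans ?_
  rw [card_range, smul_eq_mul]
  exact le_of_eq (by ring)

theorem mem_cellKeys {lam : ℕ} {B : Finset β} {f : ℕ → ℕ → ℕ → (ℕ × ℕ) × β → ℕ}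
    {id j i : ℕ} (hS : ∀ id, id ∉ Ids → S id = ∅) (hj : j ≤ lam) {p : ℕ × ℕ}
    (hp : p ∈ cell (S id) (2 ^ 2 ^ j) i) {b : β} (hb : b ∈ B) :
    f id j i (p, b) ∈ cellKeys S Ids lam B f := by
  have hid : id ∈ Ids := by
    by_contra h
    have := cell_subset _ _ _ hp
    rw [hS id h] at this
    simp at this
  rw [cellKeys, mem_biUnion]
  refine ⟨id, hid, mem_biUnion.2 ⟨j, mem_range.2 (by omega), mem_biUnion.2
    ⟨i, mem_range.2 (lt_card_of_mem_cell hp), mem_image_of_mem _ (mem_product.2 ⟨hp, hb⟩)⟩⟩⟩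

variable (W L lam H : ℕ)

/-- The keys of the trie of first coordinates. -/
def xTrieKeys : Finset ℕ :=
  keysBy Ids (fun id => S id ×ˢ (range (L + 1) ×ˢ range 2)) fun id x =>
    pack W (pack W (pack W id x.2.1) (2 * (x.1.1 / 2 ^ (L - x.2.1) / 2) + x.2.2)) 4

/-- The keys of a table indexed by levels and ranks. -/
def rankKeys (tag : ℕ) : Finset ℕ :=
  keysBy Ids (fun id => range (lam + 1) ×ˢ range #(S id)) fun id x =>
    pack W (pack W (pack W id x.1) x.2) tag

/-- The keys of the tries of the cells. -/
def yTrieKeys : Finset ℕ :=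
  cellKeys S Ids lam (range (L + 1) ×ˢ range 2) fun id j i x =>
    pack W (pack W (pack W (pack W (pack W id j) i) x.2.1)
      (2 * (x.1.2 / 2 ^ (L - x.2.1) / 2) + x.2.2)) 7

/-- The keys of the counts in the cells. -/
def countKeys (tag : ℕ) : Finset ℕ :=
  cellKeys S Ids lam (range (lam + 1) ×ˢ (range (2 ^ (lam + 2)) ×ˢ range 2)) fun id j i x =>
    let C := cell (S id) (2 ^ 2 ^ j) i
    let e := 2 ^ x.2.1
    let s := x.2.2.1
    let v := yRank C x.1 / 2 ^ (s + e)
    let u := rightCount (node C (s + e) v) x.1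
    pack W (pack W (pack W (pack W (pack W (pack W (pack W id j) i) e) s)
      (v * 2 ^ e + u % 2 ^ (e - 1) + x.2.2.2 * 2 ^ (e - 1))) (u / 2 ^ (e - 1) + 1)) tag

variable {S Ids W L lam H}

theorem exists_of_trieVal_ne_zero {A : Finset ℕ} {lev π : ℕ} (h : trieVal L A lev π ≠ 0) :
    ∃ z ∈ A, lev < L + 1 ∧ ∃ c < 2, π = 2 * (z / 2 ^ (L - lev) / 2) + c := by
  obtain ⟨_, h2, z, hz, h3⟩ := trieVal_ne_zero.1 h
  exact ⟨z, hz, by omega, π % 2, by omega, by omega⟩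

theorem mem_of_mem_cellOf {c : ℕ} {p : ℕ × ℕ} (hp : p ∈ cellOf W lam S c) :
    ∃ id j i, c = pack W (pack W id j) i ∧ j ≤ lam ∧ cellOf W lam S c = cell (S id) (2 ^ 2 ^ j) i := by
  refine ⟨c / W / W, c / W % W, c % W, ?_, ?_, ?_⟩
  · rw [pack_div_mod, pack_div_mod]
  · unfold cellOf at hp
    split_ifs at hp with h
    · exact h
    · simp at hp
  · unfold cellOf at hp ⊢
    split_ifs at hp ⊢ with h
    · rfl
    · simp at hp

theorem mem_xTrieKeys (hS : ∀ id, id ∉ Ids → S id = ∅) {k : ℕ}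
    (h : trieVal L ((S (k / W / W)).image Prod.fst) (k / W % W) (k % W) ≠ 0) :
    pack W k 4 ∈ xTrieKeys S Ids W L := by
  obtain ⟨z, hz, hlev, c, hc, hπ⟩ := exists_of_trieVal_ne_zero h
  obtain ⟨p, hp, rfl⟩ := mem_image.1 hz
  have hid : k / W / W ∈ Ids := by
    by_contra h
    rw [hS _ h] at hp
    simp at hp
  rw [xTrieKeys, keysBy, mem_biUnion]
  refine ⟨k / W / W, hid, mem_image.2 ⟨(p, k / W % W, c), ?_, ?_⟩⟩
  · simp [hp, hlev, hc]
  · simp only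
    rw [← hπ, pack_div_mod, pack_div_mod]

theorem mem_rankKeys (hS : ∀ id, id ∉ Ids → S id = ∅) {k tag : ℕ}
    (h1 : k / W % W ≤ lam) (h2 : k % W < #(S (k / W / W))) :
    pack W k tag ∈ rankKeys S Ids W lam tag := by
  have hid : k / W / W ∈ Ids := by
    by_contra h
    rw [hS _ h] at h2
    simp at h2
  rw [rankKeys, keysBy, mem_biUnion]
  refine ⟨k / W / W, hid, mem_image.2 ⟨(k / W % W, k % W), ?_, ?_⟩⟩
  · simp only [mem_product, mem_range]; omega
  · simp only
    rw [pack_div_mod, pack_div_mod]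

theorem mem_yTrieKeys (hS : ∀ id, id ∉ Ids → S id = ∅) {k : ℕ}
    (h : trieVal L ((cellOf W lam S (k / W / W)).image Prod.snd) (k / W % W) (k % W) ≠ 0) :
    pack W k 7 ∈ yTrieKeys S Ids W L lam := by
  obtain ⟨z, hz, hlev, c, hc, hπ⟩ := exists_of_trieVal_ne_zero h
  obtain ⟨p, hp, rfl⟩ := mem_image.1 hz
  obtain ⟨id, j, i, hcid, hj, hcell⟩ := mem_of_mem_cellOf hp
  rw [hcell] at hp
  have hmem := mem_cellKeys (f := fun id j i x =>
    pack W (pack W (pack W (pack W (pack W id j) i) x.2.1)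
      (2 * (x.1.2 / 2 ^ (L - x.2.1) / 2) + x.2.2)) 7) (B := range (L + 1) ×ˢ range 2)
    (b := (k / W % W, c)) S Ids hS hj hp (by simp [hlev, hc])
  simp only at hmem
  rw [← hcid, ← hπ, pack_div_mod, pack_div_mod] at hmem
  exact hmem

/-- The charged point and half from `exists_charge` reconstruct the key. -/
theorem mem_countKeys (hG : ∀ id, GeneralPosition (S id)) (hS : ∀ id, id ∉ Ids → S id = ∅)
    {k tag : ℕ} (he : ∃ g ≤ lam, k / W / W / W % W = 2 ^ g) (hs : k / W / W % W < 2 ^ (lam + 2))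
    (hρ : k % W ≠ 0 ∧ k % W * 2 ^ (k / W / W / W % W - 1)
      ≤ #(node (cellOf W lam S (k / W / W / W / W)) (k / W / W % W + k / W / W / W % W)
          (k / W % W / 2 ^ (k / W / W / W % W)))) :
    pack W k tag ∈ countKeys S Ids W lam tag := by
  obtain ⟨g, hg, he⟩ := he
  have hC : Set.InjOn Prod.fst (cellOf W lam S (k / W / W / W / W) : Set (ℕ × ℕ)) := by
    unfold cellOf
    split_ifs
    · exact (hG _).1.mono (coe_subset.2 (cell_subset _ _ _))
    · simp
  obtain ⟨p, hp, c, hc, hρ', hπ⟩ := exists_charge hC (by rw [he]; exact Nat.one_le_two_pow) hρ.1 hρ.2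
  obtain ⟨id, j, i, hcid, hj, hcell⟩ := mem_of_mem_cellOf hp
  rw [hcell] at hp hρ' hπ
  have hmem := mem_cellKeys (f := fun id j i x =>
    let C := cell (S id) (2 ^ 2 ^ j) i
    let e := 2 ^ x.2.1
    let s := x.2.2.1
    let v := yRank C x.1 / 2 ^ (s + e)
    let u := rightCount (node C (s + e) v) x.1
    pack W (pack W (pack W (pack W (pack W (pack W (pack W id j) i) e) s)
      (v * 2 ^ e + u % 2 ^ (e - 1) + x.2.2.2 * 2 ^ (e - 1))) (u / 2 ^ (e - 1) + 1)) tag)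
    (B := range (lam + 1) ×ˢ (range (2 ^ (lam + 2)) ×ˢ range 2))
    (b := (g, k / W / W % W, c)) S Ids hS hj hp (by
      simp only [mem_product, mem_range]; exact ⟨by omega, hs, hc⟩)
  simp only at hmem
  rw [← he, ← hcid, ← hρ', ← hπ, pack_div_mod, pack_div_mod, pack_div_mod, pack_div_mod] at hmem
  exact hmem

variable (S Ids W L lam) in
/-- A set that contains all keys with a nonzero entry. -/
def allKeys : Finset ℕ :=
  {1, 2, 3} ∪ (xTrieKeys S Ids W L ∪ (rankKeys S Ids W lam 5 ∪ (rankKeys S Ids W lam 6 ∪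
    (yTrieKeys S Ids W L lam ∪ (countKeys S Ids W lam 8 ∪ countKeys S Ids W lam 9)))))

theorem mem_allKeys (hG : ∀ id, GeneralPosition (S id)) (hS : ∀ id, id ∉ Ids → S id = ∅)
    {k : ℕ} (h : dict W L lam H S k ≠ 0) : k ∈ allKeys S Ids W L lam := by
  have hk := pack_div_mod W k
  unfold dict at h
  unfold allKeys
  simp only [mem_union]
  generalize k % W = tag at *
  generalize hq : k / W = q at *
  unfold entry at h
  split at h
  · split_ifs at h with h0
    · subst h0; simp [pack] at hk; simp [← hk]
    · exact absurd rfl h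
  · split_ifs at h with h0
    · subst h0; simp [pack] at hk; simp [← hk]
    · exact absurd rfl h
  · split_ifs at h with h0
    · subst h0; simp [pack] at hk; simp [← hk]
    · exact absurd rfl h
  · rw [← hk]; exact Or.inr (Or.inl (mem_xTrieKeys hS h))
  · split_ifs at h with h0
    · rw [← hk]
      exact Or.inr (Or.inr (Or.inl (mem_rankKeys hS h0.le (lt_card_of_threshold_ne_zero h))))
    · exact absurd rfl h
  · split_ifs at h with h0
    · rw [← hk]
      exact Or.inr (Or.inr (Or.inr (Or.inl
        (mem_rankKeys hS h0 (lt_card_of_startCount_ne_zero h)))))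
    · exact absurd rfl h
  · rw [← hk]; exact Or.inr (Or.inr (Or.inr (Or.inr (Or.inl (mem_yTrieKeys hS h)))))
  · split_ifs at h with h0
    · rw [← hk]
      exact Or.inr (Or.inr (Or.inr (Or.inr (Or.inr (Or.inl
        (mem_countKeys hG hS h0.1 h0.2 (charge_of_gtVal_ne_zero h)))))))
    · exact absurd rfl h
  · split_ifs at h with h0
    · rw [← hk]
      exact Or.inr (Or.inr (Or.inr (Or.inr (Or.inr (Or.inr
        (mem_countKeys hG hS h0.1 h0.2 (charge_of_eqVal_ne_zero h)))))))
    · exact absurd rfl h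
  · exact absurd rfl h

/-- Absorbs the `(log log n) ^ 2` from levels and step widths into one factor `log n`. -/
theorem succ_sq_le (m : ℕ) : (m + 1) ^ 2 ≤ 4 * 2 ^ m := by
  induction m with
  | zero => norm_num
  | succ m ih =>
    rw [pow_succ 2]
    rcases Nat.lt_or_ge m 2 with h | h
    · interval_cases m <;> norm_num
    · nlinarith

/-- The count tables dominate: per point of the set there are `O((lam + 1) ^ 2 * 2 ^ lam)` entries,
from levels, step widths and depths. -/
theorem card_allKeys_le (hG : ∀ id, GeneralPosition (S id)) (hL : L + 1 = 2 ^ lam) :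
    #(allKeys S Ids W L lam) ≤ 3 + (∑ id ∈ Ids, #(S id)) * (144 * 4 ^ lam) := by
  set N := ∑ id ∈ Ids, #(S id) with hN
  have h1 : #({1, 2, 3} : Finset ℕ) ≤ 3 := card_le_three
  have h4 : #(xTrieKeys S Ids W L) ≤ N * (2 ^ lam * 2) :=
    card_keysBy_le S Ids _ _ _ fun id _ => by simp [hL]
  have h5 : ∀ tag, #(rankKeys S Ids W lam tag) ≤ N * (lam + 1) := fun tag =>
    card_keysBy_le S Ids _ _ _ fun id _ => by simp [mul_comm]
  have h7 : #(yTrieKeys S Ids W L lam) ≤ N * ((lam + 1) * (2 * (2 ^ lam * 2))) := by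
    refine (card_cellKeys_le S Ids hG _ _ _).trans (le_of_eq ?_)
    simp [hL, hN]
  have h8 : ∀ tag, #(countKeys S Ids W lam tag)
      ≤ N * ((lam + 1) * (2 * ((lam + 1) * (2 ^ (lam + 2) * 2)))) := by
    intro tag
    refine (card_cellKeys_le S Ids hG _ _ _).trans (le_of_eq ?_)
    simp [hN]
  have hl := succ_sq_le lam
  have hll : lam + 1 ≤ 2 ^ lam := Nat.lt_two_pow_self
  have h2 : (2 : ℕ) ^ (lam + 2) = 4 * 2 ^ lam := by rw [pow_add]; ring
  have h44 : (4 : ℕ) ^ lam = 2 ^ lam * 2 ^ lam := by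
    rw [← mul_pow]; norm_num
  have hall : #(allKeys S Ids W L lam) ≤ 3 + (N * (2 ^ lam * 2) + (N * (lam + 1) + (N * (lam + 1) +
      (N * ((lam + 1) * (2 * (2 ^ lam * 2)))
      + (N * ((lam + 1) * (2 * ((lam + 1) * (2 ^ (lam + 2) * 2))))
      + N * ((lam + 1) * (2 * ((lam + 1) * (2 ^ (lam + 2) * 2))))))))) := by
    unfold allKeys
    have := h5 5
    have := h5 6
    have := h8 8
    have := h8 9
    refine (card_union_le _ _).trans (add_le_add h1 ?_)
    refine (card_union_le _ _).trans (add_le_add h4 ?_)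
    refine (card_union_le _ _).trans (add_le_add (h5 5) ?_)
    refine (card_union_le _ _).trans (add_le_add (h5 6) ?_)
    refine (card_union_le _ _).trans (add_le_add h7 ?_)
    exact (card_union_le _ _).trans (add_le_add (h8 8) (h8 9))
  refine hall.trans ?_
  rw [h2, h44]
  generalize 2 ^ lam = Λ at *
  have e1 : Λ * 2 ≤ 2 * (Λ * Λ) := by nlinarith
  have e2 : lam + 1 ≤ Λ * Λ := by nlinarith
  have e3 : (lam + 1) * (2 * (Λ * 2)) ≤ 4 * (Λ * Λ) := by nlinarith
  have e4 : (lam + 1) * (2 * ((lam + 1) * (4 * Λ * 2))) ≤ 64 * (Λ * Λ) := by nlinarith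
  have := Nat.mul_le_mul_left N e1
  have := Nat.mul_le_mul_left N e2
  have := Nat.mul_le_mul_left N e3
  have := Nat.mul_le_mul_left N e4
  -- The tables account for `136`; the last `8` is slack.
  have h144 : N * (144 * (Λ * Λ)) = N * (2 * (Λ * Λ)) + N * (Λ * Λ) + N * (Λ * Λ)
    + N * (4 * (Λ * Λ)) + N * (64 * (Λ * Λ)) + N * (64 * (Λ * Λ)) + N * (8 * (Λ * Λ)) := by ring
  omega

end support
end ApproxCounting

/-! ### The machine with its dictionary, and the rank program -/

namespace ApproxCounting
open Finset WordRAM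

/-- The expression that appends the digit `b` to `a`, in the base that is held in register 10. -/
def packE (a b : Expr) : Expr := a * .reg 10 + b

@[simp] theorem eval_packE (μ σ : ℕ → ℕ) (a b : Expr) :
    (packE a b).eval μ σ = pack (σ 10) (a.eval μ σ) (b.eval μ σ) := rfl

@[simp] theorem safe_packE (w M : ℕ) (μ σ : ℕ → ℕ) (a b : Expr) :
    (packE a b).Safe w M μ σ ↔ a.Safe w M μ σ ∧ b.Safe w M μ σ ∧
      pack (σ 10) (a.eval μ σ) (b.eval μ σ) < 2 ^ w := by
  simp only [packE, Expr.safe_add, Expr.safe_mul, Expr.safe_reg, Expr.eval_mul, Expr.eval_reg, pack]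
  constructor
  · rintro ⟨⟨h1, -, -⟩, h2, h3⟩; exact ⟨h1, h2, h3⟩
  · rintro ⟨h1, h2, h3⟩; exact ⟨⟨h1, by norm_num, by omega⟩, h2, h3⟩

/-- A machine whose memory holds the dictionary `O`, and which is large enough for the parameters. -/
structure Machine (w M : ℕ) (μ : ℕ → ℕ) (W L lam : ℕ) (O : ℕ → ℕ) : Prop where
  pos : 0 < w
  isDict : IsDict w M μ (W ^ 12) O
  big : 64 * (W ^ 12) ^ 2 ≤ 2 ^ w
  le : ∀ k, O k ≤ W
  hL : L + 1 = 2 ^ lam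
  hW : W = 2 ^ (2 * 2 ^ lam)
  hlam : 2 ≤ lam

namespace Machine
variable {w M : ℕ} {μ : ℕ → ℕ} {W L lam : ℕ} {O : ℕ → ℕ}

theorem pow_lt (m : Machine w M μ W L lam O) : 64 * W ^ 12 < 2 ^ w := by
  have h := m.big
  have hW : 2 ≤ W := by
    rw [m.hW]; exact Nat.le_self_pow (by positivity) 2
  have h2 : 2 ≤ W ^ 12 := hW.trans (Nat.le_self_pow (by norm_num) W)
  nlinarith

theorem two_le (m : Machine w M μ W L lam O) : 2 ≤ W := by
  rw [m.hW]; exact Nat.le_self_pow (by positivity) 2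

theorem lt_w (m : Machine w M μ W L lam O) : 18 < w := by
  have h := m.pow_lt
  have h2 : 2 ^ 12 ≤ W ^ 12 := Nat.pow_le_pow_left m.two_le 12
  by_contra! hcon
  have := Nat.pow_le_pow_right (show 0 < 2 by norm_num) hcon
  omega

theorem pow_le (m : Machine w M μ W L lam O) {i : ℕ} (hi : i ≤ 12) : W ^ i ≤ W ^ 12 :=
  Nat.pow_le_pow_right (by have := m.two_le; omega) hi

theorem le_pow (_ : Machine w M μ W L lam O) : W ≤ W ^ 12 := Nat.le_self_pow (by norm_num) W

theorem two_pow_L_lt (m : Machine w M μ W L lam O) : 2 * 2 ^ L ≤ W := by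
  rw [m.hW, ← pow_succ', m.hL]
  exact Nat.pow_le_pow_right (by norm_num) (by omega)

theorem L_lt (m : Machine w M μ W L lam O) : 2 * (L + 1) ≤ W := by
  have h1 := m.two_pow_L_lt
  have h2 : L < 2 ^ L := Nat.lt_two_pow_self
  omega

theorem sixteen_le (m : Machine w M μ W L lam O) : 16 * 2 ^ lam ≤ W := by
  have h1 : 2 ^ 2 ≤ 2 ^ lam := Nat.pow_le_pow_right (by norm_num) m.hlam
  generalize hΛ : 2 ^ lam = Λ at *
  rw [m.hW, hΛ, pow_mul]
  have h3 : Λ + 1 ≤ 2 ^ Λ := Nat.lt_two_pow_self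
  have h4 : 2 ^ 4 ≤ 2 ^ Λ := Nat.pow_le_pow_right (by norm_num) (by omega)
  have h5 : (2 ^ 2) ^ Λ = 2 ^ Λ * 2 ^ Λ := by rw [← mul_pow]; norm_num
  rw [h5]
  exact Nat.mul_le_mul (by simpa using h4) (by omega)

theorem lam_lt (m : Machine w M μ W L lam O) : 16 * (lam + 1) ≤ W := by
  have h1 := m.sixteen_le
  have h2 : lam < 2 ^ lam := Nat.lt_two_pow_self
  omega

theorem lookup (m : Machine w M μ W L lam O) {σ : ℕ → ℕ} {r key : ℕ} (hr : r < 64)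
    (hk : σ r = key) (hkey : key < W ^ 12) :
    (lookup r).Safe w M μ σ ∧ (lookup r).eval μ σ = O key := by
  subst hk
  exact m.isDict σ r hr hkey

end Machine

open WordRAM.Expr in
/-- Predecessor search: register 38 receives the rank of register 31 in the set whose trie has the
number in register 30. -/
def rankBody (tag : ℕ) : Prog :=
  .seq (asg 36 (packE (packE (packE (reg 30) (reg 32 + reg 33))
    (bin .shr (reg 31) (reg 11 - (reg 32 + reg 33)))) (const tag)))
  (.seq (asg 37 (lookup 36))
  (.seq (asg 32 (reg 32 + reg 33 * bin .lt (const 0) (reg 37)))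
  (.seq (asg 34 (reg 37 + reg 34 * bin .eq (reg 37) (const 0)))
  (asg 33 (reg 33 / const 2)))))

open WordRAM.Expr in
/-- Compute into register 38 the rank of the number in register 31. -/
def rankProg (tag : ℕ) : Prog :=
  .seq (asg 32 (const 0))
  (.seq (asg 33 ((reg 11 + const 1) / const 2))
  (.seq (asg 34 (const 1))
  (.seq (asg 35 (reg 12))
  (.seq (rep 35 (rankBody tag))
  (asg 38 (reg 34 - const 1))))))

section rank
variable {w M : ℕ} {μ : ℕ → ℕ} {W L lam : ℕ} {O : ℕ → ℕ}

/-- Register 32 is the level reached, register 33 the step of the search, and register 34 caches the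
entry at the level reached; at level `0` it is `1`, that is, rank `0` plus one. Both updates are
branch-free selections. -/
theorem runs_rankBody (m : Machine w M μ W L lam O) {tag : ℕ} (htag : tag < 10) {A : Finset ℕ}
    {id b k : ℕ} (hid : id < W ^ 8) (hb : b < 2 ^ L)
    (hO : ∀ lev π, lev ≤ L → π < 2 ^ L →
      O (pack W (pack W (pack W id lev) π) tag) = trieVal L A lev π)
    {σ : ℕ → ℕ} (h10 : σ 10 = W) (h11 : σ 11 = L) (h30 : σ 30 = id) (h31 : σ 31 = b)
    (hs : σ 33 = 2 ^ k)
    (hinv : SearchInv (fun l => trieVal L A l (b / 2 ^ (L - l)) ≠ 0) lam (k + 1) (σ 32))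
    (hv : σ 34 = if σ 32 = 0 then 1 else trieVal L A (σ 32) (b / 2 ^ (L - σ 32))) :
    Runs w M μ (rankBody tag) σ 500 (fun τ =>
      SearchInv (fun l => trieVal L A l (b / 2 ^ (L - l)) ≠ 0) lam k (τ 32) ∧ τ 33 = 2 ^ k / 2 ∧
      τ 34 = (if τ 32 = 0 then 1 else trieVal L A (τ 32) (b / 2 ^ (L - τ 32))) ∧
      ∀ i, i < 32 ∨ i = 35 ∨ 37 < i → τ i = σ i) := by
  have hposL : σ 32 + 2 ^ k ≤ L := by
    have := hinv.1
    have := m.hL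
    have : 0 < 2 ^ k := by positivity
    rw [pow_succ] at *
    omega
  have hWw := m.pow_lt
  have hWW := m.le_pow
  have hLW := m.L_lt
  have hLW2 := m.two_pow_L_lt
  have hlW := m.lam_lt
  have hπ : b / 2 ^ (L - (σ 32 + 2 ^ k)) < 2 ^ L := (Nat.div_le_self _ _).trans_lt hb
  have p1 : pack W id (σ 32 + 2 ^ k) < W ^ 9 := pack_lt hid (by omega)
  have p2 : pack W (pack W id (σ 32 + 2 ^ k)) (b / 2 ^ (L - (σ 32 + 2 ^ k))) < W ^ 10 :=
    pack_lt p1 (by omega)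
  have p3 : pack W (pack W (pack W id (σ 32 + 2 ^ k)) (b / 2 ^ (L - (σ 32 + 2 ^ k)))) tag < W ^ 11 :=
    pack_lt p2 (by omega)
  have q1 := m.pow_le (i := 9) (by norm_num)
  have q2 := m.pow_le (i := 10) (by norm_num)
  have q3 := m.pow_le (i := 11) (by norm_num)
  have hOk := hO (σ 32 + 2 ^ k) (b / 2 ^ (L - (σ 32 + 2 ^ k))) hposL hπ
  have hstep := SearchInv.step (P := fun l => trieVal L A l (b / 2 ^ (L - l)) ≠ 0)
    (fun l l' h h1 h2 => trieVal_anti h h1 h2) hinv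
  set key := pack W (pack W (pack W id (σ 32 + 2 ^ k)) (b / 2 ^ (L - (σ 32 + 2 ^ k)))) tag with hkey
  have hval := m.le key
  rw [hOk] at hval
  have hv' : σ 34 ≤ W := by
    rw [hv]
    split_ifs
    · omega
    · rw [← hO _ _ (by omega) ((Nat.div_le_self _ _).trans_lt hb)]
      exact m.le _
  -- The cost of straight-line code is a closed numeral, compared with the bound by evaluation.
  refine Runs.mono (t := _) (Runs.asg_seq m.pos key (by norm_num) ?_ ?_
    (Runs.asg_seq m.pos (O key) (by norm_num) (m.lookup (by norm_num) (Function.update_self ..)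
      (by omega)).1 (m.lookup (by norm_num) (Function.update_self ..) (by omega)).2
    (Runs.asg_seq m.pos (if O key ≠ 0 then σ 32 + 2 ^ k else σ 32) (by norm_num) ?_ ?_
    (Runs.asg_seq m.pos (if O key = 0 then σ 34 else O key) (by norm_num) ?_ ?_
    (Runs.asg_of m.pos (2 ^ k / 2) (by norm_num) ?_ ?_ ?_))))) (Nat.le_of_ble_eq_true rfl) (fun _ h => h)
  · simp [h10, h11, h30, h31, hs, ← hkey]
    omega
  · simp [h10, h11, h30, h31, hs, ← hkey]
  · simp only [Expr.safe_add, Expr.safe_reg, Expr.safe_mul, Expr.safe_lt, Expr.safe_const,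
      Expr.eval_reg, Expr.eval_lt, Expr.eval_const, Expr.eval_mul, Function.update_apply, hs]
    simp
    split_ifs <;> omega
  · simp [hs, Nat.pos_iff_ne_zero]
    split_ifs <;> simp_all
  · rw [← hOk] at hval
    simp
    split_ifs <;> omega
  · simp
    split_ifs <;> simp_all
  · simp
    omega
  · simp [hs]
  · simp only [Function.update_apply]
    simp only [Nat.reduceEqDiff, if_true, if_false, true_and]
    rw [← hOk] at hstep
    have h2k : 0 < 2 ^ k := by positivity
    refine ⟨hstep, ?_, fun i hi => ?_⟩
    · by_cases h : O key = 0
      · simp [h, hv]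
      · simp only [h, if_false, ne_eq, not_false_eq_true, if_true]
        rw [if_neg (by omega), hOk]
    · rw [if_neg (by omega), if_neg (by omega), if_neg (by omega), if_neg (by omega),
        if_neg (by omega)]

theorem runs_rankProg (m : Machine w M μ W L lam O) {tag : ℕ} (htag : tag < 10) {A : Finset ℕ}
    {id b : ℕ} (hid : id < W ^ 8) (hb : b < 2 ^ L) (hA : ∀ z ∈ A, z < 2 ^ L)
    (hO : ∀ lev π, lev ≤ L → π < 2 ^ L →
      O (pack W (pack W (pack W id lev) π) tag) = trieVal L A lev π)
    {σ : ℕ → ℕ} (h10 : σ 10 = W) (h11 : σ 11 = L) (h12 : σ 12 = lam) (h30 : σ 30 = id)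
    (h31 : σ 31 = b) :
    Runs w M μ (rankProg tag) σ (600 * (lam + 1)) (fun τ =>
      τ 38 = rank A b ∧ ∀ i, i < 32 ∨ 38 < i → τ i = σ i) := by
  have hWw := m.pow_lt
  have hWW := m.le_pow
  have hLW := m.L_lt
  have hL := m.hL
  have hw := m.lt_w
  have hL1 : 1 ≤ L := by
    have : 2 ^ 2 ≤ 2 ^ lam := Nat.pow_le_pow_right (by norm_num) m.hlam
    omega
  set P : ℕ → Prop := fun l => trieVal L A l (b / 2 ^ (L - l)) ≠ 0 with hP
  set I : ℕ → (ℕ → ℕ) → Prop := fun k τ => SearchInv P lam k (τ 32) ∧ τ 33 = 2 ^ k / 2 ∧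
      τ 34 = (if τ 32 = 0 then 1 else trieVal L A (τ 32) (b / 2 ^ (L - τ 32))) ∧
      ∀ i, i < 32 ∨ 38 < i → τ i = σ i with hI
  have hstep : ∀ k τ, I (k + 1) τ → τ 35 = k + 1 → Runs w M μ (rankBody tag) τ 500
      (fun τ' => τ' 35 = k + 1 ∧ I k (Function.update τ' 35 k)) := by
    rintro k τ ⟨i1, i2, i3, i4⟩ h35
    refine (runs_rankBody m htag hid hb hO (by rw [i4 10 (by omega), h10])
      (by rw [i4 11 (by omega), h11]) (by rw [i4 30 (by omega), h30])
      (by rw [i4 31 (by omega), h31]) (k := k) (by rw [i2, pow_succ]; omega) i1 i3).mono le_rfl ?_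
    rintro τ' ⟨j1, j2, j3, j4⟩
    refine ⟨by rw [j4 35 (by omega), h35], by simpa using j1, by simpa using j2,
      by simpa using j3, fun i hi => ?_⟩
    rw [Function.update_of_ne (by omega), j4 i (by omega), i4 i hi]
  refine Runs.mono (t := _) (Runs.asg_seq m.pos 0 (by norm_num) ?_ ?_
    (Runs.asg_seq m.pos (2 ^ lam / 2) (by norm_num) ?_ ?_
    (Runs.asg_seq m.pos 1 (by norm_num) ?_ ?_
    (Runs.asg_seq m.pos lam (by norm_num) ?_ ?_
    (Runs.seq (Runs.rep m.pos (by norm_num) I hstep lam _ ?_ ?_)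
      (Q := fun τ => τ 38 = rank A b ∧ ∀ i, i < 32 ∨ 38 < i → τ i = σ i)
      (t' := 4) ?_))))) ?_ (fun _ h => h)
  · simp
  · simp
  · simp [h11]; omega
  · simp [h11, hL]
  · simp; omega
  · simp
  · simp
  · simp [h12]
  · simp
  · simp only [hI]
    refine ⟨by simpa using SearchInv.start P lam, by simp, by simp, fun i hi => ?_⟩
    rw [Function.update_of_ne (by omega), Function.update_of_ne (by omega),
      Function.update_of_ne (by omega), Function.update_of_ne (by omega)]
  · rintro τ ⟨⟨⟨s1, s2, s3⟩, i2, i3, i4⟩, h35⟩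
    rw [pow_zero] at s1 s3
    have hr := rank_eq_of_trie hL1 hA hb (pos := τ 32) (by omega)
      (fun h => by simpa [hP] using s3 (τ 32 + 1) le_rfl (by omega)) s2
    refine Runs.asg_of m.pos (rank A b) (by norm_num) ?_ ?_ ?_
    · simp only [Expr.safe_sub, Expr.safe_reg, Expr.safe_const, Expr.eval_const, Expr.eval_reg]
      refine ⟨by norm_num, by omega, ?_⟩
      rw [i3]
      split_ifs with h0
      · omega
      · have := s2 h0
        simp only [hP] at this
        omega
    · simp [i3, hr]
    · refine ⟨by simp, fun i hi => ?_⟩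
      rw [Function.update_of_ne (by omega), i4 i hi]
  · simp only [Expr.cost, Expr.cost_div]
    omega
end rank
end ApproxCounting

/-! ### Choice of the level and of the step width, and the descent as a program -/

namespace ApproxCounting
open Finset WordRAM

/-- The levels that are too small form an initial segment, so counting them finds the least
sufficient one. There are only `O(log log n)` levels, hence a linear scan is affordable. -/
theorem card_levels {g : ℕ → ℕ} (hg : Monotone g) {lam N : ℕ} (h : N ≤ g lam) :
    #{t ∈ range lam | g t < N} ≤ lam ∧ N ≤ g #{t ∈ range lam | g t < N} ∧
      ∀ i < #{t ∈ range lam | g t < N}, g i < N := by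
  classical
  have hex : ∃ t, N ≤ g t := ⟨lam, h⟩
  have hle : Nat.find hex ≤ lam := Nat.find_min' hex h
  have heq : {t ∈ range lam | g t < N} = range (Nat.find hex) := by
    ext t
    simp only [mem_filter, mem_range]
    constructor
    · rintro ⟨_, h2⟩
      by_contra! hcon
      have := hg hcon
      have := Nat.find_spec hex
      omega
    · intro ht
      exact ⟨by omega, not_le.1 (Nat.find_min hex ht)⟩
  rw [heq, card_range]
  exact ⟨hle, Nat.find_spec hex, fun i hi => not_le.1 (Nat.find_min hex hi)⟩

/-- The step width `e` that suits the level `j` and the precision `R`. -/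
def GoodWidth (j R e : ℕ) : Prop :=
  (∃ g ≤ j, e = 2 ^ g) ∧ (e = 1 ∨ 2 * e ≤ 2 ^ j / R / (j + 3)) ∧ 2 ^ j / R / (j + 3) < 4 * e

/-- The lower bound on `e` makes the step long enough. -/
theorem GoodWidth.rounds_le {j R e : ℕ} (hR : 1 ≤ R) (h : GoodWidth j R e) :
    2 ^ (j + 2) / e ≤ 16 * R * (j + 3) := by
  obtain ⟨⟨g, _, rfl⟩, -, h⟩ := h
  rw [Nat.div_div_eq_div_mul, Nat.div_lt_iff_lt_mul (by positivity)] at h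
  refine Nat.div_le_of_le_mul ?_
  rw [pow_add]
  nlinarith

/-- For `e = 1` each round is exact. Otherwise write `j = i + 1`; the upper bound on `e` gives `e *
(i + 4) ≤ 2 ^ i * ρ`, so four times the loss is at most `2 ^ (e * (i + 4)) ≤ (2 ^ 2 ^ i) ^ ρ ≤ k ^
ρ`. The factor `4` leaves room for four queries. A word `R` above `2 ^ j` forces `e = 1`, so a
truncated precision word is harmless. -/
theorem GoodWidth.error_le {j R e k k' : ℕ} (h : GoodWidth j R e) (hk' : k' ≤ k)
    (herr : k ≤ k' + 2 ^ (j + 2) / e * (2 ^ (e - 1) - 1)) (hj : ∀ i < j, 2 ^ 2 ^ i < k) {ρ : ℝ}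
    (hρ : 0 < ρ) (hRρ : R ≤ 2 ^ j → 1 / ρ ≤ R) : 4 * ((k : ℝ) - k') ≤ (k : ℝ) ^ ρ := by
  obtain ⟨⟨g, _, rfl⟩, h, -⟩ := h
  by_cases hg1 : 2 ^ g = 1
  · rw [hg1] at herr
    simp at herr
    have : k = k' := by omega
    rw [this]
    simp
    positivity
  replace h := h.resolve_left hg1
  set e := 2 ^ g with he
  have he1 : 1 ≤ e := Nat.one_le_two_pow
  have hR0 : R ≠ 0 := by rintro rfl; simp at h; omega
  have h2 : 2 * e * (R * (j + 3)) ≤ 2 ^ j := by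
    rw [Nat.div_div_eq_div_mul, Nat.le_div_iff_mul_le (by positivity)] at h
    exact h
  have hRj : R ≤ 2 ^ j := by
    refine le_trans ?_ h2
    have : 1 ≤ 2 * e * (j + 3) := Nat.succ_le_of_lt (by positivity)
    nlinarith
  have hj0 : j ≠ 0 := by
    rintro rfl
    have : 1 ≤ e * R := Nat.succ_le_of_lt (by positivity)
    norm_num at h2
    nlinarith
  obtain ⟨i, rfl⟩ := Nat.exists_eq_succ_of_ne_zero hj0
  have hki := hj i (by omega)
  have h3 : e * R * (i + 1 + 3) ≤ 2 ^ i := by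
    rw [Nat.succ_eq_add_one, pow_succ] at h2
    nlinarith
  have hρR : 1 ≤ ρ * R := by
    have := hRρ hRj
    rwa [div_le_iff₀ hρ, mul_comm] at this
  have h4 : ((e * (i + 4) : ℕ) : ℝ) ≤ 2 ^ i * ρ := by
    have h5 : ((e * R * (i + 1 + 3) : ℕ) : ℝ) ≤ 2 ^ i := by exact_mod_cast h3
    push_cast at h5 ⊢
    have h6 : (e : ℝ) * (i + 4) ≤ (e : ℝ) * (i + 4) * (ρ * R) :=
      le_mul_of_one_le_right (by positivity) hρR
    have h7 : (e : ℝ) * R * (i + 1 + 3) * ρ ≤ 2 ^ i * ρ := mul_le_mul_of_nonneg_right h5 hρ.le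
    calc _ ≤ _ := h6
      _ = (e : ℝ) * R * (i + 1 + 3) * ρ := by ring
      _ ≤ _ := h7
  have h5 : ((2 : ℝ) ^ (e * (i + 4))) ≤ (k : ℝ) ^ ρ := by
    calc (2 : ℝ) ^ (e * (i + 4)) = (2 : ℝ) ^ (((e * (i + 4) : ℕ) : ℝ)) := (Real.rpow_natCast _ _).symm
      _ ≤ (2 : ℝ) ^ ((2 : ℝ) ^ i * ρ) := Real.rpow_le_rpow_of_exponent_le (by norm_num) h4
      _ = ((2 : ℝ) ^ (2 ^ i : ℕ)) ^ ρ := by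
          rw [Real.rpow_mul (by norm_num)]
          rw [show (2 : ℝ) ^ i = ((2 ^ i : ℕ) : ℝ) by push_cast; rfl, Real.rpow_natCast]
      _ ≤ (k : ℝ) ^ ρ := Real.rpow_le_rpow (by positivity) (by exact_mod_cast hki.le) hρ.le
  have h6 : 4 * (k - k') ≤ 2 ^ (e * (i + 4)) := by
    have h7 : 2 ^ (i + 1 + 2) / e * (2 ^ (e - 1) - 1) ≤ 2 ^ (i + 1 + 2) * 2 ^ (e - 1) :=
      Nat.mul_le_mul (Nat.div_le_self _ _) (Nat.sub_le _ _)
    have h8 : 4 * (2 ^ (i + 1 + 2) * 2 ^ (e - 1)) = 2 ^ (i + e + 4) := by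
      rw [← pow_add, show (4 : ℕ) = 2 ^ 2 by norm_num, ← pow_add]
      congr 1; omega
    -- Here `2 ≤ e` is essential: it lets the product absorb the number of rounds.
    have h9 : i + e + 4 ≤ e * (i + 4) := by
      have h10 : 2 ≤ e := by omega
      nlinarith
    have := Nat.pow_le_pow_right (show 0 < 2 by norm_num) h9
    simp only [Nat.succ_eq_add_one] at herr
    omega
  have h7 : ((4 * (k - k') : ℕ) : ℝ) ≤ 2 ^ (e * (i + 4)) := by exact_mod_cast h6
  rw [Nat.cast_mul, Nat.cast_sub hk'] at h7
  push_cast at h7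
  exact h7.trans h5

theorem DescentInv.bounds {C A : Finset (ℕ × ℕ)} {e b s r acc t : ℕ}
    (h : DescentInv C A e b s r acc t) : acc ≤ #A ∧ r ≤ #C := by
  obtain ⟨Z, hZ, -, rfl, h, -⟩ := h
  have h1 : #{p ∈ A | b ≤ yRank C p} ≤ #A := card_filter_le _ _
  exact ⟨by omega, card_le_card (hZ.trans (filter_subset _ _))⟩

open WordRAM.Expr in
/-- Register 41 receives the level of the cell that answers the query. -/
def scanProg : Prog :=
  .seq (asg 41 (const 0))
  (.seq (asg 42 (const 0))
  (.seq (asg 43 (reg 12))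
  (rep 43
    (.seq (asg 44 (packE (packE (packE (reg 20) (reg 42)) (reg 40)) (const 5)))
    (.seq (asg 41 (reg 41 + bin .lt (reg 22) (lookup 44)))
    (asg 42 (reg 42 + const 1)))))))

open WordRAM.Expr in
/-- Register 47 receives a good step width. -/
def widthProg : Prog :=
  .seq (asg 46 (bin .shl (const 1) (reg 41) / reg 23 / (reg 41 + const 3)))
  (.seq (asg 47 (const 1))
  (.seq (asg 43 (reg 12))
  (rep 43
    (asg 47 (reg 47 + reg 47 * bin .lt (const 4 * reg 47) (reg 46 + const 1))))))

open WordRAM.Expr in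
/-- The descent in a cell. The count is added to register 24. -/
def descentProg : Prog :=
  .seq (asg 48 (bin .shl (const 4) (reg 41)))
  (.seq (asg 43 (reg 48 / reg 47))
  (.seq (rep 43
    (.seq (asg 48 (reg 48 - reg 47))
    (.seq (asg 49 (packE (packE (packE (packE (reg 30) (reg 47)) (reg 48))
      (bin .shr (reg 38) (reg 48))) (bin .shr (reg 45) (reg 47 - const 1))))
    (.seq (asg 44 (packE (reg 49) (const 8)))
    (.seq (asg 24 (reg 24 + lookup 44))
    (.seq (asg 44 (packE (reg 49) (const 9)))
    (asg 45 (lookup 44))))))))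
  (asg 24 (reg 24 + reg 45))))

section
variable {w M : ℕ} {μ : ℕ → ℕ} {W L lam : ℕ} {O : ℕ → ℕ}

theorem runs_scanProg (m : Machine w M μ W L lam O) {σ : ℕ → ℕ} {f : ℕ → ℕ} {id a qb : ℕ}
    (hid : id < W ^ 8) (ha : a < W) (hO : ∀ t < lam, O (pack W (pack W (pack W id t) a) 5) = f t)
    (h10 : σ 10 = W) (h12 : σ 12 = lam) (h20 : σ 20 = id) (h22 : σ 22 = qb) (h40 : σ 40 = a) :
    Runs w M μ scanProg σ (400 * (lam + 1)) (fun τ =>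
      τ 41 = #{t ∈ range lam | qb < f t} ∧ ∀ i, i < 41 ∨ 44 < i → τ i = σ i) := by
  have hWw := m.pow_lt
  have hWW := m.le_pow
  have hlam := m.lam_lt
  have hw := m.lt_w
  have q1 := m.pow_le (i := 9) (by norm_num)
  have q2 := m.pow_le (i := 10) (by norm_num)
  have q3 := m.pow_le (i := 11) (by norm_num)
  set I : ℕ → (ℕ → ℕ) → Prop := fun k τ => k ≤ lam ∧ τ 42 = lam - k ∧
      τ 41 = #{t ∈ range (lam - k) | qb < f t} ∧ ∀ i, i < 41 ∨ 44 < i → τ i = σ i with hI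
  refine Runs.mono (t := _) (Runs.asg_seq m.pos 0 (by norm_num) (by simp) rfl
    (Runs.asg_seq m.pos 0 (by norm_num) (by simp) rfl
    (Runs.asg_seq m.pos lam (by norm_num) (by simp) (by simp [h12])
    (Runs.rep m.pos (by norm_num) (t := 300) I ?_ lam _ (by simp) ?_)))) ?_ ?_
  · rintro k τ ⟨i1, i2, i3, i4⟩ h43
    have hk : lam - (k + 1) < lam := by omega
    have hOk := hO _ hk
    have p1 : pack W id (lam - (k + 1)) < W ^ 9 := pack_lt hid (by omega)
    have p2 : pack W (pack W id (lam - (k + 1))) a < W ^ 10 := pack_lt p1 ha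
    have p3 : pack W (pack W (pack W id (lam - (k + 1))) a) 5 < W ^ 11 := pack_lt p2 (by omega)
    set key := pack W (pack W (pack W id (lam - (k + 1))) a) 5 with hkey
    have hc : #{t ∈ range (lam - (k + 1)) | qb < f t} ≤ lam := by
      refine (card_filter_le _ _).trans ?_
      rw [card_range]; omega
    have hsucc : #{t ∈ range (lam - k) | qb < f t}
        = #{t ∈ range (lam - (k + 1)) | qb < f t} + if qb < O key then 1 else 0 := by
      rw [show lam - k = lam - (k + 1) + 1 by omega, range_add_one, filter_insert, hOk]
      split_ifs
      · rw [card_insert_of_notMem (by simp)]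
      · rfl
    have e20 : τ 20 = id := by rw [i4 20 (by omega), h20]
    have e10 : τ 10 = W := by rw [i4 10 (by omega), h10]
    have e40 : τ 40 = a := by rw [i4 40 (by omega), h40]
    have e22 : τ 22 = qb := by rw [i4 22 (by omega), h22]
    have hlook := m.lookup (σ := Function.update τ 44 key) (r := 44) (by norm_num)
      (Function.update_self ..) (by omega)
    refine Runs.mono (t := _) (Runs.asg_seq m.pos key (by norm_num) ?_ ?_
      (Runs.asg_seq m.pos #{t ∈ range (lam - k) | qb < f t} (by norm_num) ?_ ?_
      (Runs.asg_of m.pos (lam - k) (by norm_num) ?_ ?_ ?_)))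
      (Nat.le_of_ble_eq_true rfl) (fun _ h => h)
    · simp [e10, e20, e40, i2, ← hkey]
      omega
    · simp [e10, e20, e40, i2, ← hkey]
    · simp only [Expr.safe_add, Expr.safe_reg, Expr.safe_lt, hlook, Expr.eval_lt, Expr.eval_reg]
      simp [i3]
      split_ifs <;> omega
    · simp [hlook.2, i3, e22, hsucc]
    · simp [i2]
      omega
    · simp [i2]
      omega
    · refine ⟨by simp [h43], by omega, by simp, by simp, fun i hi => ?_⟩
      rw [Function.update_of_ne (by omega), Function.update_of_ne (by omega),
        Function.update_of_ne (by omega), Function.update_of_ne (by omega), i4 i hi]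
  · refine ⟨le_rfl, by simp, by simp, fun i hi => ?_⟩
    rw [Function.update_of_ne (by omega), Function.update_of_ne (by omega),
      Function.update_of_ne (by omega)]
  · simp only [Expr.cost]
    omega
  · rintro τ ⟨⟨_, _, i3, i4⟩, _⟩
    exact ⟨i3, i4⟩

/-- The width is doubled while four times it does not exceed the target; after `lam` rounds it has
either stopped growing or reached `2 ^ lam`, which is at least the target. -/
theorem runs_widthProg (m : Machine w M μ W L lam O) {σ : ℕ → ℕ} {j R : ℕ} (hj : j ≤ lam)
    (h12 : σ 12 = lam) (h23 : σ 23 = R) (h41 : σ 41 = j) :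
    Runs w M μ widthProg σ (400 * (lam + 1)) (fun τ =>
      GoodWidth j R (τ 47) ∧ ∀ i, i < 43 ∨ i = 45 ∨ 47 < i → τ i = σ i) := by
  have hWw := m.pow_lt
  have hWW := m.le_pow
  have hlam := m.lam_lt
  have hw := m.lt_w
  have h16 := m.sixteen_le
  have h2j : 2 ^ j ≤ 2 ^ lam := Nat.pow_le_pow_right (by norm_num) hj
  set X := 2 ^ j / R / (j + 3) with hX
  have hXj : X ≤ 2 ^ j := (Nat.div_le_self _ _).trans (Nat.div_le_self _ _)
  set I : ℕ → (ℕ → ℕ) → Prop := fun k τ => k ≤ lam ∧ τ 46 = X ∧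
      (∃ g, τ 47 = 2 ^ g ∧ (X < 4 * τ 47 ∨ g = lam - k)) ∧ (τ 47 = 1 ∨ 2 * τ 47 ≤ X) ∧
      ∀ i, i < 43 ∨ i = 45 ∨ 47 < i → τ i = σ i with hI
  refine Runs.mono (t := _) (Runs.asg_seq m.pos X (by norm_num) ?_ (by simp [h41, h23, hX])
    (Runs.asg_seq m.pos 1 (by norm_num) ?_ rfl
    (Runs.asg_seq m.pos lam (by norm_num) (by simp) (by simp [h12])
    (Runs.rep m.pos (by norm_num) (t := 300) I ?_ lam _ (by simp) ?_)))) ?_ ?_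
  · simp [h41]; omega
  · simp; omega
  · rintro k τ ⟨i1, i2, ⟨g, i3, i4⟩, i5, i6⟩ h43
    have h1g : 1 ≤ τ 47 := by rw [i3]; exact Nat.one_le_two_pow
    have h47 : τ 47 ≤ W := by omega
    refine Runs.mono (t := _) (Runs.asg_of m.pos (if 4 * τ 47 < X + 1 then 2 * τ 47 else τ 47)
      (by norm_num) ?_ ?_ ?_) (Nat.le_of_ble_eq_true rfl) (fun _ h => h)
    · simp [i2]
      split_ifs <;> omega
    · simp [i2]
      split_ifs <;> omega
    · refine ⟨by simp [h43], by omega, by simp [i2], ?_, ?_, fun i hi => ?_⟩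
      · simp only [Function.update_apply, Nat.reduceEqDiff, if_true, if_false]
        split_ifs with hc
        · exact ⟨g + 1, by rw [i3, pow_succ]; ring, Or.inr (by omega)⟩
        · exact ⟨g, i3, Or.inl (by omega)⟩
      · simp only [Function.update_apply, Nat.reduceEqDiff, if_true, if_false]
        split_ifs with hc <;> omega
      · rw [Function.update_of_ne (by omega), Function.update_of_ne (by omega), i6 i hi]
  · refine ⟨le_rfl, by simp, ⟨0, by simp⟩, by simp, fun i hi => ?_⟩
    rw [Function.update_of_ne (by omega), Function.update_of_ne (by omega),
      Function.update_of_ne (by omega)]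
  · simp only [Expr.cost, Expr.cost_div]
    omega
  · rintro τ ⟨⟨_, _, ⟨g, i3, i4⟩, i5, i6⟩, _⟩
    refine ⟨⟨⟨g, ?_, i3⟩, i5, ?_⟩, i6⟩
    · rcases i5 with h | h
      · have : g = 0 := by
          by_contra h0
          have := Nat.one_lt_two_pow h0
          omega
        omega
      · by_contra! hcon
        have := Nat.pow_lt_pow_right (show 1 < 2 by norm_num) hcon
        omega
    · rcases i4 with h | h
      · exact h
      · rw [i3, h, Nat.sub_zero]
        have : 0 < 2 ^ lam := by positivity
        omega

theorem runs_descentProg (m : Machine w M μ W L lam O) {σ : ℕ → ℕ} {C A : Finset (ℕ × ℕ)}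
    {cid b j R e : ℕ} (hj : j ≤ lam) (he : GoodWidth j R e) (hR : 1 ≤ R) (hcid : cid < W ^ 6)
    (hC : Set.InjOn Prod.fst (C : Set (ℕ × ℕ))) (hCW : #C < W) (hAW : #A < W) (hbW : b < W)
    (h8 : ∀ s π ρ, s < 2 ^ (j + 2) → π < W → ρ < W →
      O (pack W (pack W (pack W (pack W (pack W cid e) s) π) ρ) 8) = gtVal C e s π ρ)
    (h9 : ∀ s π ρ, s < 2 ^ (j + 2) → π < W → ρ < W →
      O (pack W (pack W (pack W (pack W (pack W cid e) s) π) ρ) 9) = eqVal C e s π ρ)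
    (hinv : DescentInv C A e b (2 ^ (j + 2)) (σ 45) 0 0)
    (h10 : σ 10 = W) (h24 : σ 24 ≤ 8 * W) (h30 : σ 30 = cid) (h38 : σ 38 = b) (h41 : σ 41 = j)
    (h47 : σ 47 = e) :
    Runs w M μ descentProg σ (600 * (16 * R * (j + 3) + 1)) (fun τ =>
      (∃ k', τ 24 = σ 24 + k' ∧ k' ≤ #{p ∈ A | b ≤ yRank C p} ∧
        #{p ∈ A | b ≤ yRank C p} ≤ k' + 2 ^ (j + 2) / e * (2 ^ (e - 1) - 1)) ∧
      ∀ i, i < 24 ∨ 24 < i ∧ i < 43 ∨ 49 < i → τ i = σ i) := by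
  have hWw := m.pow_lt
  have hWW := m.le_pow
  have hW2 := m.two_le
  have hw := m.lt_w
  have h16 := m.sixteen_le
  have h2j : 2 ^ j ≤ 2 ^ lam := Nat.pow_le_pow_right (by norm_num) hj
  have h4j : 2 ^ (j + 2) = 4 * 2 ^ j := by rw [pow_add]; ring
  have hrounds := he.rounds_le hR
  obtain ⟨⟨g, hgj, heg⟩, -, -⟩ := he
  have he1 : 1 ≤ e := by rw [heg]; exact Nat.one_le_two_pow
  have hej : e ≤ 2 ^ j := by rw [heg]; exact Nat.pow_le_pow_right (by norm_num) hgj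
  -- Both numbers are powers of two, so the rounds use up the bits exactly.
  have hdvd : 2 ^ (j + 2) / e * e = 2 ^ (j + 2) :=
    Nat.div_mul_cancel (by rw [heg]; exact pow_dvd_pow _ (by omega))
  have q1 := m.pow_le (i := 7) (by norm_num)
  have q2 := m.pow_le (i := 8) (by norm_num)
  have q3 := m.pow_le (i := 9) (by norm_num)
  have q4 := m.pow_le (i := 10) (by norm_num)
  have q5 := m.pow_le (i := 11) (by norm_num)
  set d := 2 ^ (j + 2) / e with hd
  set I : ℕ → (ℕ → ℕ) → Prop := fun k τ => k ≤ d ∧ τ 48 = k * e ∧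
      (∃ acc, τ 24 = σ 24 + acc ∧ DescentInv C A e b (k * e) (τ 45) acc (d - k)) ∧
      ∀ i, i < 24 ∨ 24 < i ∧ i < 43 ∨ i = 47 ∨ 49 < i → τ i = σ i with hI
  refine Runs.mono (t := _) (Runs.asg_seq m.pos (2 ^ (j + 2)) (by norm_num) ?_ ?_
    (Runs.asg_seq m.pos d (by norm_num) ?_ ?_
    (Runs.seq (Runs.rep m.pos (by norm_num) (t := 500) I ?_ d _ (by simp) ?_)
      (Q := fun τ => (∃ k', τ 24 = σ 24 + k' ∧ k' ≤ #{p ∈ A | b ≤ yRank C p} ∧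
        #{p ∈ A | b ≤ yRank C p} ≤ k' + d * (2 ^ (e - 1) - 1)) ∧
      ∀ i, i < 24 ∨ 24 < i ∧ i < 43 ∨ 49 < i → τ i = σ i)
      (t' := 4) ?_))) ?_ (fun _ h => h)
  · simp [h41]; omega
  · simp [h41]; omega
  · simp
  · simp [h47, hd]
  · rintro k τ ⟨i1, i2, ⟨acc, i3, i4⟩, i5⟩ h43
    rw [add_mul, one_mul] at i2 i4
    have hs : k * e + e ≤ 2 ^ (j + 2) := by
      rw [← hdvd, ← Nat.succ_mul]; exact Nat.mul_le_mul_right _ i1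
    obtain ⟨b1, b2⟩ := i4.bounds
    have hstep := i4.step hC
    obtain ⟨b3, b4⟩ := hstep.bounds
    have e10 : τ 10 = W := by rw [i5 10 (by omega), h10]
    have e30 : τ 30 = cid := by rw [i5 30 (by omega), h30]
    have e38 : τ 38 = b := by rw [i5 38 (by omega), h38]
    have e47 : τ 47 = e := by rw [i5 47 (by omega), h47]
    have hπ : b / 2 ^ (k * e) < W := (Nat.div_le_self _ _).trans_lt hbW
    have hρ : τ 45 / 2 ^ (e - 1) < W := (Nat.div_le_self _ _).trans_lt (by omega)
    have k8 := h8 (k * e) _ _ (by omega) hπ hρ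
    have k9 := h9 (k * e) _ _ (by omega) hπ hρ
    have p1 : pack W cid e < W ^ 7 := pack_lt hcid (by omega)
    have p2 : pack W (pack W cid e) (k * e) < W ^ 8 := pack_lt p1 (by omega)
    have p3 : pack W (pack W (pack W cid e) (k * e)) (b / 2 ^ (k * e)) < W ^ 9 := pack_lt p2 hπ
    have p4 : pack W (pack W (pack W (pack W cid e) (k * e)) (b / 2 ^ (k * e)))
      (τ 45 / 2 ^ (e - 1)) < W ^ 10 := pack_lt p3 hρ
    set q := pack W (pack W (pack W (pack W cid e) (k * e)) (b / 2 ^ (k * e)))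
      (τ 45 / 2 ^ (e - 1)) with hq
    have p5 : pack W q 8 < W ^ 11 := pack_lt p4 (by omega)
    have p6 : pack W q 9 < W ^ 11 := pack_lt p4 (by omega)
    rw [← k8, ← k9] at hstep
    rw [← k8] at b3
    refine Runs.mono (t := _) (Runs.asg_seq m.pos (k * e) (by norm_num) ?_ ?_
      (Runs.asg_seq m.pos q (by norm_num) ?_ ?_
      (Runs.asg_seq m.pos (pack W q 8) (by norm_num) ?_ ?_
      (Runs.asg_seq m.pos (σ 24 + (acc + O (pack W q 8))) (by norm_num) ?_ ?_
      (Runs.asg_seq m.pos (pack W q 9) (by norm_num) ?_ ?_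
      (Runs.asg_of m.pos (O (pack W q 9)) (by norm_num)
        (m.lookup (by norm_num) (Function.update_self ..) (by omega)).1
        (m.lookup (by norm_num) (Function.update_self ..) (by omega)).2 ?_))))))
      (Nat.le_of_ble_eq_true rfl) (fun _ h => h)
    · simp [i2, e47]
    · simp [i2, e47]
    · simp [e10, e30, e38, e47, ← hq]
      omega
    · simp [e10, e30, e38, e47, ← hq]
    · simp [e10]
      omega
    · simp [e10]
    · have hl := m.lookup (σ := Function.update (Function.update (Function.update τ 48 (k * e)) 49 q)
        44 (pack W q 8)) (r := 44) (by norm_num) (Function.update_self ..) (by omega)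
      simp only [Expr.safe_add, hl, Expr.safe_reg, Expr.eval_reg]
      simp [i3]
      omega
    · have hl := m.lookup (σ := Function.update (Function.update (Function.update τ 48 (k * e)) 49 q)
        44 (pack W q 8)) (r := 44) (by norm_num) (Function.update_self ..) (by omega)
      simp [hl.2, i3, add_assoc]
    · simp [e10]
      omega
    · simp [e10]
    · refine ⟨by simp [h43], by omega, by simp, ⟨acc + O (pack W q 8), by simp, ?_⟩,
        fun i hi => ?_⟩
      · rw [show d - k = d - (k + 1) + 1 by omega]
        simpa using hstep
      · rw [Function.update_of_ne (by omega), Function.update_of_ne (by omega),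
          Function.update_of_ne (by omega), Function.update_of_ne (by omega),
          Function.update_of_ne (by omega), Function.update_of_ne (by omega),
          Function.update_of_ne (by omega), i5 i hi]
  · refine ⟨le_rfl, by simp [hdvd], ⟨0, by simp, ?_⟩, fun i hi => ?_⟩
    · rw [hdvd, Nat.sub_self]; simpa using hinv
    · rw [Function.update_of_ne (by omega), Function.update_of_ne (by omega)]
  · rintro τ ⟨⟨_, i2, ⟨acc, i3, i4⟩, i5⟩, _⟩
    rw [zero_mul] at i4
    have hf := i4.finish
    obtain ⟨b1, b2⟩ := i4.bounds
    refine Runs.asg_of m.pos (σ 24 + (acc + τ 45)) (by norm_num) ?_ ?_ ?_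
    · simp [i3]; omega
    · simp [i3, add_assoc]
    · refine ⟨⟨acc + τ 45, by simp, hf.1, by simpa using hf.2⟩, fun i hi => ?_⟩
      rw [Function.update_of_ne (by omega), i5 i (by omega)]
  · simp only [Expr.cost, Expr.cost_div]
    omega
end
end ApproxCounting

/-! ### The dominance query on one point set -/

namespace ApproxCounting
open Finset WordRAM

theorem dict_pack {W L lam H : ℕ} {S : ℕ → Finset (ℕ × ℕ)} {k tag : ℕ} (h : tag < W) :
    dict W L lam H S (pack W k tag) = entry W L lam H S tag k := by
  rw [dict, pack_mod h, pack_div h]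

open WordRAM.Expr in
/-- Dominance counting: an approximation of the number of points, in the set with the number in
register 20, that dominate the point in registers 21 and 22, with the precision in register 23, is
added to register 24. -/
def domProg : Prog :=
  .seq (asg 30 (reg 20))
  (.seq (asg 31 (reg 21))
  (.seq (rankProg 4)
  (.seq (asg 40 (reg 38))
  (.seq scanProg
  (.seq (asg 44 (packE (packE (packE (reg 20) (reg 41)) (reg 40)) (const 6)))
  (.seq (asg 45 (lookup 44))
  (.seq (asg 30 (packE (packE (reg 20) (reg 41))
    (bin .shr (reg 40) (bin .shl (const 1) (reg 41)))))
  (.seq (asg 31 (reg 22))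
  (.seq (rankProg 7)
  (.seq widthProg descentProg))))))))))

/-- The result is added to an accumulator and is a lower bound with a quarter of the admissible
error, so that four calls can be summed. The bound `8 * W` on the accumulator rules out overflow. -/
theorem runs_domProg {w M : ℕ} {μ : ℕ → ℕ} {W L lam H : ℕ} {S : ℕ → Finset (ℕ × ℕ)}
    (m : Machine w M μ W L lam (dict W L lam H S)) {id qa qb R : ℕ} (hid : id < W ^ 4)
    (hG : GeneralPosition (S id)) (hn : #(S id) ≤ 2 ^ 2 ^ lam)
    (hS : ∀ p ∈ S id, p.1 < 2 ^ L ∧ p.2 < 2 ^ L) (hqa : qa < 2 ^ L) (hqb : qb < 2 ^ L)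
    (hR : 1 ≤ R) {σ : ℕ → ℕ} (h10 : σ 10 = W) (h11 : σ 11 = L) (h12 : σ 12 = lam)
    (h20 : σ 20 = id) (h21 : σ 21 = qa) (h22 : σ 22 = qb) (h23 : σ 23 = R) (h24 : σ 24 ≤ 8 * W) :
    Runs w M μ domProg σ (40000 * (R * (lam + 1))) (fun τ =>
      (∃ k', τ 24 = σ 24 + k' ∧ k' ≤ domCount (S id) (qa, qb) ∧
        ∀ ρ : ℝ, 0 < ρ → (R ≤ 2 ^ lam → 1 / ρ ≤ R) →
          4 * ((domCount (S id) (qa, qb) : ℝ) - k') ≤ (domCount (S id) (qa, qb) : ℝ) ^ ρ) ∧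
      ∀ i, i < 24 ∨ 49 < i → τ i = σ i) := by
  have hWw := m.pow_lt
  have hWW := m.le_pow
  have hW2 := m.two_le
  have hw := m.lt_w
  have h16 := m.sixteen_le
  have hlamW := m.lam_lt
  have hLW := m.L_lt
  have h2LW := m.two_pow_L_lt
  have hid8 : id < W ^ 8 := hid.trans_le (Nat.pow_le_pow_right (by omega) (by norm_num))
  have q5 := m.pow_le (i := 5) (by norm_num)
  have q6 := m.pow_le (i := 6) (by norm_num)
  have q7 := m.pow_le (i := 7) (by norm_num)
  have hTW : 2 ^ 2 ^ lam < W := by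
    rw [m.hW]
    exact Nat.pow_lt_pow_right (by norm_num) (by have : 0 < 2 ^ lam := by positivity
                                                 omega)
  set P := S id with hP
  set a := rank (P.image Prod.fst) qa with ha
  have haP : a ≤ #P := (rank_le_card _ _).trans card_image_le
  set N := domCount P (qa, qb) with hN
  have hNa : #(dominators P a qb) = N := card_dominators_rank P (qa, qb)
  have hNP : N ≤ #P := card_filter_le _ _
  have hO4 : ∀ lev π, lev ≤ L → π < 2 ^ L →
      dict W L lam H S (pack W (pack W (pack W id lev) π) 4)
        = trieVal L (P.image Prod.fst) lev π := by
    intro lev π hlev hπ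
    have h1 : lev < W := by omega
    have h2 : π < W := by omega
    simp [dict_pack (show 4 < W by omega), entry, pack_div, pack_mod, h1, h2, hP]
  have hO5 : ∀ t < lam, dict W L lam H S (pack W (pack W (pack W id t) a) 5)
      = threshold P (2 ^ 2 ^ t) a := by
    intro t ht
    have h1 : t < W := by omega
    have h2 : a < W := by omega
    simp [dict_pack (show 5 < W by omega), entry, pack_div, pack_mod, h1, h2, hP, ht]
  have hlev := card_levels (g := fun t => 2 ^ 2 ^ t) (lam := lam) (N := N)
    (fun s t hst => Nat.pow_le_pow_right (by norm_num) (Nat.pow_le_pow_right (by norm_num) hst))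
    (hNP.trans hn)
  set j := #{t ∈ range lam | 2 ^ 2 ^ t < N} with hj
  obtain ⟨hjlam, hNT, hTN⟩ := hlev
  -- The scan sees only thresholds, yet it computes the level determined by the unknown count `N`.
  have hscan : #{t ∈ range lam | qb < threshold P (2 ^ 2 ^ t) a} = j := by
    simp only [hj, lt_threshold_iff, hNa]
  have hjW : j < W := by omega
  set T := 2 ^ 2 ^ j with hT
  have hTpos : 0 < T := by positivity
  set c := a / T with hc
  have hcW : c < W := (Nat.div_le_self _ _).trans_lt (by omega)
  set C := cell P T c with hC
  set A : Finset (ℕ × ℕ) := {p ∈ C | a ≤ xRank P p} with hA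
  have hCP : C ⊆ P := cell_subset _ _ _
  have hCT : #C ≤ 2 * T := card_cell_le hG hTpos c
  have hCW : #C < W := (card_le_card hCP).trans_lt (by omega)
  have hO6 : dict W L lam H S (pack W (pack W (pack W id j) a) 6) = #A := by
    have h2 : a < W := by omega
    simp [dict_pack (show 6 < W by omega), entry, pack_div, pack_mod, hjW, h2, hjlam, startCount,
      hA, hC, hP, hT, hc]
  set cid := pack W (pack W id j) c with hcid
  have hcid6 : cid < W ^ 6 := pack_lt (pack_lt hid hjW) hcW
  have hcell : cellOf W lam S cid = C := cellOf_pack hjW hcW hjlam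
  have hO7 : ∀ lev π, lev ≤ L → π < 2 ^ L →
      dict W L lam H S (pack W (pack W (pack W cid lev) π) 7)
        = trieVal L (C.image Prod.snd) lev π := by
    intro lev π hlev hπ
    have h1 : lev < W := by omega
    have h2 : π < W := by omega
    simp [dict_pack (show 7 < W by omega), entry, pack_div, pack_mod, h1, h2, hcell]
  set b := rank (C.image Prod.snd) qb with hb
  have hbC : b ≤ #C := (rank_le_card _ _).trans card_image_le
  have hNA : #{p ∈ A | b ≤ yRank C p} = N := by
    rw [← hNa]
    exact card_dominators_eq (by omega)
  have hcount : ∀ e s π ρ, GoodWidth j R e → s < 2 ^ (j + 2) → π < W → ρ < W →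
      dict W L lam H S (pack W (pack W (pack W (pack W (pack W cid e) s) π) ρ) 8)
        = gtVal C e s π ρ ∧
      dict W L lam H S (pack W (pack W (pack W (pack W (pack W cid e) s) π) ρ) 9)
        = eqVal C e s π ρ := by
    intro e s π ρ he hs hπ hρ
    obtain ⟨g, hg, heg⟩ := he.1
    have h2j : 2 ^ j ≤ 2 ^ lam := Nat.pow_le_pow_right (by norm_num) hjlam
    have h4j : 2 ^ (j + 2) = 4 * 2 ^ j := by rw [pow_add]; ring
    have h4l : 2 ^ (lam + 2) = 4 * 2 ^ lam := by rw [pow_add]; ring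
    have hej : e ≤ 2 ^ j := by rw [heg]; exact Nat.pow_le_pow_right (by norm_num) hg
    have heW : e < W := by
      have : 0 < 2 ^ lam := by positivity
      omega
    have hsW : s < W := by omega
    have hex : ∃ g ≤ lam, e = 2 ^ g := ⟨g, by omega, heg⟩
    have hsl : s < 2 ^ (lam + 2) := by omega
    constructor
    · simp [dict_pack (show 8 < W by omega), entry, pack_div, pack_mod, heW, hsW, hπ, hρ, hex, hsl,
        hcell]
    · simp [dict_pack (show 9 < W by omega), entry, pack_div, pack_mod, heW, hsW, hπ, hρ, hex, hsl,
        hcell]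
  -- The inequality is strict because the rank `b` may equal the number of points of the cell, and
  -- it must still have an empty prefix.
  have h2T : 2 * T < 2 ^ 2 ^ (j + 2) := by
    rw [hT, ← pow_succ']
    refine Nat.pow_lt_pow_right (by norm_num) ?_
    have : 0 < 2 ^ j := by positivity
    rw [pow_add]
    omega
  have hstart : ∀ e, DescentInv C A e b (2 ^ (j + 2)) #A 0 0 := by
    intro e
    refine DescentInv.start (filter_subset _ _) ?_ (by omega) (by omega)
    intro p hp q hq hpq
    rw [hA, mem_filter] at hp ⊢
    exact ⟨hq, hp.2.trans (rank_mono _ hpq)⟩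
  have p1 : pack W id j < W ^ 5 := pack_lt hid hjW
  have p2 : pack W (pack W id j) a < W ^ 6 := pack_lt p1 (by omega)
  have p3 : pack W (pack W (pack W id j) a) 6 < W ^ 7 := pack_lt p2 (by omega)
  set key := pack W (pack W (pack W id j) a) 6 with hkey
  refine Runs.mono (t := _) (Runs.asg_seq m.pos id (by norm_num) (by simp) (by simp [h20])
    (Runs.asg_seq m.pos qa (by norm_num) (by simp) (by simp [h21])
    (Runs.seq (runs_rankProg m (by norm_num) (A := P.image Prod.fst) hid8 hqa ?_ hO4
      (by simp [h10]) (by simp [h11]) (by simp [h12]) (by simp) (by simp))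
      (t' := 38500 * (R * (lam + 1))) ?_))) ?_ (fun _ h => h)
  · intro z hz
    obtain ⟨p, hp, rfl⟩ := mem_image.1 hz
    exact (hS p hp).1
  · rintro τ ⟨f38, ff⟩
    have e10 : τ 10 = W := by rw [ff 10 (by omega)]; simp [h10]
    have e11 : τ 11 = L := by rw [ff 11 (by omega)]; simp [h11]
    have e12 : τ 12 = lam := by rw [ff 12 (by omega)]; simp [h12]
    have e20 : τ 20 = id := by rw [ff 20 (by omega)]; simp [h20]
    have e22 : τ 22 = qb := by rw [ff 22 (by omega)]; simp [h22]
    have e23 : τ 23 = R := by rw [ff 23 (by omega)]; simp [h23]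
    have e24 : τ 24 = σ 24 := by rw [ff 24 (by omega)]; simp
    have eF : ∀ i, i < 24 ∨ 49 < i → τ i = σ i := fun i hi => by
      rw [ff i (by omega), Function.update_of_ne (by omega), Function.update_of_ne (by omega)]
    clear ff
    refine Runs.mono (t := _) (Runs.asg_seq m.pos a (by norm_num) (by simp) (by simp [f38, ha])
      (Runs.seq (runs_scanProg m (f := fun t => threshold P (2 ^ 2 ^ t) a) (id := id) (a := a)
        (qb := qb) hid8 (by omega) hO5 (by simp [e10]) (by simp [e12]) (by simp [e20])
        (by simp [e22]) (by simp)) (t' := 38000 * (R * (lam + 1))) ?_)) ?_ (fun _ h => h)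
    · rintro υ ⟨u41, uu⟩
      rw [hscan] at u41
      have e10 : υ 10 = W := by rw [uu 10 (by omega)]; simp [e10]
      have e11 : υ 11 = L := by rw [uu 11 (by omega)]; simp [e11]
      have e12 : υ 12 = lam := by rw [uu 12 (by omega)]; simp [e12]
      have e20 : υ 20 = id := by rw [uu 20 (by omega)]; simp [e20]
      have e22 : υ 22 = qb := by rw [uu 22 (by omega)]; simp [e22]
      have e23 : υ 23 = R := by rw [uu 23 (by omega)]; simp [e23]
      have e24 : υ 24 = σ 24 := by rw [uu 24 (by omega)]; simp [e24]
      have e40 : υ 40 = a := by rw [uu 40 (by omega)]; simp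
      have eF : ∀ i, i < 24 ∨ 49 < i → υ i = σ i := fun i hi => by
        rw [uu i (by omega), Function.update_of_ne (by omega), eF i hi]
      clear uu
      refine Runs.mono (t := _) (Runs.asg_seq m.pos key (by norm_num) ?_ ?_
        (Runs.asg_seq m.pos #A (by norm_num)
          (m.lookup (by norm_num) (Function.update_self ..) (by omega)).1
          ((m.lookup (by norm_num) (Function.update_self ..) (by omega)).2.trans hO6)
        (Runs.asg_seq m.pos cid (by norm_num) ?_ ?_
        (Runs.asg_seq m.pos qb (by norm_num) (by simp) (by simp [e22])
        (Runs.seq (runs_rankProg m (by norm_num) (A := C.image Prod.snd) (id := cid) (b := qb)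
          (hcid6.trans_le (Nat.pow_le_pow_right (by omega) (by norm_num))) hqb ?_ hO7
          (by simp [e10]) (by simp [e11]) (by simp [e12]) (by simp) (by simp))
          (t' := 37000 * (R * (lam + 1))) ?_))))) ?_ (fun _ h => h)
      · simp [e10, e20, e40, u41, ← hkey]
        omega
      · simp [e10, e20, e40, u41, ← hkey]
      · have h2j : 2 ^ j ≤ 2 ^ lam := Nat.pow_le_pow_right (by norm_num) hjlam
        simp [e10, e20, e40, u41, ← hcid, ← hc, ← hT]
        omega
      · simp [e10, e20, e40, u41, ← hcid, ← hc, ← hT]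
      · intro z hz
        obtain ⟨p, hp, rfl⟩ := mem_image.1 hz
        exact (hS p (hCP hp)).2
      · rintro φ ⟨v38, vv⟩
        have e10 : φ 10 = W := by rw [vv 10 (by omega)]; simp [e10]
        have e12 : φ 12 = lam := by rw [vv 12 (by omega)]; simp [e12]
        have e23 : φ 23 = R := by rw [vv 23 (by omega)]; simp [e23]
        have e24 : φ 24 = σ 24 := by rw [vv 24 (by omega)]; simp [e24]
        have e30 : φ 30 = cid := by rw [vv 30 (by omega)]; simp
        have e41 : φ 41 = j := by rw [vv 41 (by omega)]; simp [u41]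
        have e45 : φ 45 = #A := by rw [vv 45 (by omega)]; simp
        have eF : ∀ i, i < 24 ∨ 49 < i → φ i = σ i := fun i hi => by
          rw [vv i (by omega), Function.update_of_ne (by omega), Function.update_of_ne (by omega),
            Function.update_of_ne (by omega), Function.update_of_ne (by omega), eF i hi]
        clear vv
        refine Runs.mono (t := _) (Runs.seq (runs_widthProg m hjlam e12 e23 e41)
          (t' := 600 * (16 * R * (j + 3) + 1)) ?_) ?_ (fun _ h => h)
        · rintro ψ ⟨hgood, ww⟩
          refine (runs_descentProg m (C := C) (A := A) (cid := cid) (b := b) (e := ψ 47) hjlam hgood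
            hR hcid6 (hG.1.mono (coe_subset.2 hCP)) hCW
            ((card_le_card (filter_subset _ _)).trans_lt hCW) (by omega)
            (fun s π ρ hs hπ hρ => (hcount _ s π ρ hgood hs hπ hρ).1)
            (fun s π ρ hs hπ hρ => (hcount _ s π ρ hgood hs hπ hρ).2)
            (by rw [ww 45 (by omega), e45]; exact hstart _)
            (by rw [ww 10 (by omega), e10]) (by rw [ww 24 (by omega), e24]; exact h24)
            (by rw [ww 30 (by omega), e30]) (by rw [ww 38 (by omega), v38])
            (by rw [ww 41 (by omega), e41]) rfl).mono le_rfl ?_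
          rintro χ ⟨⟨k', k1, k2, k3⟩, xx⟩
          rw [hNA] at k2 k3
          refine ⟨⟨k', by rw [k1, ww 24 (by omega), e24], k2, fun ρ hρ hRρ => ?_⟩, fun i hi => ?_⟩
          · exact hgood.error_le k2 k3 hTN hρ
              fun h => hRρ (h.trans (Nat.pow_le_pow_right (by norm_num) hjlam))
          · rw [xx i (by omega), ww i (by omega), eF i hi]
        · have h1 : 1 * (lam + 1) ≤ R * (lam + 1) := Nat.mul_le_mul_right _ hR
          have h2 : R * (j + 3) ≤ R * (3 * (lam + 1)) := Nat.mul_le_mul_left _ (by omega)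
          have h3 : R * (3 * (lam + 1)) = 3 * (R * (lam + 1)) := by ring
          rw [mul_assoc 16]
          omega
      · have h1 : 1 * (lam + 1) ≤ R * (lam + 1) := Nat.mul_le_mul_right _ hR
        have hc1 : (lookup 44).cost ≤ 200 := Nat.le_of_ble_eq_true rfl
        simp only [Expr.cost, packE, Expr.cost_add]
        omega
    · have h1 : 1 * (lam + 1) ≤ R * (lam + 1) := Nat.mul_le_mul_right _ hR
      simp only [Expr.cost]
      omega
  · have h1 : 1 * (lam + 1) ≤ R * (lam + 1) := Nat.mul_le_mul_right _ hR
    simp only [Expr.cost]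
    omega

end ApproxCounting

namespace ApproxCounting
open Finset WordRAM

/-! ### Parameters -/

/-- The number of bits of `n`. -/
def bits (n : ℕ) : ℕ := Nat.log 2 n + 1

/-- The logarithm of the number of levels of the tries. -/
def depth (n : ℕ) : ℕ := Nat.log 2 (2 * bits n) + 1

/-- The bit length of the coordinates. -/
def height (n : ℕ) : ℕ := 2 ^ depth n - 1

/-- The base of the keys. -/
def base (n : ℕ) : ℕ := 2 ^ (2 * 2 ^ depth n)

theorem lt_two_pow_bits (n : ℕ) : n < 2 ^ bits n := Nat.lt_pow_succ_log_self (by norm_num) n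

theorem three_le_bits {n : ℕ} (hn : 4 ≤ n) : 3 ≤ bits n := by
  have : 2 ≤ Nat.log 2 n := Nat.le_log_of_pow_le (by norm_num) (by omega)
  unfold bits; omega

theorem height_add_one (n : ℕ) : height n + 1 = 2 ^ depth n :=
  Nat.sub_add_cancel Nat.one_le_two_pow

theorem two_bits_le_height (n : ℕ) : 2 * bits n ≤ height n := by
  have h1 := Nat.lt_pow_succ_log_self (b := 2) (by norm_num) (2 * bits n)
  have h2 := height_add_one n
  unfold depth at h2
  omega

theorem two_pow_depth_le (n : ℕ) : 2 ^ depth n ≤ 4 * bits n := by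
  have h : 2 ^ Nat.log 2 (2 * bits n) ≤ 2 * bits n := Nat.pow_log_le_self 2 (by unfold bits; omega)
  unfold depth
  rw [pow_succ]
  omega

theorem two_le_depth {n : ℕ} (hn : 4 ≤ n) : 2 ≤ depth n := by
  have := three_le_bits hn
  have : 1 ≤ Nat.log 2 (2 * bits n) := Nat.le_log_of_pow_le (by norm_num) (by omega)
  unfold depth
  omega

/-- The data structure is one dictionary on the possibly nonzero keys, for a whole family of point
sets; its size depends only on the total size of the family. -/
theorem exists_machine {n w : ℕ} (hn : 4 ≤ n) (hw : 200 * (Nat.log 2 n + 1) ≤ w)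
    (S : ℕ → Finset (ℕ × ℕ)) (Ids : Finset ℕ) (hIds : ∀ id, id ∉ Ids → S id = ∅)
    (hG : ∀ id, GeneralPosition (S id)) (hcard : ∀ id, #(S id) ≤ n)
    (hS : ∀ id, ∀ p ∈ S id, p.2 < 2 ^ height n) :
    ∃ data : List (BitVec w),
      data.length ≤ 20 * (4 + (∑ id ∈ Ids, #(S id)) * (144 * 4 ^ depth n)) ∧
      ∀ mem : ℕ → BitVec w, Holds mem data →
        Machine w data.length (fun i => (mem i).toNat) (base n) (height n) (depth n)
          (dict (base n) (height n) (depth n) (2 ^ bits n) S) := by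
  have hb := three_le_bits hn
  have hd := two_pow_depth_le n
  have hL := height_add_one n
  have hbL := two_bits_le_height n
  have hnb := lt_two_pow_bits n
  have hbase : base n = 2 ^ (2 * 2 ^ depth n) := rfl
  have hbits : 2 ^ bits n ≤ 2 ^ height n := Nat.pow_le_pow_right (by norm_num) (by omega)
  have hLW : 2 ^ height n ≤ base n := Nat.pow_le_pow_right (by norm_num) (by omega)
  -- The exponent is `6 + 48 * 2 ^ depth n ≤ 6 + 192 * bits n`, which explains the constant `200`.
  have hbig : 64 * (base n ^ 12) ^ 2 ≤ 2 ^ w := by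
    rw [hbase, ← pow_mul, ← pow_mul, show (64 : ℕ) = 2 ^ 6 by norm_num, ← pow_add]
    refine Nat.pow_le_pow_right (by norm_num) ?_
    change 200 * bits n ≤ w at hw
    omega
  have hdep : depth n ≤ base n := by
    have h1 : depth n < 2 ^ depth n := Nat.lt_two_pow_self
    have h2 : 2 * 2 ^ depth n < 2 ^ (2 * 2 ^ depth n) := Nat.lt_two_pow_self
    omega
  have hdict : ∀ k, dict (base n) (height n) (depth n) (2 ^ bits n) S k ≤ base n :=
    dict_le hdep (by omega) hLW (fun id => (hcard id).trans (by omega)) (by omega) hS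
  have hU : base n < 2 ^ w := by
    have h2 : base n ≤ base n ^ 12 := Nat.le_self_pow (by norm_num) _
    have h3 : base n ^ 12 ≤ (base n ^ 12) ^ 2 := Nat.le_self_pow (by norm_num) _
    have : 0 < base n := by rw [hbase]; positivity
    omega
  have hU0 : 0 < base n ^ 12 := by rw [hbase]; positivity
  obtain ⟨data, hlen, hdata⟩ := exists_dict hU0 hbig
    ((allKeys S Ids (base n) (height n) (depth n)).filter (· < base n ^ 12))
    (dict (base n) (height n) (depth n) (2 ^ bits n) S)
    (fun x hx => (mem_filter.1 hx).2) (fun x _ => (hdict x).trans_lt hU)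
    (fun x hx hxK => by
      by_contra h
      exact hxK (mem_filter.2 ⟨mem_allKeys hG hIds h, hx⟩))
  refine ⟨data, ?_, fun mem hmem => ⟨?_, ?_, hbig, hdict, hL, rfl, two_le_depth hn⟩⟩
  · have := card_allKeys_le (W := base n) (S := S) (Ids := Ids) hG hL
    have := card_filter_le (allKeys S Ids (base n) (height n) (depth n)) (· < base n ^ 12)
    omega
  · omega
  · exact hdata _ fun i hi => by rw [hmem i hi]

/-! ### Running the query program -/

/-- Programs covered by `Runs` leave the memory as it was, so no cells behind the data are needed
and the data structure is ready for the next query. -/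
theorem answers_of_runs {w : ℕ} {p : Prog} {data : List (BitVec w)} {query : List ℕ} {t : ℕ}
    {T : ℝ} {Correct : ℕ → Prop} (hq : ∀ x ∈ query, x < 2 ^ w) (ht : (t : ℝ) ≤ T)
    (h : ∀ mem : ℕ → BitVec w, Holds mem data →
      Runs w data.length (fun i => (mem i).toNat) p (fun i => query.getD i 0) t
        (fun τ => Correct (τ 0))) :
    Answers data.length p data query T Correct := by
  intro mem hmem
  obtain ⟨t', ht', s', σ', he, hm, hr, hc⟩ := h mem hmem (State.init query mem)
    (fun i _ => rfl) (fun i _ => by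
      change (BitVec.ofNat w (query.getD i 0)).toNat = _
      rw [BitVec.toNat_ofNat, Nat.mod_eq_of_lt]
      rw [List.getD_eq_getElem?_getD]
      by_cases hi : i < query.length
      · simpa [hi] using hq _ (List.getElem_mem hi)
      · simp [hi])
  refine ⟨t', s', he, ?_, by rw [hr 0 (by norm_num)]; exact hc, by rw [hm]; exact hmem⟩
  exact (Nat.cast_le.2 ht').trans ht

open WordRAM.Expr in
/-- Load the parameters into registers 10 to 13. -/
def initProg : Prog :=
  .seq (asg 44 (const 1))
  (.seq (asg 10 (lookup 44))
  (.seq (asg 44 (const 2))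
  (.seq (asg 12 (lookup 44))
  (.seq (asg 44 (const 3))
  (.seq (asg 13 (lookup 44))
  (asg 11 (bin .shl (const 1) (reg 12) - const 1)))))))

theorem runs_initProg {w M : ℕ} {μ : ℕ → ℕ} {W L lam H : ℕ} {S : ℕ → Finset (ℕ × ℕ)}
    (m : Machine w M μ W L lam (dict W L lam H S)) (σ : ℕ → ℕ) :
    Runs w M μ initProg σ 1000 (fun τ => τ 10 = W ∧ τ 11 = L ∧ τ 12 = lam ∧ τ 13 = H ∧
      ∀ i < 10, τ i = σ i) := by
  have hWw := m.pow_lt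
  have hWW := m.le_pow
  have hw := m.lt_w
  have h16 := m.sixteen_le
  have hL := m.hL
  have hlam := m.lam_lt
  have hd : ∀ tag < W, dict W L lam H S tag = entry W L lam H S tag 0 := by
    intro tag h
    have := dict_pack (L := L) (lam := lam) (H := H) (S := S) (k := 0) h
    simpa [pack] using this
  have h1 : dict W L lam H S 1 = W := by rw [hd 1 (by omega)]; simp [entry]
  have h2 : dict W L lam H S 2 = lam := by rw [hd 2 (by omega)]; simp [entry]
  have h3 : dict W L lam H S 3 = H := by rw [hd 3 (by omega)]; simp [entry]
  refine Runs.mono (t := _) (Runs.asg_seq m.pos 1 (by norm_num) ?_ rfl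
    (Runs.asg_seq m.pos W (by norm_num)
      (m.lookup (by norm_num) (Function.update_self ..) (by omega)).1
      ((m.lookup (by norm_num) (Function.update_self ..) (by omega)).2.trans h1)
    (Runs.asg_seq m.pos 2 (by norm_num) ?_ rfl
    (Runs.asg_seq m.pos lam (by norm_num)
      (m.lookup (by norm_num) (Function.update_self ..) (by omega)).1
      ((m.lookup (by norm_num) (Function.update_self ..) (by omega)).2.trans h2)
    (Runs.asg_seq m.pos 3 (by norm_num) ?_ rfl
    (Runs.asg_seq m.pos H (by norm_num)
      (m.lookup (by norm_num) (Function.update_self ..) (by omega)).1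
      ((m.lookup (by norm_num) (Function.update_self ..) (by omega)).2.trans h3)
    (Runs.asg_of m.pos L (by norm_num) ?_ ?_ ?_)))))))
    (Nat.le_of_ble_eq_true rfl) (fun _ h => h)
  · simp; omega
  · simp; omega
  · simp; omega
  · simp
    have : 1 ≤ 2 ^ lam := Nat.one_le_two_pow
    omega
  · simp
    omega
  · refine ⟨by simp, by simp, by simp, by simp, fun i hi => ?_⟩
    rw [Function.update_of_ne (by omega), Function.update_of_ne (by omega),
      Function.update_of_ne (by omega), Function.update_of_ne (by omega),
      Function.update_of_ne (by omega), Function.update_of_ne (by omega),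
      Function.update_of_ne (by omega)]

/-! ### General position -/

/-- Perturb the point `p` with coordinates below `H` such that points that agree in one coordinate
are separated by the other one. -/
def perturb (H : ℕ) (p : ℕ × ℕ) : ℕ × ℕ := (p.1 * H + p.2, p.2 * H + p.1)

theorem perturb_injOn_fst {H : ℕ} : Set.InjOn (fun p => (perturb H p).1) {p | p.1 < H ∧ p.2 < H} := by
  rintro ⟨a, b⟩ ⟨_, hb⟩ ⟨c, d⟩ ⟨_, hd⟩ h
  simp only at hb hd
  have h1 : pack H a b = pack H c d := h
  have h2 := congrArg (· / H) h1
  have h3 := congrArg (· % H) h1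
  simp only [pack_div hb, pack_div hd] at h2
  simp only [pack_mod hb, pack_mod hd] at h3
  rw [h2, h3]

theorem perturb_injOn_snd {H : ℕ} : Set.InjOn (fun p => (perturb H p).2) {p | p.1 < H ∧ p.2 < H} := by
  rintro ⟨a, b⟩ ⟨ha, hb⟩ ⟨c, d⟩ ⟨hc, hd⟩ h
  have h1 : ((b, a) : ℕ × ℕ) = (d, c) := @perturb_injOn_fst H (b, a) ⟨hb, ha⟩ (d, c) ⟨hd, hc⟩ h
  simpa [and_comm] using h1

theorem generalPosition_image_perturb {H : ℕ} {P : Finset (ℕ × ℕ)}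
    (hP : ∀ p ∈ P, p.1 < H ∧ p.2 < H) : GeneralPosition (P.image (perturb H)) := by
  constructor
  · intro p hp q hq h
    obtain ⟨p, hp', rfl⟩ := mem_image.1 hp
    obtain ⟨q, hq', rfl⟩ := mem_image.1 hq
    rw [perturb_injOn_fst (hP p hp') (hP q hq') h]
  · intro p hp q hq h
    obtain ⟨p, hp', rfl⟩ := mem_image.1 hp
    obtain ⟨q, hq', rfl⟩ := mem_image.1 hq
    rw [perturb_injOn_snd (hP p hp') (hP q hq') h]

theorem perturb_injOn {H : ℕ} {P : Finset (ℕ × ℕ)} (hP : ∀ p ∈ P, p.1 < H ∧ p.2 < H) :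
    Set.InjOn (perturb H) P := fun p hp q hq h =>
  perturb_injOn_fst (hP p hp) (hP q hq) (congrArg Prod.fst h)

theorem perturb_lt {H : ℕ} {p : ℕ × ℕ} (hp : p.1 < H ∧ p.2 < H) :
    (perturb H p).1 < H * H ∧ (perturb H p).2 < H * H := by
  have h1 : (p.1 + 1) * H ≤ H * H := Nat.mul_le_mul_right _ hp.1
  have h2 : (p.2 + 1) * H ≤ H * H := Nat.mul_le_mul_right _ hp.2
  rw [add_mul, one_mul] at h1 h2
  simp only [perturb]
  omega

theorem mul_le_mul_add_iff {H a b c : ℕ} (hc : c < H) : a * H ≤ b * H + c ↔ a ≤ b := by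
  constructor
  · intro h
    by_contra! hcon
    have : (b + 1) * H ≤ a * H := Nat.mul_le_mul_right _ hcon
    rw [add_mul, one_mul] at this
    omega
  · intro h
    have : a * H ≤ b * H := Nat.mul_le_mul_right _ h
    omega

/-- The tie-breaking digit is below `H`, so scaling the query by `H` keeps all comparisons. -/
theorem domCount_image_perturb {H : ℕ} {P : Finset (ℕ × ℕ)} (hP : ∀ p ∈ P, p.1 < H ∧ p.2 < H)
    (q : ℕ × ℕ) : domCount (P.image (perturb H)) (q.1 * H, q.2 * H) = domCount P q := by
  unfold domCount
  rw [filter_image, card_image_of_injOn ((perturb_injOn hP).mono (coe_subset.2 (filter_subset _ _)))]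
  congr 1
  refine filter_congr fun p hp => ?_
  simp only [perturb, mul_le_mul_add_iff (hP p hp).1, mul_le_mul_add_iff (hP p hp).2]

/-! ### Bounds -/

theorem logb_two_le {n : ℕ} (hn : 4 ≤ n) : 2 ≤ Real.logb 2 n := by
  rw [Real.le_logb_iff_rpow_le (by norm_num) (by positivity)]
  norm_num
  exact_mod_cast hn

theorem bits_le_logb {n : ℕ} (hn : 4 ≤ n) : (bits n : ℝ) ≤ 2 * Real.logb 2 n := by
  have h1 : (Nat.log 2 n : ℝ) ≤ Real.logb 2 n := by
    have := Real.natLog_le_logb n 2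
    exact_mod_cast this
  have := logb_two_le hn
  unfold bits
  push_cast
  linarith

theorem two_pow_depth_le_logb {n : ℕ} (hn : 4 ≤ n) : ((2 ^ depth n : ℕ) : ℝ) ≤ 8 * Real.logb 2 n := by
  have h1 : ((2 ^ depth n : ℕ) : ℝ) ≤ ((4 * bits n : ℕ) : ℝ) := Nat.cast_le.2 (two_pow_depth_le n)
  have := bits_le_logb hn
  push_cast at h1 ⊢
  linarith

theorem one_le_logb_logb {n : ℕ} (hn : 4 ≤ n) : 1 ≤ Real.logb 2 (Real.logb 2 n) := by
  have h2 := logb_two_le hn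
  rw [Real.le_logb_iff_rpow_le (by norm_num) (by linarith)]
  simpa using h2

theorem depth_le_logb_logb {n : ℕ} (hn : 4 ≤ n) :
    ((depth n + 1 : ℕ) : ℝ) ≤ 5 * Real.logb 2 (Real.logb 2 n) := by
  have h2 := logb_two_le hn
  have h3 := one_le_logb_logb hn
  have h1 : (depth n : ℝ) ≤ Real.logb 2 (8 * Real.logb 2 n) := by
    rw [Real.le_logb_iff_rpow_le (by norm_num) (by linarith), Real.rpow_natCast]
    exact_mod_cast two_pow_depth_le_logb hn
  rw [Real.logb_mul (by norm_num) (by linarith), show (8 : ℝ) = 2 ^ 3 by norm_num,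
    Real.logb_pow, Real.logb_self_eq_one (by norm_num)] at h1
  push_cast
  norm_num at h1
  linarith

/-- Rounding up costs at most a factor `2` in time, as `1 < 1 / ρ`. A word below the maximum is not
truncated, so it bounds `1 / ρ` from above. -/
theorem precisionWord_spec {w : ℕ} {ρ : ℝ} (hρ : 0 < ρ) (hρ1 : ρ < 1) (hw : 2 ≤ w) :
    1 ≤ precisionWord w ρ ∧ precisionWord w ρ < 2 ^ w ∧ (precisionWord w ρ : ℝ) ≤ 2 / ρ ∧
      ∀ B < 2 ^ w - 1, precisionWord w ρ ≤ B → 1 / ρ ≤ precisionWord w ρ := by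
  have h1 : 1 < 1 / ρ := by rw [lt_div_iff₀ hρ]; linarith
  have h2 : (1 : ℕ) ≤ ⌈1 / ρ⌉₊ := Nat.one_le_ceil_iff.2 (by linarith)
  have h3 : 2 ^ 2 ≤ 2 ^ w := Nat.pow_le_pow_right (by norm_num) hw
  unfold precisionWord
  refine ⟨le_min h2 (by omega), (min_le_right _ _).trans_lt (by omega), ?_, fun B hB h => ?_⟩
  · have h4 : ((min ⌈1 / ρ⌉₊ (2 ^ w - 1) : ℕ) : ℝ) ≤ (⌈1 / ρ⌉₊ : ℝ) :=
      Nat.cast_le.2 (min_le_left _ _)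
    have h5 := Nat.ceil_lt_add_one (show 0 ≤ 1 / ρ by positivity)
    have h6 : 2 / ρ = 1 / ρ + 1 / ρ := by ring
    linarith
  · have : min ⌈1 / ρ⌉₊ (2 ^ w - 1) = ⌈1 / ρ⌉₊ := by
      rcases min_choice ⌈1 / ρ⌉₊ (2 ^ w - 1) with h' | h'
      · exact h'
      · omega
    rw [this]
    exact Nat.le_ceil _

/-- The factor `10` is `2` from rounding `1 / ρ`, times `5` from `depth_le_logb_logb`. -/
theorem time_le {n c R : ℕ} {ρ C : ℝ} (hC : 10 * (c : ℝ) ≤ C) (hn : 4 ≤ n) (hρ : 0 < ρ)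
    (hR : (R : ℝ) ≤ 2 / ρ) :
    ((c * (R * (depth n + 1)) : ℕ) : ℝ) ≤ C * ((1 / ρ) * Real.logb 2 (Real.logb 2 n)) := by
  have h1 := depth_le_logb_logb hn
  have h2 := one_le_logb_logb hn
  calc ((c * (R * (depth n + 1)) : ℕ) : ℝ) = c * (R * ((depth n + 1 : ℕ) : ℝ)) := by push_cast; ring
    _ ≤ c * ((2 / ρ) * (5 * Real.logb 2 (Real.logb 2 n))) := by gcongr
    _ = (10 * (c : ℝ)) * ((1 / ρ) * Real.logb 2 (Real.logb 2 n)) := by ring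
    _ ≤ C * ((1 / ρ) * Real.logb 2 (Real.logb 2 n)) := by gcongr

/-- The constant is `20 * 144 = 2880`, plus `5` for the additive `80`, since `n * logb 2 n ^ j` is
at least `16`. -/
theorem space_le {n s j : ℕ} (hn : 4 ≤ n) (hj : 2 ≤ j)
    (hs : s ≤ 20 * (4 + n * (144 * (2 ^ depth n) ^ j))) :
    (s : ℝ) ≤ (2885 * 8 ^ j) * (n * Real.logb 2 n ^ j) := by
  have h2 := logb_two_le hn
  have h3 := two_pow_depth_le_logb hn
  have h4 : (4 : ℝ) ≤ n := by exact_mod_cast hn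
  have h5 : (2 : ℝ) ^ 2 ≤ Real.logb 2 n ^ j :=
    (pow_le_pow_right₀ (by norm_num) hj).trans (pow_le_pow_left₀ (by norm_num) h2 j)
  have h6 : (4 : ℝ) * 2 ^ 2 ≤ n * Real.logb 2 n ^ j := by gcongr
  have h7 : (1 : ℝ) ≤ 8 ^ j := one_le_pow₀ (by norm_num)
  have h8 : 1 * (n * Real.logb 2 n ^ j) ≤ 8 ^ j * (n * Real.logb 2 n ^ j) := by gcongr
  have h9 : (s : ℝ) ≤ 20 * (4 + n * (144 * ((2 ^ depth n : ℕ) : ℝ) ^ j)) := by exact_mod_cast hs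
  have h10 : 20 * (4 + n * (144 * ((2 ^ depth n : ℕ) : ℝ) ^ j))
      ≤ 20 * (4 + n * (144 * (8 * Real.logb 2 n) ^ j)) := by gcongr
  rw [mul_pow] at h10
  linarith

theorem isApprox_of_le {ρ : ℝ} {k k' : ℕ} (h1 : k' ≤ k) (h2 : (k : ℝ) - k' ≤ (k : ℝ) ^ ρ) :
    IsApprox ρ k k' := by
  have h3 : (k' : ℝ) ≤ k := Nat.cast_le.2 h1
  have h4 : 0 ≤ (k : ℝ) ^ ρ := by positivity
  exact ⟨by linarith, by linarith⟩

/-! ### Dominance counting -/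

open WordRAM.Expr in
/-- The query program for dominance counting. -/
def dominanceProg : Prog :=
  .seq initProg
  (.seq (asg 20 (const 0))
  (.seq (asg 21 (reg 0 * reg 13))
  (.seq (asg 22 (reg 1 * reg 13))
  (.seq (asg 23 (reg 2))
  (.seq (asg 24 (const 0))
  (.seq domProg
  (asg 0 (reg 24))))))))

theorem le_two_pow_two_pow_depth (n : ℕ) : n ≤ 2 ^ 2 ^ depth n := by
  have h1 := lt_two_pow_bits n
  have h2 : 2 ^ bits n ≤ 2 ^ 2 ^ depth n := Nat.pow_le_pow_right (by norm_num) (by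
    have := two_bits_le_height n
    have := height_add_one n
    omega)
  omega

theorem Machine.two_pow_depth_lt {w M : ℕ} {μ : ℕ → ℕ} {W L lam : ℕ} {O : ℕ → ℕ}
    (m : Machine w M μ W L lam O) : 2 ^ lam < 2 ^ w - 1 := by
  have h1 := m.sixteen_le
  have h2 := m.pow_lt
  have h3 := m.le_pow
  have : 0 < 2 ^ lam := by positivity
  omega

theorem runs_dominanceProg {w M : ℕ} {μ : ℕ → ℕ} {W L lam H : ℕ} {S : ℕ → Finset (ℕ × ℕ)}
    (m : Machine w M μ W L lam (dict W L lam H S)) (hG : GeneralPosition (S 0))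
    (hcard : #(S 0) ≤ 2 ^ 2 ^ lam) (hS : ∀ p ∈ S 0, p.1 < 2 ^ L ∧ p.2 < 2 ^ L)
    {a b R : ℕ} (ha : a * H < 2 ^ L) (hb : b * H < 2 ^ L) (hR : 1 ≤ R) {σ : ℕ → ℕ}
    (h0 : σ 0 = a) (h1 : σ 1 = b) (h2 : σ 2 = R) :
    Runs w M μ dominanceProg σ (42000 * (R * (lam + 1))) (fun τ =>
      τ 0 ≤ domCount (S 0) (a * H, b * H) ∧ ∀ ρ : ℝ, 0 < ρ → (R ≤ 2 ^ lam → 1 / ρ ≤ R) →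
        4 * ((domCount (S 0) (a * H, b * H) : ℝ) - τ 0)
          ≤ (domCount (S 0) (a * H, b * H) : ℝ) ^ ρ) := by
  have hWw := m.pow_lt
  have hWW := m.le_pow
  have h2L := m.two_pow_L_lt
  have hpos : 0 < W := by omega
  have hR' : 1 * (lam + 1) ≤ R * (lam + 1) := Nat.mul_le_mul_right _ hR
  refine Runs.mono (Runs.seq (runs_initProg m σ) (t' := 41000 * (R * (lam + 1))) ?_)
    (by omega) (fun _ h => h)
  rintro τ ⟨e10, e11, e12, e13, eF⟩
  have e0 : τ 0 = a := by rw [eF 0 (by norm_num), h0]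
  have e1 : τ 1 = b := by rw [eF 1 (by norm_num), h1]
  have e2 : τ 2 = R := by rw [eF 2 (by norm_num), h2]
  refine Runs.mono (Runs.asg_seq m.pos 0 (by norm_num) (by simp) rfl
    (Runs.asg_seq m.pos (a * H) (by norm_num) ?_ (by simp [e0, e13])
    (Runs.asg_seq m.pos (b * H) (by norm_num) ?_ (by simp [e1, e13])
    (Runs.asg_seq m.pos R (by norm_num) (by simp) (by simp [e2])
    (Runs.asg_seq m.pos 0 (by norm_num) (by simp) rfl
    (Runs.seq (runs_domProg m (id := 0) (qa := a * H) (qb := b * H) (R := R) (by positivity)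
      hG hcard hS ha hb hR (by simp [e10]) (by simp [e11])
      (by simp [e12]) (by simp) (by simp) (by simp) (by simp) (by simp)) (t' := 2) ?_)))))) ?_
      (fun _ h => h)
  · simp [e0, e13]; omega
  · simp [e1, e13]; omega
  · rintro υ ⟨⟨k', k1, k2, k3⟩, -⟩
    refine Runs.asg_of m.pos k' (by norm_num) (by simp) ?_ ?_
    · rw [Expr.eval_reg, k1]; simp
    · rw [Function.update_self]
      exact ⟨k2, k3⟩
  · simp only [Expr.cost]
    omega

theorem grid_lt {n : ℕ} {p : ℕ × ℕ} (hp : p ∈ grid n) : p.1 < 2 ^ bits n ∧ p.2 < 2 ^ bits n := by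
  have h := lt_two_pow_bits n
  simp only [grid, mem_product, mem_Icc] at hp
  omega

theorem sq_two_pow_bits_le (n : ℕ) : 2 ^ bits n * 2 ^ bits n ≤ 2 ^ height n := by
  rw [← pow_add]
  exact Nat.pow_le_pow_right (by norm_num) (by have := two_bits_le_height n; omega)

theorem dominance_counting : ∃ (p : Prog) (C : ℝ) (c : ℕ), ∀ n : ℕ, 4 ≤ n →
      ∀ w : ℕ, c * (Nat.log 2 n + 1) ≤ w →
      ∀ P : Finset (ℕ × ℕ), P ⊆ grid n → P.card ≤ n →
      ∃ (M : ℕ) (data : List (BitVec w)),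
        (M : ℝ) ≤ C * (n * (Real.logb 2 n) ^ 2) ∧ data.length ≤ M ∧
        ∀ ρ : ℝ, 0 < ρ → ρ < 1 → ∀ q ∈ grid n,
          Answers M p data [q.1, q.2, precisionWord w ρ]
            (C * ((1 / ρ) * Real.logb 2 (Real.logb 2 n))) (IsApprox ρ (domCount P q)) := by
  refine ⟨dominanceProg, 420000, 200, fun n hn w hw P hP hPn => ?_⟩
  set H := 2 ^ bits n with hH
  have hPH : ∀ p ∈ P, p.1 < H ∧ p.2 < H := fun p hp => grid_lt (hP hp)
  have hHL : H * H ≤ 2 ^ height n := sq_two_pow_bits_le n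
  set S : ℕ → Finset (ℕ × ℕ) := fun id => if id = 0 then P.image (perturb H) else ∅ with hS
  have hScard : ∀ id, #(S id) ≤ n := by
    intro id
    simp only [hS]
    split_ifs
    · exact card_image_le.trans hPn
    · simp
  have hSL : ∀ id, ∀ p ∈ S id, p.1 < 2 ^ height n ∧ p.2 < 2 ^ height n := by
    intro id p hp
    simp only [hS] at hp
    split_ifs at hp
    · obtain ⟨p, hp', rfl⟩ := mem_image.1 hp
      have := perturb_lt (hPH p hp')
      omega
    · simp at hp
  obtain ⟨data, hlen, hdata⟩ := exists_machine hn hw S {0} (fun id hid => by simp [hS] at hid ⊢; simp [hid])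
    (fun id => by
      simp only [hS]
      split_ifs
      · exact generalPosition_image_perturb hPH
      · simp [GeneralPosition]) hScard (fun id p hp => (hSL id p hp).2)
  refine ⟨data.length, data, ?_, le_rfl, fun ρ hρ hρ1 q hq => ?_⟩
  · have h1 : data.length ≤ 20 * (4 + n * (144 * (2 ^ depth n) ^ 2)) := by
      refine hlen.trans ?_
      rw [sum_singleton, ← pow_mul, mul_comm (depth n), pow_mul]
      have := hScard 0
      gcongr
      norm_num
    refine (space_le hn (by norm_num) h1).trans ?_
    gcongr
    norm_num
  · have hpw := precisionWord_spec hρ hρ1 (w := w) (by omega)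
    set R := precisionWord w ρ with hRdef
    obtain ⟨hR1, hRw, hR2, hR3⟩ := hpw
    have hqH := grid_lt hq
    have hHw : H < 2 ^ w := Nat.pow_lt_pow_right (by norm_num) (by unfold bits; omega)
    refine answers_of_runs (t := 42000 * (R * (depth n + 1))) ?_ ?_ fun mem hmem => ?_
    · intro x hx
      simp only [List.mem_cons, List.not_mem_nil, or_false] at hx
      rcases hx with rfl | rfl | rfl <;> omega
    · exact time_le (c := 42000) (by norm_num) hn hρ hR2
    · have m := hdata mem hmem
      have hqa : q.1 * H < 2 ^ height n :=
        (Nat.mul_lt_mul_of_pos_right hqH.1 (by omega)).trans_le hHL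
      have hqb : q.2 * H < 2 ^ height n :=
        (Nat.mul_lt_mul_of_pos_right hqH.2 (by omega)).trans_le hHL
      have hS0 : S 0 = P.image (perturb H) := by simp [hS]
      have hcount := domCount_image_perturb hPH q
      rw [← hS0] at hcount
      have hdw : 2 ^ depth n < 2 ^ w - 1 := m.two_pow_depth_lt
      refine Runs.mono (runs_dominanceProg m (a := q.1) (b := q.2) (R := R)
        (by rw [hS0]; exact generalPosition_image_perturb hPH)
        ((hScard 0).trans (le_two_pow_two_pow_depth n)) (hSL 0) hqa hqb hR1 (by simp) (by simp)
        (by simp)) le_rfl ?_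
      rintro τ ⟨k2, k3⟩
      rw [hcount] at k2 k3
      refine isApprox_of_le k2 ?_
      have := k3 ρ hρ (hR3 _ hdw)
      have h5 : (τ 0 : ℝ) ≤ domCount P q := Nat.cast_le.2 k2
      linarith

end ApproxCounting

namespace ApproxCounting
open Finset WordRAM

/-! ### Splitting an interval into two one-sided ones -/

/-- At level `lev`, but not above it, the `L`-bit numbers `a` and `b` have different prefixes. -/
def IsSplit (L a b lev : ℕ) : Prop :=
  1 ≤ lev ∧ lev ≤ L ∧ a / 2 ^ (L - lev) ≠ b / 2 ^ (L - lev) ∧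
    a / 2 ^ (L - lev) / 2 = b / 2 ^ (L - lev) / 2

/-- Reflect an `L`-bit number if it lies in a right child `π`. -/
def fold (L π x : ℕ) : ℕ := if π % 2 = 1 then 2 ^ L - 1 - x else x

theorem fold_lt {L π x : ℕ} (hx : x < 2 ^ L) : fold L π x < 2 ^ L := by
  unfold fold
  split_ifs <;> omega

theorem fold_injOn (L π : ℕ) : Set.InjOn (fold L π) {x | x < 2 ^ L} := by
  intro x hx y hy h
  simp only [Set.mem_ofPred_eq] at hx hy
  unfold fold at h
  split_ifs at h <;> omega

/-- The two prefixes are siblings and `a < b`, so that of `a` is even and that of `b` is its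
successor. Nothing lies between the two nodes, and only the node of `b` is reflected. -/
theorem IsSplit.between_iff {L a b lev x : ℕ} (h : IsSplit L a b lev) (hab : a < b)
    (hb : b < 2 ^ L) (hx : x < 2 ^ L) :
    (a ≤ x ∧ x ≤ b) ↔
      (x / 2 ^ (L - lev) = a / 2 ^ (L - lev) ∧ a ≤ fold L (a / 2 ^ (L - lev)) x) ∨
      (x / 2 ^ (L - lev) = b / 2 ^ (L - lev) ∧ 2 ^ L - 1 - b ≤ fold L (b / 2 ^ (L - lev)) x) := by
  obtain ⟨-, -, hne, he⟩ := h
  generalize 2 ^ (L - lev) = D at *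
  have h1 : a / D ≤ b / D := Nat.div_le_div_right hab.le
  have ha2 : a / D % 2 = 0 := by omega
  have hb2 : b / D % 2 = 1 := by omega
  have hb1 : b / D = a / D + 1 := by omega
  unfold fold
  rw [if_neg (by omega), if_pos hb2]
  constructor
  · rintro ⟨h3, h4⟩
    have h5 : a / D ≤ x / D := Nat.div_le_div_right h3
    have h6 : x / D ≤ b / D := Nat.div_le_div_right h4
    omega
  · rintro (⟨h3, h4⟩ | ⟨h3, h4⟩)
    · refine ⟨h4, ?_⟩
      by_contra! hcon
      have : b / D ≤ x / D := Nat.div_le_div_right hcon.le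
      omega
    · refine ⟨?_, by omega⟩
      by_contra! hcon
      have : x / D ≤ a / D := Nat.div_le_div_right hcon.le
      omega

theorem card_filter_or_and_or {α : Type*} (s : Finset α) (A A' B B' : α → Prop)
    [DecidablePred A] [DecidablePred A'] [DecidablePred B] [DecidablePred B']
    (hA : ∀ x, A x → ¬ A' x) (hB : ∀ x, B x → ¬ B' x) :
    #{x ∈ s | (A x ∨ A' x) ∧ (B x ∨ B' x)} =
      #{x ∈ s | A x ∧ B x} + #{x ∈ s | A x ∧ B' x} + #{x ∈ s | A' x ∧ B x} +
        #{x ∈ s | A' x ∧ B' x} := by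
  simp only [card_filter, ← sum_add_distrib]
  refine sum_congr rfl fun x _ => ?_
  have h1 := hA x
  have h2 := hB x
  by_cases A x <;> by_cases A' x <;> by_cases B x <;> by_cases B' x <;> simp_all

/-- The number of the pair of tree nodes `px` at level `lx` and `py` at level `ly`. -/
def pairCode (W lx px ly py : ℕ) : ℕ := pack W (pack W (pack W lx px) ly) py

/-- The points of `P` below the pair of tree nodes with number `id`, reflected such that ranges
that leave the pair at its inner corner become dominance ranges. -/
def corner (W L : ℕ) (P : Finset (ℕ × ℕ)) (id : ℕ) : Finset (ℕ × ℕ) :=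
  if id / W / W / W ∈ Icc 1 L ∧ id / W % W ∈ Icc 1 L then
    {p ∈ P | p.1 / 2 ^ (L - id / W / W / W) = id / W / W % W ∧
      p.2 / 2 ^ (L - id / W % W) = id % W}.image
        fun p => (fold L (id / W / W % W) p.1, fold L (id % W) p.2)
  else ∅

theorem pairCode_decode (W id : ℕ) :
    pairCode W (id / W / W / W) (id / W / W % W) (id / W % W) (id % W) = id := by
  simp only [pairCode, pack_div_mod]

theorem pairCode_lt {W lx px ly py : ℕ} (h1 : lx < W) (h2 : px < W) (h3 : ly < W) (h4 : py < W) :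
    pairCode W lx px ly py < W ^ 4 :=
  pack_lt (pack_lt (pack_lt (by simpa using h1) h2) h3) h4

theorem card_corner_le (W L : ℕ) (P : Finset (ℕ × ℕ)) (id : ℕ) : #(corner W L P id) ≤ #P := by
  unfold corner
  split_ifs
  · exact card_image_le.trans (card_filter_le _ _)
  · simp

theorem corner_lt {W L id : ℕ} {P : Finset (ℕ × ℕ)} (hP : ∀ p ∈ P, p.1 < 2 ^ L ∧ p.2 < 2 ^ L) :
    ∀ p ∈ corner W L P id, p.1 < 2 ^ L ∧ p.2 < 2 ^ L := by
  intro p hp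
  unfold corner at hp
  split_ifs at hp
  · obtain ⟨q, hq, rfl⟩ := mem_image.1 hp
    have := hP q (mem_filter.1 hq).1
    exact ⟨fold_lt this.1, fold_lt this.2⟩
  · simp at hp

theorem generalPosition_corner {W L id : ℕ} {P : Finset (ℕ × ℕ)} (hG : GeneralPosition P)
    (hP : ∀ p ∈ P, p.1 < 2 ^ L ∧ p.2 < 2 ^ L) : GeneralPosition (corner W L P id) := by
  unfold corner
  split_ifs
  · constructor
    · intro p hp q hq h
      obtain ⟨p, hp', rfl⟩ := mem_image.1 hp
      obtain ⟨q, hq', rfl⟩ := mem_image.1 hq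
      have h1 := (mem_filter.1 hp').1
      have h2 := (mem_filter.1 hq').1
      rw [hG.1 h1 h2 (fold_injOn _ _ (hP p h1).1 (hP q h2).1 h)]
    · intro p hp q hq h
      obtain ⟨p, hp', rfl⟩ := mem_image.1 hp
      obtain ⟨q, hq', rfl⟩ := mem_image.1 hq
      have h1 := (mem_filter.1 hp').1
      have h2 := (mem_filter.1 hq').1
      rw [hG.2 h1 h2 (fold_injOn _ _ (hP p h1).2 (hP q h2).2 h)]
  · simp [GeneralPosition]

theorem domCount_corner {W L lx px ly py : ℕ} {P : Finset (ℕ × ℕ)}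
    (hP : ∀ p ∈ P, p.1 < 2 ^ L ∧ p.2 < 2 ^ L) (h1 : 1 ≤ lx) (h2 : lx ≤ L) (h3 : 1 ≤ ly)
    (h4 : ly ≤ L) (hL : L < W) (hpx : px < W) (hpy : py < W) (q : ℕ × ℕ) :
    domCount (corner W L P (pairCode W lx px ly py)) q =
      #{p ∈ P | (p.1 / 2 ^ (L - lx) = px ∧ q.1 ≤ fold L px p.1) ∧
        (p.2 / 2 ^ (L - ly) = py ∧ q.2 ≤ fold L py p.2)} := by
  have e1 : pairCode W lx px ly py / W / W / W = lx := by
    rw [pairCode, pack_div hpy, pack_div (by omega), pack_div hpx]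
  have e2 : pairCode W lx px ly py / W / W % W = px := by
    rw [pairCode, pack_div hpy, pack_div (by omega), pack_mod hpx]
  have e3 : pairCode W lx px ly py / W % W = ly := by
    rw [pairCode, pack_div hpy, pack_mod (by omega)]
  have e4 : pairCode W lx px ly py % W = py := pack_mod hpy
  unfold domCount corner
  rw [e1, e2, e3, e4, if_pos (by simp only [mem_Icc]; omega), filter_image, card_image_of_injOn,
    filter_filter]
  · congr 1
    refine filter_congr fun p _ => ?_
    tauto
  · intro p hp q hq h
    have hp' := hP p (mem_filter.1 (mem_filter.1 hp).1).1
    have hq' := hP q (mem_filter.1 (mem_filter.1 hq).1).1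
    exact Prod.ext (fold_injOn _ _ hp'.1 hq'.1 (congrArg Prod.fst h))
      (fold_injOn _ _ hp'.2 hq'.2 (congrArg Prod.snd h))

/-- The numbers of the pairs of tree nodes with a point below them. -/
def cornerIds (W L : ℕ) (P : Finset (ℕ × ℕ)) : Finset ℕ :=
  (P ×ˢ (Icc 1 L ×ˢ Icc 1 L)).image fun x =>
    pairCode W x.2.1 (x.1.1 / 2 ^ (L - x.2.1)) x.2.2 (x.1.2 / 2 ^ (L - x.2.2))

theorem corner_eq_empty {W L id : ℕ} {P : Finset (ℕ × ℕ)} (h : id ∉ cornerIds W L P) :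
    corner W L P id = ∅ := by
  unfold corner
  split_ifs with hl
  · rw [image_eq_empty, filter_eq_empty_iff]
    rintro p hp ⟨h1, h2⟩
    refine h (mem_image.2 ⟨(p, id / W / W / W, id / W % W), by simp [hp, mem_Icc.1 hl.1, mem_Icc.1 hl.2], ?_⟩)
    simp only [h1, h2, pairCode_decode]
  · rfl

/-- A point and a pair of levels determine the pair of nodes, so each point is stored at most `L *
L` times. -/
theorem sum_card_corner_le (W L : ℕ) (P : Finset (ℕ × ℕ)) (Ids : Finset ℕ) :
    ∑ id ∈ Ids, #(corner W L P id) ≤ #P * (L * L) := by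
  set r : ℕ × ℕ → ℕ → Prop := fun p id => (id / W / W / W ∈ Icc 1 L ∧ id / W % W ∈ Icc 1 L) ∧
    p.1 / 2 ^ (L - id / W / W / W) = id / W / W % W ∧
      p.2 / 2 ^ (L - id / W % W) = id % W with hr
  calc ∑ id ∈ Ids, #(corner W L P id) ≤ ∑ id ∈ Ids, #{p ∈ P | r p id} := by
        refine sum_le_sum fun id _ => ?_
        unfold corner
        split_ifs with h
        · refine card_image_le.trans (card_le_card fun p hp => ?_)
          obtain ⟨h1, h2⟩ := mem_filter.1 hp
          exact mem_filter.2 ⟨h1, h, h2⟩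
        · simp
    _ = ∑ p ∈ P, #{id ∈ Ids | r p id} := by
        simp only [card_filter]
        exact sum_comm
    _ ≤ ∑ p ∈ P, L * L := by
        refine sum_le_sum fun p _ => ?_
        have hc : #(Icc 1 L ×ˢ Icc 1 L) = L * L := by simp
        rw [← hc]
        refine card_le_card_of_injOn (fun id => (id / W / W / W, id / W % W)) (fun id hid => ?_) ?_
        · obtain ⟨-, h, -⟩ := mem_filter.1 hid
          exact mem_product.2 h
        · intro id hid id' hid' h
          obtain ⟨-, -, h1, h2⟩ := mem_filter.1 hid
          obtain ⟨-, -, h1', h2'⟩ := mem_filter.1 hid'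
          obtain ⟨h3, h4⟩ := Prod.mk.inj h
          rw [← pairCode_decode W id, ← pairCode_decode W id', ← h1, ← h2, ← h1', ← h2', h3, h4]
    _ = #P * (L * L) := by simp

/-- Each coordinate condition is a disjoint alternative by `IsSplit.between_iff`; the product of the
two has four cases, each a dominance range in a folded set. -/
theorem card_between_eq_sum_domCount_corner {W L a₁ b₁ a₂ b₂ lx ly : ℕ} {P : Finset (ℕ × ℕ)}
    (hP : ∀ p ∈ P, p.1 < 2 ^ L ∧ p.2 < 2 ^ L) (hx : IsSplit L a₁ b₁ lx) (hy : IsSplit L a₂ b₂ ly)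
    (hab₁ : a₁ < b₁) (hab₂ : a₂ < b₂) (hb₁ : b₁ < 2 ^ L) (hb₂ : b₂ < 2 ^ L) (hL : L < W)
    (hLW : 2 ^ L ≤ W) :
    #{p ∈ P | (a₁ ≤ p.1 ∧ p.1 ≤ b₁) ∧ (a₂ ≤ p.2 ∧ p.2 ≤ b₂)} =
      domCount (corner W L P (pairCode W lx (a₁ / 2 ^ (L - lx)) ly (a₂ / 2 ^ (L - ly)))) (a₁, a₂) +
      domCount (corner W L P (pairCode W lx (a₁ / 2 ^ (L - lx)) ly (b₂ / 2 ^ (L - ly))))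
        (a₁, 2 ^ L - 1 - b₂) +
      domCount (corner W L P (pairCode W lx (b₁ / 2 ^ (L - lx)) ly (a₂ / 2 ^ (L - ly))))
        (2 ^ L - 1 - b₁, a₂) +
      domCount (corner W L P (pairCode W lx (b₁ / 2 ^ (L - lx)) ly (b₂ / 2 ^ (L - ly))))
        (2 ^ L - 1 - b₁, 2 ^ L - 1 - b₂) := by
  have hlt : ∀ {x k : ℕ}, x < 2 ^ L → x / 2 ^ k < W := fun h =>
    ((Nat.div_le_self _ _).trans_lt h).trans_le hLW
  rw [domCount_corner hP hx.1 hx.2.1 hy.1 hy.2.1 hL (hlt (hab₁.trans hb₁)) (hlt (hab₂.trans hb₂)),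
    domCount_corner hP hx.1 hx.2.1 hy.1 hy.2.1 hL (hlt (hab₁.trans hb₁)) (hlt hb₂),
    domCount_corner hP hx.1 hx.2.1 hy.1 hy.2.1 hL (hlt hb₁) (hlt (hab₂.trans hb₂)),
    domCount_corner hP hx.1 hx.2.1 hy.1 hy.2.1 hL (hlt hb₁) (hlt hb₂),
    ← card_filter_or_and_or]
  · congr 1
    refine filter_congr fun p hp => ?_
    rw [hx.between_iff hab₁ hb₁ (hP p hp).1, hy.between_iff hab₂ hb₂ (hP p hp).2]
  · rintro p ⟨h1, -⟩ ⟨h2, -⟩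
    exact hx.2.2.1 (h1.symm.trans h2)
  · rintro p ⟨h1, -⟩ ⟨h2, -⟩
    exact hy.2.2.1 (h1.symm.trans h2)

theorem rangeCount_eq_card_image_perturb {H : ℕ} {P : Finset (ℕ × ℕ)}
    (hP : ∀ p ∈ P, p.1 < H ∧ p.2 < H) (l u : ℕ × ℕ) :
    rangeCount P l u = #{p ∈ P.image (perturb H) |
      (l.1 * H ≤ p.1 ∧ p.1 ≤ u.1 * H + (H - 1)) ∧ (l.2 * H ≤ p.2 ∧ p.2 ≤ u.2 * H + (H - 1))} := by
  unfold rangeCount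
  rw [filter_image, card_image_of_injOn ((perturb_injOn hP).mono (coe_subset.2 (filter_subset _ _)))]
  congr 1
  have key : ∀ {a b c : ℕ}, c < H → (a * H + c ≤ b * H + (H - 1) ↔ a ≤ b) := by
    intro a b c hc
    constructor
    · intro h
      by_contra! hcon
      have : (b + 1) * H ≤ a * H := Nat.mul_le_mul_right _ hcon
      rw [add_mul, one_mul] at this
      omega
    · intro h
      have : a * H ≤ b * H := Nat.mul_le_mul_right _ h
      omega
  refine filter_congr fun p hp => ?_
  simp only [perturb, mul_le_mul_add_iff (hP p hp).1, mul_le_mul_add_iff (hP p hp).2,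
    key (hP p hp).1, key (hP p hp).2]

/-! ### The level at which two numbers split -/

theorem prefix_eq_of_le {L a b l l' : ℕ} (h : a / 2 ^ (L - l) = b / 2 ^ (L - l)) (hl : l' ≤ l) :
    a / 2 ^ (L - l') = b / 2 ^ (L - l') := by
  have e : L - l' = (L - l) + ((L - l') - (L - l)) := by omega
  rw [e, pow_add, ← Nat.div_div_eq_div_mul, ← Nat.div_div_eq_div_mul, h]

/-- The search ends at the last level with equal prefixes; level `0`, where both prefixes are empty,
is the default when there is none. -/
theorem SearchInv.isSplit {L lam a b pos : ℕ} (hL : L + 1 = 2 ^ lam) (hlam : 1 ≤ L) (ha : a < 2 ^ L)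
    (hb : b < 2 ^ L) (hab : a ≠ b)
    (h : SearchInv (fun l => a / 2 ^ (L - l) = b / 2 ^ (L - l)) lam 0 pos) :
    IsSplit L a b (pos + 1) := by
  obtain ⟨h1, h2, h3⟩ := h
  have hpos : pos < L := by
    by_contra! hcon
    have := h2 (by omega)
    simp only [show L - pos = 0 by omega, pow_zero, Nat.div_one] at this
    exact hab this
  refine ⟨by omega, hpos, h3 _ (by simp) (by omega), ?_⟩
  rw [Nat.div_div_eq_div_mul, Nat.div_div_eq_div_mul, ← pow_succ,
    show L - (pos + 1) + 1 = L - pos by omega]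
  by_cases hp : pos = 0
  · subst hp
    rw [Nat.sub_zero, Nat.div_eq_of_lt ha, Nat.div_eq_of_lt hb]
  · exact h2 hp

open WordRAM.Expr in
/-- One round of the binary search for the split level. -/
def splitBody : Prog :=
  .seq (asg 32 (reg 32 + reg 33 * bin .eq (bin .shr (reg 30) (reg 11 - (reg 32 + reg 33)))
    (bin .shr (reg 31) (reg 11 - (reg 32 + reg 33)))))
  (asg 33 (reg 33 / const 2))

open WordRAM.Expr in
/-- Compute into register 32 the last level at which the numbers in registers 30 and 31 have the same
prefix. -/
def splitProg : Prog :=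
  .seq (asg 32 (const 0))
  (.seq (asg 33 ((reg 11 + const 1) / const 2))
  (.seq (asg 35 (reg 12))
  (rep 35 splitBody)))

section split
variable {w M : ℕ} {μ : ℕ → ℕ} {W L lam : ℕ} {O : ℕ → ℕ}

theorem runs_splitBody (m : Machine w M μ W L lam O) {a b k : ℕ} {σ : ℕ → ℕ} (h11 : σ 11 = L)
    (h30 : σ 30 = a) (h31 : σ 31 = b) (hs : σ 33 = 2 ^ k)
    (hinv : SearchInv (fun l => a / 2 ^ (L - l) = b / 2 ^ (L - l)) lam (k + 1) (σ 32)) :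
    Runs w M μ splitBody σ 50 (fun τ =>
      SearchInv (fun l => a / 2 ^ (L - l) = b / 2 ^ (L - l)) lam k (τ 32) ∧ τ 33 = 2 ^ k / 2 ∧
      ∀ i, i ≠ 32 → i ≠ 33 → τ i = σ i) := by
  have hposL : σ 32 + 2 ^ k ≤ L := by
    have := hinv.1
    have := m.hL
    have : 0 < 2 ^ k := by positivity
    rw [pow_succ] at *
    omega
  have hWw := m.pow_lt
  have hWW := m.le_pow
  have hLW := m.L_lt
  have hstep := SearchInv.step (P := fun l => a / 2 ^ (L - l) = b / 2 ^ (L - l))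
    (fun l l' h _ h2 => prefix_eq_of_le h h2) hinv
  set v := if a / 2 ^ (L - (σ 32 + 2 ^ k)) = b / 2 ^ (L - (σ 32 + 2 ^ k)) then σ 32 + 2 ^ k else σ 32
    with hv
  refine Runs.mono (Runs.asg_seq m.pos v (by norm_num) ?_ ?_
    (Runs.asg_of m.pos (2 ^ k / 2) (by norm_num) ?_ ?_ ?_)) (Nat.le_of_ble_eq_true rfl) (fun _ h => h)
  · simp [h11, h30, h31, hs]
    split_ifs <;> omega
  · simp [h11, h30, h31, hs, hv]
    split_ifs <;> omega
  · simp; omega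
  · simp [hs]
  · refine ⟨by simpa using hstep, by simp, fun i h1 h2 => ?_⟩
    rw [Function.update_of_ne h2, Function.update_of_ne h1]

theorem runs_splitProg (m : Machine w M μ W L lam O) {a b : ℕ} (ha : a < 2 ^ L) (hb : b < 2 ^ L)
    (hab : a ≠ b) {σ : ℕ → ℕ} (h11 : σ 11 = L) (h12 : σ 12 = lam) (h30 : σ 30 = a)
    (h31 : σ 31 = b) :
    Runs w M μ splitProg σ (100 * (lam + 1)) (fun τ =>
      IsSplit L a b (τ 32 + 1) ∧ ∀ i < 32, τ i = σ i) := by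
  have hWw := m.pow_lt
  have hWW := m.le_pow
  have hLW := m.L_lt
  have hL := m.hL
  have hw := m.lt_w
  have hL1 : 1 ≤ L := by
    have : 2 ^ 2 ≤ 2 ^ lam := Nat.pow_le_pow_right (by norm_num) m.hlam
    omega
  set I : ℕ → (ℕ → ℕ) → Prop := fun k τ =>
    SearchInv (fun l => a / 2 ^ (L - l) = b / 2 ^ (L - l)) lam k (τ 32) ∧ τ 33 = 2 ^ k / 2 ∧
      ∀ i < 32, τ i = σ i with hI
  have hstep : ∀ k τ, I (k + 1) τ → τ 35 = k + 1 → Runs w M μ splitBody τ 50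
      (fun τ' => τ' 35 = k + 1 ∧ I k (Function.update τ' 35 k)) := by
    rintro k τ ⟨i1, i2, i3⟩ h35
    refine (runs_splitBody m (by rw [i3 11 (by omega), h11]) (by rw [i3 30 (by omega), h30])
      (by rw [i3 31 (by omega), h31]) (k := k) (by rw [i2, pow_succ]; omega) i1).mono le_rfl ?_
    rintro τ' ⟨j1, j2, j3⟩
    refine ⟨by rw [j3 35 (by omega) (by omega), h35], by simpa using j1, by simpa using j2,
      fun i hi => ?_⟩
    rw [Function.update_of_ne (by omega), j3 i (by omega) (by omega), i3 i hi]
  refine Runs.mono (Runs.asg_seq m.pos 0 (by norm_num) ?_ ?_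
    (Runs.asg_seq m.pos (2 ^ lam / 2) (by norm_num) ?_ ?_
    (Runs.asg_seq m.pos lam (by norm_num) ?_ ?_
    (Runs.rep m.pos (by norm_num) I hstep lam _ ?_ ?_)))) ?_ ?_
  · simp
  · simp
  · simp [h11]; omega
  · simp [h11, hL]
  · simp
  · simp [h12]
  · simp
  · refine ⟨by simpa using SearchInv.start _ lam, by simp, fun i hi => ?_⟩
    rw [Function.update_of_ne (by omega), Function.update_of_ne (by omega),
      Function.update_of_ne (by omega)]
  · simp only [Expr.cost, Expr.cost_div]
    omega
  · rintro τ ⟨⟨i1, -, i3⟩, -⟩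
    exact ⟨i1.isSplit hL hL1 ha hb hab, i3⟩

end split

end ApproxCounting

namespace ApproxCounting
open Finset WordRAM

/-! ### Range counting -/

open WordRAM.Expr in
/-- Add to register 24 an approximation of the number of points below the pair of tree nodes that are
the prefixes of the numbers in registers `rx` and `ry`, and in the dominance range given by
registers `qx` and `qy`. -/
def cornerProg (rx ry qx qy : ℕ) : Prog :=
  .seq (asg 20 (packE (packE (packE (reg 18) (bin .shr (reg rx) (reg 11 - reg 18))) (reg 19))
    (bin .shr (reg ry) (reg 11 - reg 19))))
  (.seq (asg 21 (reg qx))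
  (.seq (asg 22 (reg qy))
  domProg))

open WordRAM.Expr in
/-- Prepare the registers for `cornerProg`. -/
def prepareProg : Prog :=
  .seq initProg
  (.seq (asg 14 (reg 0 * reg 13))
  (.seq (asg 15 (reg 2 * reg 13 + (reg 13 - const 1)))
  (.seq (asg 16 (reg 1 * reg 13))
  (.seq (asg 17 (reg 3 * reg 13 + (reg 13 - const 1)))
  (.seq (asg 30 (reg 14))
  (.seq (asg 31 (reg 15))
  (.seq splitProg
  (.seq (asg 18 (reg 32 + const 1))
  (.seq (asg 30 (reg 16))
  (.seq (asg 31 (reg 17))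
  (.seq splitProg
  (.seq (asg 19 (reg 32 + const 1))
  (.seq (asg 5 (bin .shl (const 1) (reg 11) - const 1 - reg 15))
  (.seq (asg 6 (bin .shl (const 1) (reg 11) - const 1 - reg 17))
  (.seq (asg 23 (reg 4))
  (asg 24 (const 0)))))))))))))))))

open WordRAM.Expr in
/-- The query program for range counting. -/
def rangeProg : Prog :=
  .seq prepareProg
  (.seq (cornerProg 14 16 14 16)
  (.seq (cornerProg 14 17 14 6)
  (.seq (cornerProg 15 16 5 16)
  (.seq (cornerProg 15 17 5 6)
  (asg 0 (reg 24 * bin .lt (reg 0) (reg 2 + const 1) * bin .lt (reg 1) (reg 3 + const 1)))))))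

section run
variable {w M : ℕ} {μ : ℕ → ℕ} {W L lam H : ℕ} {S : ℕ → Finset (ℕ × ℕ)}

/-- `k'` is a lower bound of `k`, up to a quarter of the admissible error for the word `R`. -/
def IsQuarterApprox (lam R k k' : ℕ) : Prop :=
  k' ≤ k ∧ ∀ ρ : ℝ, 0 < ρ → (R ≤ 2 ^ lam → 1 / ρ ≤ R) → 4 * ((k : ℝ) - k') ≤ (k : ℝ) ^ ρ

/-- The fixed reference state `σ₀` describes the registers that survive a call, so that four calls
can be chained while only the accumulator changes. -/
theorem runs_cornerProg (m : Machine w M μ W L lam (dict W L lam H S))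
    (hG : ∀ id, GeneralPosition (S id)) (hn : ∀ id, #(S id) ≤ 2 ^ 2 ^ lam)
    (hS : ∀ id, ∀ p ∈ S id, p.1 < 2 ^ L ∧ p.2 < 2 ^ L) {rx ry qx qy : ℕ} (hrx : rx < 20)
    (hry : ry < 20) (hqx : qx < 20) (hqy : qy < 20) {R acc : ℕ} (hR : 1 ≤ R) (hacc : acc ≤ 8 * W)
    {σ₀ σ : ℕ → ℕ} (h10 : σ₀ 10 = W) (h11 : σ₀ 11 = L) (h12 : σ₀ 12 = lam) (h18 : σ₀ 18 ≤ L)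
    (h19 : σ₀ 19 ≤ L) (h23 : σ₀ 23 = R) (hx : σ₀ rx < 2 ^ L) (hy : σ₀ ry < 2 ^ L)
    (hqx' : σ₀ qx < 2 ^ L) (hqy' : σ₀ qy < 2 ^ L) (hσ : ∀ i, i < 20 ∨ i = 23 → σ i = σ₀ i)
    (h24 : σ 24 = acc) :
    Runs w M μ (cornerProg rx ry qx qy) σ (41000 * (R * (lam + 1))) (fun τ =>
      ∃ k', IsQuarterApprox lam R (domCount (S (pairCode W (σ₀ 18) (σ₀ rx / 2 ^ (L - σ₀ 18)) (σ₀ 19)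
        (σ₀ ry / 2 ^ (L - σ₀ 19)))) (σ₀ qx, σ₀ qy)) k' ∧ k' ≤ W ∧ τ 24 = acc + k' ∧
        ∀ i, i < 20 ∨ i = 23 → τ i = σ₀ i) := by
  have hWw := m.pow_lt
  have hWW := m.le_pow
  have hLW := m.L_lt
  have h2L := m.two_pow_L_lt
  have hR' : 1 * (lam + 1) ≤ R * (lam + 1) := Nat.mul_le_mul_right _ hR
  have hlt : ∀ {x k : ℕ}, x < 2 ^ L → x / 2 ^ k < W := fun h =>
    (Nat.div_le_self _ _).trans_lt (by omega)
  have hx' := hlt (k := L - σ₀ 18) hx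
  have hy' := hlt (k := L - σ₀ 19) hy
  have hcode := pairCode_lt (W := W) (lx := σ₀ 18) (ly := σ₀ 19) (by omega) hx' (by omega) hy'
  have c2 : pack W (σ₀ 18) (σ₀ rx / 2 ^ (L - σ₀ 18)) < W ^ 2 :=
    pack_lt (by rw [pow_one]; omega) hx'
  have c3 : pack W (pack W (σ₀ 18) (σ₀ rx / 2 ^ (L - σ₀ 18))) (σ₀ 19) < W ^ 3 :=
    pack_lt c2 (by omega)
  have q2 := m.pow_le (i := 2) (by norm_num)
  have q3 := m.pow_le (i := 3) (by norm_num)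
  have q4 := m.pow_le (i := 4) (by norm_num)
  have hTW : 2 ^ 2 ^ lam ≤ W := by
    rw [m.hW]
    exact Nat.pow_le_pow_right (by norm_num) (by omega)
  have e10 := hσ 10 (by norm_num)
  have e11 := hσ 11 (by norm_num)
  have e12 := hσ 12 (by norm_num)
  have e18 := hσ 18 (by norm_num)
  have e19 := hσ 19 (by norm_num)
  have e23 := hσ 23 (by norm_num)
  have erx := hσ rx (by omega)
  have ery := hσ ry (by omega)
  have eqx := hσ qx (by omega)
  have eqy := hσ qy (by omega)
  set id := pairCode W (σ₀ 18) (σ₀ rx / 2 ^ (L - σ₀ 18)) (σ₀ 19) (σ₀ ry / 2 ^ (L - σ₀ 19)) with hid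
  refine Runs.mono (Runs.asg_seq m.pos id (by norm_num) ?_ ?_
    (Runs.asg_seq m.pos (σ₀ qx) (by norm_num) ?_ ?_
    (Runs.asg_seq m.pos (σ₀ qy) (by norm_num) ?_ ?_
    (runs_domProg m (id := id) (qa := σ₀ qx) (qb := σ₀ qy) (R := R) hcode (hG id) (hn id) (hS id)
      hqx' hqy' hR ?_ ?_ ?_ ?_ ?_ ?_ ?_ ?_)))) ?_ ?_
  · simp only [safe_packE, Expr.safe_reg, Expr.safe_shr, Expr.safe_sub, Expr.eval_reg,
      Expr.eval_shr, Expr.eval_sub, eval_packE, e10, e11, e18, e19, erx, ery, h10, h11]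
    simp only [pairCode] at hid
    rw [← hid]
    refine ⟨⟨⟨?_, ?_, ?_⟩, ?_, ?_⟩, ?_, ?_⟩ <;> omega
  · simp only [Expr.eval_reg, Expr.eval_shr, Expr.eval_sub, eval_packE, e10, e11, e18, e19, erx, ery,
      h10, h11]
    rfl
  · simp; omega
  · rw [Expr.eval_reg, Function.update_of_ne (by omega), eqx]
  · simp; omega
  · rw [Expr.eval_reg, Function.update_of_ne (by omega), Function.update_of_ne (by omega), eqy]
  · simp [e10, h10]
  · simp [e11, h11]
  · simp [e12, h12]
  · simp
  · simp
  · simp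
  · simp [e23, h23]
  · simp [h24]; omega
  · simp only [Expr.cost, packE, Expr.cost_add, Expr.cost_sub]
    omega
  · rintro τ ⟨⟨k', k1, k2, k3⟩, hF⟩
    refine ⟨k', ⟨k2, k3⟩, ?_, ?_, fun i hi => ?_⟩
    · have h1 : domCount (S id) (σ₀ qx, σ₀ qy) ≤ #(S id) := card_filter_le _ _
      have h2 := hn id
      omega
    · rw [k1]; simp [h24]
    · rw [hF i (by omega), Function.update_of_ne (by omega), Function.update_of_ne (by omega),
        Function.update_of_ne (by omega), hσ i hi]

theorem runs_prepareProg (m : Machine w M μ W L lam (dict W L lam H S)) {a₁ a₂ b₁ b₂ R : ℕ}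
    (hH : 2 ≤ H) (ha₁ : a₁ < H) (ha₂ : a₂ < H) (hb₁ : b₁ < H) (hb₂ : b₂ < H) (hHL : H * H ≤ 2 ^ L)
    (hR : 1 ≤ R) {σ : ℕ → ℕ} (h0 : σ 0 = a₁) (h1 : σ 1 = a₂) (h2 : σ 2 = b₁) (h3 : σ 3 = b₂)
    (h4 : σ 4 = R) :
    Runs w M μ prepareProg σ (2000 * (R * (lam + 1))) (fun τ =>
      τ 0 = a₁ ∧ τ 1 = a₂ ∧ τ 2 = b₁ ∧ τ 3 = b₂ ∧ τ 10 = W ∧ τ 11 = L ∧ τ 12 = lam ∧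
      τ 14 = a₁ * H ∧ τ 15 = b₁ * H + (H - 1) ∧ τ 16 = a₂ * H ∧ τ 17 = b₂ * H + (H - 1) ∧
      IsSplit L (a₁ * H) (b₁ * H + (H - 1)) (τ 18) ∧ IsSplit L (a₂ * H) (b₂ * H + (H - 1)) (τ 19) ∧
      τ 5 = 2 ^ L - 1 - (b₁ * H + (H - 1)) ∧ τ 6 = 2 ^ L - 1 - (b₂ * H + (H - 1)) ∧ τ 23 = R ∧
      τ 24 = 0) := by
  have hWw := m.pow_lt
  have hWW := m.le_pow
  have hLW := m.L_lt
  have h2L := m.two_pow_L_lt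
  have hw := m.lt_w
  have hR' : 1 * (lam + 1) ≤ R * (lam + 1) := Nat.mul_le_mul_right _ hR
  have hlow : ∀ {a : ℕ}, a < H → a * H < 2 ^ L := fun h =>
    (Nat.mul_lt_mul_of_pos_right h (by omega)).trans_le hHL
  have hhigh : ∀ {b : ℕ}, b < H → b * H + (H - 1) < 2 ^ L := by
    intro b h
    have : (b + 1) * H ≤ H * H := Nat.mul_le_mul_right _ h
    rw [add_mul, one_mul] at this
    omega
  -- The residues modulo `H` are `0` and `H - 1`. So the search for the split level is meaningful
  -- even for degenerate and reversed intervals.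
  have hne : ∀ a b : ℕ, a * H ≠ b * H + (H - 1) := by
    intro a b h
    have := congrArg (· % H) h
    simp only [Nat.mul_mod_left, Nat.mul_add_mod_self_right] at this
    rw [Nat.mod_eq_of_lt (by omega)] at this
    omega
  have A1 := hlow ha₁
  have A2 := hlow ha₂
  have B1 := hhigh hb₁
  have B2 := hhigh hb₂
  have N1 := hne a₁ b₁
  have N2 := hne a₂ b₂
  set x₁ := a₁ * H with hx₁
  set x₂ := a₂ * H with hx₂
  set y₁ := b₁ * H + (H - 1) with hy₁
  set y₂ := b₂ * H + (H - 1) with hy₂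
  refine Runs.mono (Runs.seq (runs_initProg m σ) (t' := 900 * (lam + 1)) ?_)
    (by omega) (fun _ h => h)
  rintro τ ⟨e10, e11, e12, e13, eF⟩
  have e0 : τ 0 = a₁ := by rw [eF 0 (by norm_num), h0]
  have e1 : τ 1 = a₂ := by rw [eF 1 (by norm_num), h1]
  have e2 : τ 2 = b₁ := by rw [eF 2 (by norm_num), h2]
  have e3 : τ 3 = b₂ := by rw [eF 3 (by norm_num), h3]
  have e4 : τ 4 = R := by rw [eF 4 (by norm_num), h4]
  refine Runs.mono (Runs.asg_seq m.pos x₁ (by norm_num) ?_ ?_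
    (Runs.asg_seq m.pos y₁ (by norm_num) ?_ ?_
    (Runs.asg_seq m.pos x₂ (by norm_num) ?_ ?_
    (Runs.asg_seq m.pos y₂ (by norm_num) ?_ ?_
    (Runs.asg_seq m.pos x₁ (by norm_num) ?_ ?_
    (Runs.asg_seq m.pos y₁ (by norm_num) ?_ ?_
    (Runs.seq (runs_splitProg m A1 B1 N1 ?_ ?_ ?_ ?_) (t' := 500 * (lam + 1)) ?_))))))) ?_
    (fun _ h => h)
  · simp [e0, e13, ← hx₁]; omega
  · simp [e0, e13, ← hx₁]
  · simp [e2, e13, ← hy₁]; omega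
  · simp [e2, e13, ← hy₁]
  · simp [e1, e13, ← hx₂]; omega
  · simp [e1, e13, ← hx₂]
  · simp [e3, e13, ← hy₂]; omega
  · simp [e3, e13, ← hy₂]
  · simp
  · simp
  · simp
  · simp
  · simp [e11]
  · simp [e12]
  · simp
  · simp
  · rintro υ ⟨hs1, hF⟩
    have f0 := hF 0 (by norm_num)
    have f1 := hF 1 (by norm_num)
    have f2 := hF 2 (by norm_num)
    have f3 := hF 3 (by norm_num)
    have f4 := hF 4 (by norm_num)
    have f10 := hF 10 (by norm_num)
    have f11 := hF 11 (by norm_num)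
    have f12 := hF 12 (by norm_num)
    have f14 := hF 14 (by norm_num)
    have f15 := hF 15 (by norm_num)
    have f16 := hF 16 (by norm_num)
    have f17 := hF 17 (by norm_num)
    simp [e0, e1, e2, e3, e4, e10, e11, e12] at f0 f1 f2 f3 f4 f10 f11 f12 f14 f15 f16 f17
    clear hF
    have hs1L := hs1.2.1
    refine Runs.mono (Runs.asg_seq m.pos (υ 32 + 1) (by norm_num) ?_ ?_
      (Runs.asg_seq m.pos x₂ (by norm_num) ?_ ?_
      (Runs.asg_seq m.pos y₂ (by norm_num) ?_ ?_
      (Runs.seq (runs_splitProg m A2 B2 N2 ?_ ?_ ?_ ?_) (t' := 100) ?_)))) ?_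
      (fun _ h => h)
    · simp; omega
    · simp
    · simp
    · simp [f16]
    · simp
    · simp [f17]
    · simp [f11]
    · simp [f12]
    · simp
    · simp
    · rintro φ ⟨hs2, hF⟩
      have g0 := hF 0 (by norm_num)
      have g1 := hF 1 (by norm_num)
      have g2 := hF 2 (by norm_num)
      have g3 := hF 3 (by norm_num)
      have g4 := hF 4 (by norm_num)
      have g10 := hF 10 (by norm_num)
      have g11 := hF 11 (by norm_num)
      have g12 := hF 12 (by norm_num)
      have g14 := hF 14 (by norm_num)
      have g15 := hF 15 (by norm_num)
      have g16 := hF 16 (by norm_num)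
      have g17 := hF 17 (by norm_num)
      have g18 := hF 18 (by norm_num)
      simp [f0, f1, f2, f3, f4] at g0 g1 g2 g3 g4
      simp [f10, f11, f12, f14, f15, f16, f17] at g10 g11 g12 g14 g15 g16 g17 g18
      clear hF
      have hs2L := hs2.2.1
      refine Runs.mono (Runs.asg_seq m.pos (φ 32 + 1) (by norm_num) ?_ ?_
        (Runs.asg_seq m.pos (2 ^ L - 1 - y₁) (by norm_num) ?_ ?_
        (Runs.asg_seq m.pos (2 ^ L - 1 - y₂) (by norm_num) ?_ ?_
        (Runs.asg_seq m.pos R (by norm_num) ?_ ?_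
        (Runs.asg_of m.pos 0 (by norm_num) ?_ ?_ ?_))))) (Nat.le_of_ble_eq_true rfl)
        (fun _ h => h)
      · simp; omega
      · simp
      · simp [g11, g15]; omega
      · simp [g11, g15]
      · simp [g11, g17]; omega
      · simp [g11, g17]
      · simp
      · simp [g4]
      · simp
      · simp
      · simp [g0, g1, g2, g3, g10, g11, g12, g14, g15, g16, g17, g18, hs1, hs2]
    · simp only [Expr.cost]
      omega
  · simp only [Expr.cost, Expr.cost_sub]
    omega

/-- Each count is at most the total, so each error is at most a quarter of the total raised to `ρ`.
-/
theorem IsQuarterApprox.add_four {lam R k₁ k₂ k₃ k₄ k₁' k₂' k₃' k₄' : ℕ}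
    (h₁ : IsQuarterApprox lam R k₁ k₁') (h₂ : IsQuarterApprox lam R k₂ k₂')
    (h₃ : IsQuarterApprox lam R k₃ k₃') (h₄ : IsQuarterApprox lam R k₄ k₄') {ρ : ℝ} (hρ : 0 < ρ)
    (hR : R ≤ 2 ^ lam → 1 / ρ ≤ R) :
    IsApprox ρ (k₁ + k₂ + k₃ + k₄) (k₁' + k₂' + k₃' + k₄') := by
  have g₁ := h₁.2 ρ hρ hR
  have g₂ := h₂.2 ρ hρ hR
  have g₃ := h₃.2 ρ hρ hR
  have g₄ := h₄.2 ρ hρ hR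
  have e : ∀ {k : ℕ}, k ≤ k₁ + k₂ + k₃ + k₄ →
      (k : ℝ) ^ ρ ≤ ((k₁ + k₂ + k₃ + k₄ : ℕ) : ℝ) ^ ρ := fun h =>
    Real.rpow_le_rpow (by positivity) (Nat.cast_le.2 h) hρ.le
  have e₁ := e (k := k₁) (by omega)
  have e₂ := e (k := k₂) (by omega)
  have e₃ := e (k := k₃) (by omega)
  have e₄ := e (k := k₄) (by omega)
  refine isApprox_of_le ?_ ?_
  · have := h₁.1
    have := h₂.1
    have := h₃.1
    have := h₄.1
    omega
  · rw [show (((k₁ + k₂ + k₃ + k₄ : ℕ) : ℝ)) - ((k₁' + k₂' + k₃' + k₄' : ℕ) : ℝ)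
      = (k₁ - k₁') + (k₂ - k₂') + (k₃ - k₃') + (k₄ - k₄') by push_cast; ring]
    linarith

theorem runs_rangeProg {P : Finset (ℕ × ℕ)} (hP : ∀ p ∈ P, p.1 < H ∧ p.2 < H)
    (m : Machine w M μ W L lam (dict W L lam H (corner W L (P.image (perturb H)))))
    (hH : 2 ≤ H) (hHL : H * H ≤ 2 ^ L) (hn : #P ≤ 2 ^ 2 ^ lam) {l u : ℕ × ℕ} {R : ℕ}
    (hl : l.1 < H ∧ l.2 < H) (hu : u.1 < H ∧ u.2 < H) (hR : 1 ≤ R) {σ : ℕ → ℕ}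
    (h0 : σ 0 = l.1) (h1 : σ 1 = l.2) (h2 : σ 2 = u.1) (h3 : σ 3 = u.2) (h4 : σ 4 = R) :
    Runs w M μ rangeProg σ (200000 * (R * (lam + 1))) (fun τ =>
      ∀ ρ : ℝ, 0 < ρ → (R ≤ 2 ^ lam → 1 / ρ ≤ R) → IsApprox ρ (rangeCount P l u) (τ 0)) := by
  set T := P.image (perturb H) with hT
  have hTL : ∀ p ∈ T, p.1 < 2 ^ L ∧ p.2 < 2 ^ L := by
    intro p hp
    obtain ⟨p, hp', rfl⟩ := mem_image.1 hp
    have := perturb_lt (hP p hp')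
    omega
  have hTG : GeneralPosition T := generalPosition_image_perturb hP
  have hTn : #T ≤ 2 ^ 2 ^ lam := card_image_le.trans hn
  have hSG : ∀ id, GeneralPosition (corner W L T id) := fun id => generalPosition_corner hTG hTL
  have hSn : ∀ id, #(corner W L T id) ≤ 2 ^ 2 ^ lam := fun id => (card_corner_le W L T id).trans hTn
  have hSL : ∀ id, ∀ p ∈ corner W L T id, p.1 < 2 ^ L ∧ p.2 < 2 ^ L := fun id => corner_lt hTL
  have hWw := m.pow_lt
  have hWW := m.le_pow
  have hLW := m.L_lt
  have h2L := m.two_pow_L_lt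
  have hR' : 1 * (lam + 1) ≤ R * (lam + 1) := Nat.mul_le_mul_right _ hR
  have hlow : ∀ {a : ℕ}, a < H → a * H < 2 ^ L := fun h =>
    (Nat.mul_lt_mul_of_pos_right h (by omega)).trans_le hHL
  have hhigh : ∀ {b : ℕ}, b < H → b * H + (H - 1) < 2 ^ L := by
    intro b h
    have : (b + 1) * H ≤ H * H := Nat.mul_le_mul_right _ h
    rw [add_mul, one_mul] at this
    omega
  have A1 := hlow hl.1
  have A2 := hlow hl.2
  have B1 := hhigh hu.1
  have B2 := hhigh hu.2
  have hHW : H ≤ W := by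
    have : 1 * H ≤ H * H := Nat.mul_le_mul_right _ (by omega)
    omega
  refine Runs.mono (Runs.seq (runs_prepareProg m hH hl.1 hl.2 hu.1 hu.2 hHL hR h0 h1 h2 h3 h4)
    (t' := 190000 * (R * (lam + 1))) ?_) (by omega) (fun _ h => h)
  rintro φ ⟨e0, e1, e2, e3, e10, e11, e12, e14, e15, e16, e17, hs1, hs2, e5, e6, e23, e24⟩
  have h18 := hs1.2.1
  have h19 := hs2.2.1
  refine Runs.mono (Runs.seq (runs_cornerProg m hSG hSn hSL (rx := 14) (ry := 16) (qx := 14)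
    (qy := 16) (by norm_num) (by norm_num) (by norm_num) (by norm_num) hR (by omega)
    e10 e11 e12 h18 h19 e23 (by omega) (by omega) (by omega) (by omega) (fun _ _ => rfl) e24)
    (t' := 41000 * (R * (lam + 1)) + (41000 * (R * (lam + 1)) + (41000 * (R * (lam + 1)) + 20))) ?_)
    (by omega) (fun _ h => h)
  rintro τ₁ ⟨k₁, a₁, b₁, c₁, d₁⟩
  refine Runs.seq (runs_cornerProg m hSG hSn hSL (rx := 14) (ry := 17) (qx := 14)
    (qy := 6) (by norm_num) (by norm_num) (by norm_num) (by norm_num) hR (by omega)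
    e10 e11 e12 h18 h19 e23 (by omega) (by omega) (by omega) (by omega) d₁ c₁) ?_
  rintro τ₂ ⟨k₂, a₂, b₂, c₂, d₂⟩
  refine Runs.seq (runs_cornerProg m hSG hSn hSL (rx := 15) (ry := 16) (qx := 5)
    (qy := 16) (by norm_num) (by norm_num) (by norm_num) (by norm_num) hR (by omega)
    e10 e11 e12 h18 h19 e23 (by omega) (by omega) (by omega) (by omega) d₂ c₂) ?_
  rintro τ₃ ⟨k₃, a₃, b₃, c₃, d₃⟩
  refine Runs.seq (runs_cornerProg m hSG hSn hSL (rx := 15) (ry := 17) (qx := 5)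
    (qy := 6) (by norm_num) (by norm_num) (by norm_num) (by norm_num) hR (by omega)
    e10 e11 e12 h18 h19 e23 (by omega) (by omega) (by omega) (by omega) d₃ c₃) ?_
  rintro τ₄ ⟨k₄, a₄, b₄, c₄, d₄⟩
  rw [e14, e16] at a₁
  rw [e14, e17, e6] at a₂
  rw [e15, e16, e5] at a₃
  rw [e15, e17, e5, e6] at a₄
  have f0 := (d₄ 0 (by norm_num)).trans e0
  have f1 := (d₄ 1 (by norm_num)).trans e1
  have f2 := (d₄ 2 (by norm_num)).trans e2
  have f3 := (d₄ 3 (by norm_num)).trans e3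
  have hw := m.lt_w
  -- For a reversed rectangle the four calls still run safely, but their sum is meaningless; the two
  -- comparison factors replace it by the exact answer `0`.
  refine Runs.mono (Runs.asg_of m.pos (if l.1 ≤ u.1 ∧ l.2 ≤ u.2 then k₁ + k₂ + k₃ + k₄ else 0)
    (by norm_num) ?_ ?_ ?_) (Nat.le_of_ble_eq_true rfl) (fun _ h => h)
  · simp [f0, f1, f2, f3, c₄]
    split_ifs <;> omega
  · simp [f0, f1, f2, f3, c₄]
    split_ifs <;> simp_all
  · intro ρ hρ hRρ
    rw [Function.update_self]
    split_ifs with hlu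
    · have hlt : ∀ {a b : ℕ}, a ≤ b → a * H < b * H + (H - 1) := by
        intro a b h
        have : a * H ≤ b * H := Nat.mul_le_mul_right _ h
        omega
      rw [rangeCount_eq_card_image_perturb hP, ← hT,
        card_between_eq_sum_domCount_corner (W := W) hTL hs1 hs2 (hlt hlu.1) (hlt hlu.2) B1 B2
          (by omega) (by omega)]
      exact a₁.add_four a₂ a₃ a₄ hρ hRρ
    · have : rangeCount P l u = 0 := by
        rw [rangeCount, card_eq_zero, filter_eq_empty_iff]
        rintro p -
        omega
      rw [this]
      exact isApprox_of_le le_rfl (by simp; positivity)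

end run

theorem range_counting : ∃ (p : Prog) (C : ℝ) (c : ℕ), ∀ n : ℕ, 4 ≤ n →
      ∀ w : ℕ, c * (Nat.log 2 n + 1) ≤ w →
      ∀ P : Finset (ℕ × ℕ), P ⊆ grid n → P.card ≤ n →
      ∃ (M : ℕ) (data : List (BitVec w)),
        (M : ℝ) ≤ C * (n * (Real.logb 2 n) ^ 4) ∧ data.length ≤ M ∧
        ∀ ρ : ℝ, 0 < ρ → ρ < 1 → ∀ l ∈ grid n, ∀ u ∈ grid n,
          Answers M p data [l.1, l.2, u.1, u.2, precisionWord w ρ]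
            (C * ((1 / ρ) * Real.logb 2 (Real.logb 2 n))) (IsApprox ρ (rangeCount P l u)) := by
  refine ⟨rangeProg, 20000000, 200, fun n hn w hw P hP hPn => ?_⟩
  set H := 2 ^ bits n with hH
  have hPH : ∀ p ∈ P, p.1 < H ∧ p.2 < H := fun p hp => grid_lt (hP hp)
  have hHL : H * H ≤ 2 ^ height n := sq_two_pow_bits_le n
  have hH2 : 2 ≤ H := Nat.le_self_pow (by have := three_le_bits hn; omega) 2
  set T := P.image (perturb H) with hT
  have hTL : ∀ p ∈ T, p.1 < 2 ^ height n ∧ p.2 < 2 ^ height n := by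
    intro p hp
    obtain ⟨p, hp', rfl⟩ := mem_image.1 hp
    have := perturb_lt (hPH p hp')
    omega
  have hTn : #T ≤ n := card_image_le.trans hPn
  obtain ⟨data, hlen, hdata⟩ := exists_machine hn hw (corner (base n) (height n) T)
    (cornerIds (base n) (height n) T) (fun id hid => corner_eq_empty hid)
    (fun id => generalPosition_corner (generalPosition_image_perturb hPH) hTL)
    (fun id => (card_corner_le _ _ T id).trans hTn) (fun id p hp => (corner_lt hTL p hp).2)
  refine ⟨data.length, data, ?_, le_rfl, fun ρ hρ hρ1 l hl u hu => ?_⟩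
  · have h1 : data.length ≤ 20 * (4 + n * (144 * (2 ^ depth n) ^ 4)) := by
      have h2 := sum_card_corner_le (base n) (height n) T (cornerIds (base n) (height n) T)
      have h3 : height n ≤ 2 ^ depth n := by have := height_add_one n; omega
      calc data.length ≤ _ := hlen
        -- Two factors `2 ^ depth n` come from the pairs of levels and two, as `4 ^ depth n`, from
        -- the dominance structures.
        _ ≤ 20 * (4 + (n * (2 ^ depth n * 2 ^ depth n)) * (144 * 4 ^ depth n)) := by
          gcongr
          exact h2.trans (by gcongr)
        _ = _ := by
          rw [show (4 : ℕ) ^ depth n = (2 ^ depth n) ^ 2 by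
            rw [← pow_mul, mul_comm (depth n), pow_mul]; norm_num]
          ring
    refine (space_le hn (by norm_num) h1).trans ?_
    gcongr
    norm_num
  · have hpw := precisionWord_spec hρ hρ1 (w := w) (by omega)
    set R := precisionWord w ρ with hRdef
    obtain ⟨hR1, hRw, hR2, hR3⟩ := hpw
    have hlH := grid_lt hl
    have huH := grid_lt hu
    have hHw : H < 2 ^ w := Nat.pow_lt_pow_right (by norm_num) (by unfold bits; omega)
    refine answers_of_runs (t := 200000 * (R * (depth n + 1))) ?_ ?_ fun mem hmem => ?_
    · intro x hx
      simp only [List.mem_cons, List.not_mem_nil, or_false] at hx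
      rcases hx with rfl | rfl | rfl | rfl | rfl <;> omega
    · exact time_le (c := 200000) (by norm_num) hn hρ hR2
    · have m := hdata mem hmem
      have hdw : 2 ^ depth n < 2 ^ w - 1 := m.two_pow_depth_lt
      exact Runs.mono (runs_rangeProg hPH m hH2 hHL (hPn.trans (le_two_pow_two_pow_depth n)) hlH huH
        hR1 (by simp) (by simp) (by simp) (by simp) (by simp)) le_rfl
        fun τ h => h ρ hρ (hR3 _ hdw)

end ApproxCounting

theorem theorem5 :
    -- dominance counting: space `O(n log² n)`, query time `O((1/ρ) log log n)`
    (∃ (p : WordRAM.Prog) (C : ℝ) (c : ℕ), ∀ n : ℕ, 4 ≤ n →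
      ∀ w : ℕ, c * (Nat.log 2 n + 1) ≤ w →
      ∀ P : Finset (ℕ × ℕ), P ⊆ ApproxCounting.grid n → P.card ≤ n →
      ∃ (M : ℕ) (data : List (BitVec w)),
        (M : ℝ) ≤ C * (n * (Real.logb 2 n) ^ 2) ∧ data.length ≤ M ∧
        ∀ ρ : ℝ, 0 < ρ → ρ < 1 → ∀ q ∈ ApproxCounting.grid n,
          WordRAM.Answers M p data
            [q.1, q.2, ApproxCounting.precisionWord w ρ]
            (C * ((1 / ρ) * Real.logb 2 (Real.logb 2 n)))
            (ApproxCounting.IsApprox ρ (ApproxCounting.domCount P q))) ∧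
    -- general range counting: space `O(n log⁴ n)`, query time `O((1/ρ) log log n)`
    (∃ (p : WordRAM.Prog) (C : ℝ) (c : ℕ), ∀ n : ℕ, 4 ≤ n →
      ∀ w : ℕ, c * (Nat.log 2 n + 1) ≤ w →
      ∀ P : Finset (ℕ × ℕ), P ⊆ ApproxCounting.grid n → P.card ≤ n →
      ∃ (M : ℕ) (data : List (BitVec w)),
        (M : ℝ) ≤ C * (n * (Real.logb 2 n) ^ 4) ∧ data.length ≤ M ∧
        ∀ ρ : ℝ, 0 < ρ → ρ < 1 →
        ∀ l ∈ ApproxCounting.grid n, ∀ u ∈ ApproxCounting.grid n,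
          WordRAM.Answers M p data
            [l.1, l.2, u.1, u.2, ApproxCounting.precisionWord w ρ]
            (C * ((1 / ρ) * Real.logb 2 (Real.logb 2 n)))
            (ApproxCounting.IsApprox ρ (ApproxCounting.rangeCount P l u))) :=
  ⟨ApproxCounting.dominance_counting, ApproxCounting.range_counting⟩
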